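/- **Source model.** Let $A\ge 2$ and $B\ge 1$ be integers and let $P_{\mathsf L}$ be a distribution on $\mathbb N$ with finite mean $\mathbb E(\mathsf L)$ such that $\mathbb P(\mathbb E(\mathsf L)/2\le \mathsf L\le 2\mathbb E(\mathsf L))=1$ and $A\le 2^{\mathbb E(\mathsf L)/2-1}$. Draw lengths $\mathsf L_1,\dots,\mathsf L_A$ i.i.d. from $P_{\mathsf L}$ and then, for $a=1,\dots,A$, a binary string $\mathsf X_a$ uniformly from $\{0,1\}^{\mathsf L_a}\setminus\{\mathsf X_1,\dots,\mathsf X_{a-1}\}$. Draw $\mathsf Y_1,\dots,\mathsf Y_B$ i.i.d. uniformly from $\{\mathsf X_1,\dots,\mathsf X_A\}$ and let $\mathsf S=\mathsf Y_1\mathsf Y_2\cdots\mathsf Y_B$ be their concatenation. Let $R^\star$ be the infimum, over all prefix-free binary codes for the random variable $\mathsf S$ (that is, for its support), of the expected codeword length. **Multi-chunk deduplication.** Fix a prefix-free code for the positive integers that uses at most $2\log n+3$ bits for $n$ (e.g. an Elias code), and an anchor length $M\ge 1$. Parse $\mathsf S=\mathsf Z_1\cdots\mathsf Z_{\mathsf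 C}$, where each chunk, except perhaps the last, is the shortest string of length at least $2^{M-1}$ ending in $0^M$. First encode the length of $\mathsf S$ with the integer code. Then process the chunks from $c=1$. Call a chunk new if it differs from all earlier chunks; the dictionary at $c$ is the list of distinct chunks among $\mathsf Z_1,\dots,\mathsf Z_{c-1}$ in order of first appearance. If $\mathsf Z_c$ is new, let $V$ be the largest integer such that $\mathsf Z_c,\dots,\mathsf Z_{c+V-1}$ are all new; write the bit $1$, the codeword of $V$, and the string $\mathsf Z_c\cdots\mathsf Z_{c+V-1}$, and continue with chunk $c+V$. Otherwise let $\tilde c<c$ be the smallest index with $\mathsf Z_{\tilde c}=\mathsf Z_c$ and let $W$ be the largest integer such that $(\mathsf Z_{\tilde c},\dots,\mathsf Z_{\tilde c+W-1})=(\mathsf Z_c,\dots,\mathsf Z_{c+W-1})$; write the bit $0$, the codeword of $W$, and the position of $\mathsf Z_c$ in the dictionary using $\lceil\log d\rceil$ bits, where $d$ is the dictionary size at $c$, and continue with chunk $c+W$. Let $R_{\mathsf{MC}}$ be the infimum over $M\ge1$ of the expected number of encoded bits. All logarithms are to base two and $x^+=\max\{x,0\}$. **Theorem.** Always $1\le R_{\mathsf{MC}}/R^\star$.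 There are universal constants $C$ and $B_0$ such that for all $B\ge B_0$, all $A$ and all $P_{\mathsf L}$ as above, $$\frac{R_{\mathsf{MC}}}{R^\star}\le 1+C\,\frac{B\log\bigl(AB\,\mathbb E(\mathsf L)\bigr)}{\bigl(\min\{A,B\}(\mathbb E(\mathsf L)-1)+(B-A)^+\log(A/2)-2B\log(2\mathbb E(\mathsf L))\bigr)^+},$$ where the right-hand side is read as $+\infty$ if the denominator is $0$. Consequently: * (order optimality) for every $\varepsilon>0$ there are $C_\varepsilon$ and $B_\varepsilon$ such that $R_{\mathsf{MC}}\le C_\varepsilon R^\star$ whenever $B\ge B_\varepsilon$, $B^\varepsilon\le A\le(1-\varepsilon)B$ and $\mathbb E(\mathsf L)\le A^{\varepsilon/3}$; * (asymptotic optimality) along every sequence of such sources with $B\to\infty$, $A\le B$ eventually, and $B=o\bigl(A\,\mathbb E(\mathsf L)/\log(A\,\mathbb E(\mathsf L))\bigr)$, one has $R_{\mathsf{MC}}/R^\star\to1$. -/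

import Mathlib

open Filter Topology Asymptotics

namespace Dedup

/-! ### Source model -/

/-- The mean of a length distribution. -/
noncomputable def mean (P : PMF ℕ) : ℝ := ∑' n : ℕ, (P n).toReal * (n : ℝ)

/-- The parameters of the source, with the standing assumptions of the model: `A` source symbols,
`B` source blocks, and a symbol-length distribution with finite mean that is concentrated
around its mean; `A` is small enough for drawing symbols without replacement. -/
structure SourceModel where
  /-- number of source symbols -/
  A : ℕ
  /-- number of source blocks -/
  B : ℕ
  /-- distribution of the length of a source symbol -/
  lengthLaw : PMF ℕ
  summable_mean : Summable fun n : ℕ => (lengthLaw n).toReal * (n : ℝ)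
  concentrated : ∀ n ∈ lengthLaw.support,
    mean lengthLaw / 2 ≤ (n : ℝ) ∧ (n : ℝ) ≤ 2 * mean lengthLaw
  two_le_A : 2 ≤ A
  A_le : (A : ℝ) ≤ (2 : ℝ) ^ (mean lengthLaw / 2 - 1)
  one_le_B : 1 ≤ B

/-- `n` independent draws from `p`. -/
noncomputable def iid {α : Type} (p : PMF α) : (n : ℕ) → PMF (Fin n → α)
  | 0 => PMF.pure Fin.elim0
  | n + 1 => (iid p n).bind fun x => p.map fun a => Fin.snoc x a

/-- The binary strings of length `l` outside the range of `x`. -/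
def freshStrings (l : ℕ) {n : ℕ} (x : Fin n → List Bool) : Finset (List Bool) :=
  (Finset.univ.image fun v : Fin l → Bool => List.ofFn v) \ Finset.univ.image x

open Classical in
/-- A uniform draw from `{0,1}^l` minus the strings already drawn (the set is never empty
under the assumptions of `SourceModel`; otherwise the value is a dummy). -/
noncomputable def drawFresh (l : ℕ) {n : ℕ} (x : Fin n → List Bool) : PMF (List Bool) :=
  if h : (freshStrings l x).Nonempty then PMF.uniformOfFinset (freshStrings l x) h
  else PMF.pure []

/-- Given the lengths, the symbols are drawn one after the other without replacement. -/
noncomputable def drawSymbols : (n : ℕ) → (Fin n → ℕ) → PMF (Fin n → List Bool)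
  | 0, _ => PMF.pure Fin.elim0
  | n + 1, l => (drawSymbols n (Fin.init l)).bind fun x =>
      (drawFresh (l (Fin.last n)) x).map fun y => Fin.snoc x y

namespace SourceModel

/-- The expected symbol length `E(L)`. -/
noncomputable def EL (m : SourceModel) : ℝ := mean m.lengthLaw

/-- The law of the random source alphabet `X_1, …, X_A`. -/
noncomputable def alphabetLaw (m : SourceModel) : PMF (Fin m.A → List Bool) :=
  (iid m.lengthLaw m.A).bind fun l => drawSymbols m.A l

instance (m : SourceModel) : Nonempty (Fin m.A) :=
  ⟨⟨0, lt_of_lt_of_le Nat.zero_lt_two m.two_le_A⟩⟩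

/-- The law of the source sequence `S = Y_1 Y_2 ⋯ Y_B`: the blocks are drawn independently and
uniformly from the alphabet (whose symbols are distinct, so one can draw indices), and are
concatenated without delimiters. -/
noncomputable def sourceLaw (m : SourceModel) : PMF (List Bool) :=
  m.alphabetLaw.bind fun x =>
    (iid (PMF.uniformOfFintype (Fin m.A)) m.B).map fun j =>
      (List.ofFn fun b => x (j b)).flatten

end SourceModel

/-! ### Source codes and their rates -/

/-- `f` is a prefix-free code for the strings in `T`: no codeword is a prefix of the codeword of
another string (in particular `f` is injective on `T`). -/
def PrefixFreeOn {α : Type} (f : α → List Bool) (T : Set α) : Prop :=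
  ∀ s ∈ T, ∀ t ∈ T, s ≠ t → ¬ f s <+: f t

/-- Expected number of encoded bits (`SourceModel.sourceLaw` has finite support). -/
noncomputable def expectedBits (p : PMF (List Bool)) (f : List Bool → List Bool) : ℝ :=
  ∑' s : List Bool, (p s).toReal * ((f s).length : ℝ)

/-- The rate `R⋆` of the optimal prefix-free code for the source sequence. -/
noncomputable def optimalRate (m : SourceModel) : ℝ :=
  sInf {r : ℝ | ∃ f : List Bool → List Bool,
    PrefixFreeOn f m.sourceLaw.support ∧ r = expectedBits m.sourceLaw f}

/-- A prefix-free code for the positive integers that spends at most `2 log n + 3` bits on `n`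
(such as an Elias code). -/
structure IntCode where
  /-- the codeword of a positive integer (the value at `0` is never used) -/
  enc : ℕ → List Bool
  prefixFree : PrefixFreeOn enc {n : ℕ | 1 ≤ n}
  length_le : ∀ n : ℕ, 1 ≤ n → ((enc n).length : ℝ) ≤ 2 * Real.logb 2 (n : ℝ) + 3

/-! ### Multi-chunk deduplication -/

/-- `w` has length at least `2^(M-1)` and ends in the anchor `0^M`. -/
def Complete (M : ℕ) (w : List Bool) : Prop :=
  2 ^ (M - 1) ≤ w.length ∧ List.replicate M false <:+ w

instance (M : ℕ) (w : List Bool) : Decidable (Complete M w) := by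
  unfold Complete; infer_instance

/-- Chunk parsing with the current unfinished chunk as first string argument. -/
def chunksAux (M : ℕ) : List Bool → List Bool → List (List Bool)
  | w, [] => if w = [] then [] else [w]
  | w, b :: s =>
      if Complete M (w ++ [b]) then (w ++ [b]) :: chunksAux M [] s else chunksAux M (w ++ [b]) s

/-- The parsing of `s` into chunks: each chunk, except perhaps the last one, is the shortest string
of length at least `2^(M-1)` that ends in `0^M`. -/
def chunks (M : ℕ) (s : List Bool) : List (List Bool) := chunksAux M [] s

/-- The chunk with index `c` (indices start at `0`). -/
def chunkAt (Z : List (List Bool)) (c : ℕ) : List Bool := Z.getD c []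

/-- Chunk `c` is new: it differs from all chunks before it. -/
def IsNew (Z : List (List Bool)) (c : ℕ) : Prop := chunkAt Z c ∉ Z.take c

instance (Z : List (List Bool)) (c : ℕ) : Decidable (IsNew Z c) := by
  unfold IsNew; infer_instance

/-- Index of the first appearance of chunk `c`. -/
def firstIdx (Z : List (List Bool)) (c : ℕ) : ℕ := Z.idxOf (chunkAt Z c)

/-- The largest `v` such that chunks `c, …, c + v - 1` exist and are all new. -/
def newRun (Z : List (List Bool)) (c : ℕ) : ℕ :=
  Nat.findGreatest (fun v => c + v ≤ Z.length ∧ ∀ i < v, IsNew Z (c + i)) Z.length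

/-- The largest `w` such that chunks `c, …, c + w - 1` exist and agree, in order, with the `w`
chunks that start at the first appearance of chunk `c`. -/
def oldRun (Z : List (List Bool)) (c : ℕ) : ℕ :=
  Nat.findGreatest (fun w => c + w ≤ Z.length ∧
    ∀ i < w, chunkAt Z (firstIdx Z c + i) = chunkAt Z (c + i)) Z.length

/-- Number of dictionary entries (distinct chunks) before chunk `c`. -/
def dictSize (Z : List (List Bool)) (c : ℕ) : ℕ := (Z.take c).toFinset.card

/-- The `k`-bit binary expansion of `n`, most significant bit first. -/
def toBits (k n : ℕ) : List Bool := List.ofFn fun i : Fin k => n.testBit (k - 1 - i)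

/-- The pointer to chunk `c` in the dictionary: entries are numbered from `0` in the order of first
appearance, and a position among `d` entries is written with `⌈log₂ d⌉` bits. -/
def pointer (Z : List (List Bool)) (c : ℕ) : List Bool :=
  toBits (Nat.clog 2 (dictSize Z c)) (dictSize Z (firstIdx Z c))

/-- The encoding of the chunks from index `c` on. Every step handles at least one chunk, so as
many steps as there are chunks (the first number) suffice. -/
def encodeFrom (K : IntCode) (Z : List (List Bool)) : ℕ → ℕ → List Bool
  | 0, _ => []
  | steps + 1, c =>
      if c < Z.length then
        if IsNew Z c then
          [true] ++ K.enc (newRun Z c) ++ ((Z.drop c).take (newRun Z c)).flatten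
            ++ encodeFrom K Z steps (c + newRun Z c)
        else
          [false] ++ K.enc (oldRun Z c) ++ pointer Z c
            ++ encodeFrom K Z steps (c + oldRun Z c)
      else []

/-- The multi-chunk deduplication code with anchor `0^M`. -/
def mcEncode (K : IntCode) (M : ℕ) (s : List Bool) : List Bool :=
  K.enc s.length ++ encodeFrom K (chunks M s) (chunks M s).length 0

/-- The rate `R_MC` of multi-chunk deduplication with optimized anchor length `M ≥ 1`. -/
noncomputable def mcRate (K : IntCode) (m : SourceModel) : ℝ :=
  ⨅ M : ℕ+, expectedBits m.sourceLaw (mcEncode K M)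

/-! ### The quantities in the bound -/

/-- `(min{A,B}(E(L) - 1) + (B - A)^+ log(A/2) - 2 B log(2 E(L)))^+` -/
noncomputable def boundDenom (m : SourceModel) : ℝ :=
  max (min (m.A : ℝ) (m.B : ℝ) * (m.EL - 1)
    + max ((m.B : ℝ) - (m.A : ℝ)) 0 * Real.logb 2 ((m.A : ℝ) / 2)
    - 2 * (m.B : ℝ) * Real.logb 2 (2 * m.EL)) 0

end Dedup

/-! Everything follows from one additive estimate, `mcRate_le`: multi-chunk deduplication exceeds
the optimal rate by at most a universal constant times `B log (A B E(L))`. Dividing by the lower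
bounds on the optimal rate then gives the multiplicative bound and both optimality regimes.

Lower bounds. A prefix-free code spends at least `h` bits on average when no string has probability
above `2^(-h)` (Kraft and Gibbs, `PrefixFreeOn.le_ex_length`). Conditioning on the lengths and the
indices leaves only the symbols random, and drawing without replacement costs at most a factor 2 per
symbol. So the rate is at least the expected total length of the symbols that occur, less one bit
per such symbol (`ex_sum_used_le`), and hence at least `min(A,B)(E(L)-1)/2`. Conditioning on the
alphabet leaves only the indices random, and the string determines them up to at most `(2 E(L))^B`
length patterns (`log_le_optimalRate`). Together these give `boundDenom_le`. Since the scheme is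
itself prefix-free (`prefixFreeOn_mcEncode`), its rate is never below the optimum.

Upper bound. Take chunks of length at least `N = 2^(M-1)`, with `N` of order `log (A B E(L))`. A
long stretch without anchor followed by an anchor forces a chunk boundary whatever precedes it
(`unfinished_eq_nil_of_endsSync`). Hence the part of a block between its first and last such
pattern, its core, is parsed identically at every occurrence. If no window of `N` bits in the first
occurrence of a block appears earlier (`NoRepeat`), the chunks of the first core are new, and any
old chunk in a later core starts a match reaching the end of that core (`exists_mark_of_old`). Thus
each symbol is paid for once, apart from the glue between cores, and the number of runs is of order
`B` plus the number of glue chunks.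

In uniform bits a synchronizing pattern appears within `O(N)` bits with probability at least 1/4, so
each block has expected glue `O(N)` (`ex_syncCost_le`). A repeat has probability at most `n^2
2^(-N)` for total length `n`, which outweighs the cruder bound of order `n` used in that case. These
estimates concern independent symbols; they transfer to drawing without replacement at the cost of a
factor 2 when `E(L)` is at least `6 log (A B E(L))` (`ex_drawSymbols_le`). For shorter symbols the
whole string has only `O(B log (A B E(L)))` bits, and the crude bound suffices. -/

namespace Dedup

open scoped ENNReal

/-! ### Expectations with respect to a `PMF` -/

/-- The expectation of a nonnegative function. -/
noncomputable def ex {α : Type} (p : PMF α) (g : α → ℝ≥0∞) : ℝ≥0∞ := ∑' a, p a * g a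

section ex

variable {α β : Type}

theorem ex_pure (a : α) (g : α → ℝ≥0∞) : ex (PMF.pure a) g = g a := by
  classical
  unfold ex
  rw [tsum_eq_single a]
  · simp
  · intro b hb
    simp [PMF.pure_apply, hb]

theorem ex_bind (p : PMF α) (q : α → PMF β) (g : β → ℝ≥0∞) :
    ex (p.bind q) g = ex p fun a => ex (q a) g := by
  unfold ex
  simp_rw [PMF.bind_apply, ← ENNReal.tsum_mul_right, ← ENNReal.tsum_mul_left]
  rw [ENNReal.tsum_comm]
  simp_rw [mul_assoc]

theorem ex_map (p : PMF α) (f : α → β) (g : β → ℝ≥0∞) :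
    ex (p.map f) g = ex p fun a => g (f a) := by
  rw [← PMF.bind_pure_comp, ex_bind]
  simp [ex_pure]

theorem ex_mono_support (p : PMF α) {f g : α → ℝ≥0∞} (h : ∀ a ∈ p.support, f a ≤ g a) :
    ex p f ≤ ex p g := by
  refine ENNReal.tsum_le_tsum fun a => ?_
  by_cases ha : a ∈ p.support
  · gcongr
    exact h a ha
  · rw [PMF.mem_support_iff, not_not] at ha
    simp [ha]

theorem ex_mono (p : PMF α) {f g : α → ℝ≥0∞} (h : ∀ a, f a ≤ g a) : ex p f ≤ ex p g :=
  ex_mono_support p fun a _ => h a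

theorem ex_congr_support (p : PMF α) {f g : α → ℝ≥0∞} (h : ∀ a ∈ p.support, f a = g a) :
    ex p f = ex p g :=
  le_antisymm (ex_mono_support p fun a ha => (h a ha).le)
    (ex_mono_support p fun a ha => (h a ha).ge)

theorem ex_const (p : PMF α) (c : ℝ≥0∞) : (ex p fun _ => c) = c := by
  unfold ex
  rw [ENNReal.tsum_mul_right, p.tsum_coe, one_mul]

theorem ex_add (p : PMF α) (f g : α → ℝ≥0∞) : (ex p fun a => f a + g a) = ex p f + ex p g := by
  unfold ex
  simp_rw [mul_add]
  exact ENNReal.tsum_add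

theorem ex_mul_left (p : PMF α) (c : ℝ≥0∞) (f : α → ℝ≥0∞) :
    (ex p fun a => c * f a) = c * ex p f := by
  unfold ex
  rw [← ENNReal.tsum_mul_left]
  exact tsum_congr fun a => by ring

theorem ex_sum {ι : Type*} (p : PMF α) (s : Finset ι) (f : ι → α → ℝ≥0∞) :
    (ex p fun a => ∑ i ∈ s, f i a) = ∑ i ∈ s, ex p (f i) := by
  unfold ex
  simp_rw [Finset.mul_sum]
  exact Summable.tsum_finsetSum fun _ _ => ENNReal.summable

theorem ex_comm (p : PMF α) (q : PMF β) (f : α → β → ℝ≥0∞) :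
    (ex p fun a => ex q fun b => f a b) = ex q fun b => ex p fun a => f a b := by
  unfold ex
  simp_rw [← ENNReal.tsum_mul_left]
  rw [ENNReal.tsum_comm]
  exact tsum_congr fun b => tsum_congr fun a => by ring

theorem ex_le_of_support (p : PMF α) {f : α → ℝ≥0∞} {c : ℝ≥0∞} (h : ∀ a ∈ p.support, f a ≤ c) :
    ex p f ≤ c :=
  (ex_mono_support p h).trans_eq (ex_const p c)

theorem le_ex_of_support (p : PMF α) {f : α → ℝ≥0∞} {c : ℝ≥0∞} (h : ∀ a ∈ p.support, c ≤ f a) :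
    c ≤ ex p f :=
  (ex_const p c).symm.trans_le (ex_mono_support p h)

open Classical in
theorem apply_eq_ex (p : PMF α) (s : α) : p s = ex p fun a => if a = s then 1 else 0 := by
  unfold ex
  rw [tsum_eq_single s]
  · simp
  · intro b hb
    simp [hb]

theorem ex_uniformOfFintype [Fintype α] [Nonempty α] (f : α → ℝ≥0∞) :
    ex (PMF.uniformOfFintype α) f = (Fintype.card α : ℝ≥0∞)⁻¹ * ∑ a, f a := by
  unfold ex
  simp_rw [PMF.uniformOfFintype_apply]
  rw [ENNReal.tsum_mul_left, tsum_fintype]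

/-- Passes from the real series to extended nonnegative expectations, where sums can be rearranged
freely. It needs no finiteness, because both sides are 0 when the series diverges. -/
theorem expectedBits_eq (p : PMF (List Bool)) (f : List Bool → List Bool) :
    expectedBits p f = (ex p fun s => ((f s).length : ℝ≥0∞)).toReal := by
  unfold expectedBits ex
  rw [ENNReal.tsum_toReal_eq]
  · simp
  · intro a
    exact ENNReal.mul_ne_top (p.apply_ne_top a) (by simp)

end ex

/-! ### Kraft's inequality and the Gibbs bound -/

section kraft

variable {α : Type}

theorem PrefixFreeOn.mono {f : α → List Bool} {S T : Set α} (h : PrefixFreeOn f T) (hST : S ⊆ T) :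
    PrefixFreeOn f S :=
  fun s hs t ht hst => h s (hST hs) t (hST ht) hst

theorem PrefixFreeOn.injOn {f : α → List Bool} {T : Set α} (h : PrefixFreeOn f T) :
    Set.InjOn f T := by
  intro s hs t ht hst
  by_contra hne
  exact h s hs t ht hne (hst ▸ List.prefix_rfl)

theorem PrefixFreeOn.eq_of_append_eq {f : α → List Bool} {T : Set α} (h : PrefixFreeOn f T)
    {s t : α} (hs : s ∈ T) (ht : t ∈ T) {u v : List Bool} (huv : f s ++ u = f t ++ v) : s = t := by
  by_contra hne
  rcases List.prefix_or_prefix_of_prefix (List.prefix_append (f s) u)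
    (huv ▸ List.prefix_append (f t) v) with h' | h'
  · exact h s hs t ht hne h'
  · exact h t ht s hs (Ne.symm hne) h'

/-- The first codeword of a concatenation is determined by prefix-freeness and can be cancelled.
Nonempty codewords are required because repetitions of the empty word could not be counted. -/
theorem PrefixFreeOn.uniquelyDecodable {f : α → List Bool} {T : Set α} (h : PrefixFreeOn f T)
    (hne : ∀ s ∈ T, f s ≠ []) : InformationTheory.UniquelyDecodable (f '' T) := by
  intro L₁
  induction L₁ with
  | nil =>
    intro L₂ _ h₂ heq
    cases L₂ with
    | nil => rfl
    | cons w L₂ =>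
      obtain ⟨s, hs, rfl⟩ := h₂ w (by simp)
      have := hne s hs
      simp_all
  | cons w L₁ ih =>
    intro L₂ h₁ h₂ heq
    obtain ⟨s, hs, rfl⟩ := h₁ w (by simp)
    cases L₂ with
    | nil =>
      have := hne s hs
      simp_all
    | cons w' L₂ =>
      obtain ⟨t, ht, rfl⟩ := h₂ w' (by simp)
      simp only [List.flatten_cons] at heq
      obtain rfl := h.eq_of_append_eq hs ht heq
      rw [ih L₂ (fun w hw => h₁ w (by simp [hw])) (fun w hw => h₂ w (by simp [hw]))
        (List.append_cancel_left heq)]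

/-- McMillan's inequality applies unless some codeword is empty; an empty codeword is a prefix of
every other, so the code then has a single element. -/
theorem PrefixFreeOn.kraft {f : α → List Bool} {F : Finset α} (h : PrefixFreeOn f (F : Set α)) :
    ∑ s ∈ F, (1 / 2 : ℝ) ^ (f s).length ≤ 1 := by
  classical
  by_cases hne : ∀ s ∈ F, f s ≠ []
  · have hU : InformationTheory.UniquelyDecodable ((F.image f : Finset (List Bool)) :
        Set (List Bool)) := by
      rw [Finset.coe_image]
      exact h.uniquelyDecodable hne
    have := InformationTheory.kraft_mcmillan_inequality hU
    rw [Finset.sum_image h.injOn] at this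
    simpa using this
  · push Not at hne
    obtain ⟨s, hs, hs0⟩ := hne
    have hF : F = {s} := by
      ext t
      simp only [Finset.mem_singleton]
      refine ⟨fun ht => ?_, fun ht => ht ▸ hs⟩
      by_contra hne
      exact h s hs t ht (Ne.symm hne) (hs0 ▸ List.nil_prefix)
    simp [hF, hs0]

theorem PrefixFreeOn.tsum_kraft {f : α → List Bool} {T : Set α} (h : PrefixFreeOn f T) :
    ∑' s, T.indicator (fun s => ENNReal.ofReal ((1 / 2 : ℝ) ^ (f s).length)) s ≤ 1 := by
  classical
  rw [ENNReal.tsum_eq_iSup_sum]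
  refine iSup_le fun F => ?_
  have hk := (h.mono (S := ((F.filter (· ∈ T) : Finset α) : Set α)) (by
    intro s hs
    simp at hs
    exact hs.2)).kraft
  calc ∑ s ∈ F, T.indicator (fun s => ENNReal.ofReal ((1 / 2 : ℝ) ^ (f s).length)) s
      = ∑ s ∈ F.filter (· ∈ T), ENNReal.ofReal ((1 / 2 : ℝ) ^ (f s).length) := by
        rw [Finset.sum_filter]
        rfl
    _ = ENNReal.ofReal (∑ s ∈ F.filter (· ∈ T), (1 / 2 : ℝ) ^ (f s).length) := by
        rw [ENNReal.ofReal_sum_of_nonneg]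
        intros
        positivity
    _ ≤ 1 := by
        rw [← ENNReal.ofReal_one]
        exact ENNReal.ofReal_le_ofReal hk

theorem one_add_mul_log_two_le_rpow (x : ℝ) : 1 + x * Real.log 2 ≤ (2 : ℝ) ^ x := by
  rw [Real.rpow_def_of_pos (by norm_num)]
  have := Real.add_one_le_exp (Real.log 2 * x)
  linarith

/-- A prefix-free code spends at least `h` bits on average if no string has probability more
than `2^(-h)`. -/
theorem PrefixFreeOn.le_ex_length {p : PMF α} {f : α → List Bool}
    (hf : PrefixFreeOn f p.support) {h : ℝ} (hp : ∀ s, p s ≤ ENNReal.ofReal ((2 : ℝ) ^ (-h))) :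
    ENNReal.ofReal h ≤ ex p fun s => ((f s).length : ℝ≥0∞) := by
  rcases le_or_gt h 0 with h0 | h0
  · simp [ENNReal.ofReal_of_nonpos h0]
  have hl2 : 0 < Real.log 2 := Real.log_pos (by norm_num)
  -- Tangent-line form of Gibbs' inequality: `1 + x log 2 ≤ 2^x` at `x = h - |f s|`, weighted by `p
  -- s`. Since `p s ≤ 2^(-h)`, the exponential term is at most the Kraft weight, so summation leaves
  -- at most 1 there and the two ones cancel.
  have key : ∀ s, p s * ENNReal.ofReal (1 + h * Real.log 2) ≤
      p s * (ENNReal.ofReal (Real.log 2) * ((f s).length : ℝ≥0∞)) +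
        p.support.indicator (fun s => ENNReal.ofReal ((1 / 2 : ℝ) ^ (f s).length)) s := by
    intro s
    by_cases hs : s ∈ p.support
    swap
    · rw [PMF.mem_support_iff, not_not] at hs
      simp [hs]
    rw [Set.indicator_of_mem hs]
    have hps : p s = ENNReal.ofReal (p s).toReal :=
      (ENNReal.ofReal_toReal (p.apply_ne_top s)).symm
    have hle : (p s).toReal ≤ (2 : ℝ) ^ (-h) :=
      ENNReal.toReal_le_of_le_ofReal (by positivity) (hp s)
    set q := (p s).toReal with hq
    have hq0 : 0 ≤ q := ENNReal.toReal_nonneg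
    set n := (f s).length
    rw [hps, ← ENNReal.ofReal_natCast n, ← ENNReal.ofReal_mul hq0, ← ENNReal.ofReal_mul hl2.le,
      ← ENNReal.ofReal_mul hq0, ← ENNReal.ofReal_add (by positivity) (by positivity)]
    apply ENNReal.ofReal_le_ofReal
    have h1 := one_add_mul_log_two_le_rpow (h - n)
    have h2 : (2 : ℝ) ^ (-h) * (2 : ℝ) ^ (h - n) = (1 / 2 : ℝ) ^ n := by
      rw [← Real.rpow_add (by norm_num)]
      rw [show -h + (h - n) = -(n : ℝ) by ring, Real.rpow_neg (by norm_num), Real.rpow_natCast]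
      simp
    have h3 : q * (2 : ℝ) ^ (h - n) ≤ (1 / 2 : ℝ) ^ n := by
      rw [← h2]
      gcongr
    nlinarith [mul_le_mul_of_nonneg_left h1 hq0]
  have hsum := ENNReal.tsum_le_tsum key
  rw [ENNReal.tsum_mul_right, p.tsum_coe, one_mul, ENNReal.tsum_add] at hsum
  have h1 := hsum.trans (add_le_add_right hf.tsum_kraft _)
  change _ ≤ ex p (fun s => ENNReal.ofReal (Real.log 2) * ((f s).length : ℝ≥0∞)) + 1 at h1
  rw [ex_mul_left, ENNReal.ofReal_add zero_le_one (by positivity), ENNReal.ofReal_one,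
    add_comm] at h1
  have h2 := (ENNReal.add_le_add_iff_right ENNReal.one_ne_top).1 h1
  rw [mul_comm h, ENNReal.ofReal_mul hl2.le] at h2
  exact (ENNReal.mul_le_mul_iff_right (by simpa using hl2) ENNReal.ofReal_ne_top).1 h2

end kraft

end Dedup

namespace Dedup

/-! ### Chunk parsing -/

/-- The completed chunks after parsing a string that starts inside the unfinished chunk `w`. -/
def fullChunks (M : ℕ) : List Bool → List Bool → List (List Bool)
  | _, [] => []
  | w, b :: s =>
      if Complete M (w ++ [b]) then (w ++ [b]) :: fullChunks M [] s else fullChunks M (w ++ [b]) s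

/-- The unfinished chunk after parsing a string that starts inside the unfinished chunk `w`. -/
def unfinished (M : ℕ) : List Bool → List Bool → List Bool
  | w, [] => w
  | w, b :: s => if Complete M (w ++ [b]) then unfinished M [] s else unfinished M (w ++ [b]) s

theorem not_complete_nil (M : ℕ) : ¬ Complete M [] := by
  intro h
  have := h.1
  have h2 : 0 < 2 ^ (M - 1) := by positivity
  simp at this

theorem Complete.ne_nil {M : ℕ} {w : List Bool} (h : Complete M w) : w ≠ [] := by
  rintro rfl
  exact not_complete_nil M h

/-- The parser is an automaton whose only state is the unfinished chunk, so parsing resumes from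
that state. -/
theorem chunksAux_append (M : ℕ) (w u r : List Bool) :
    chunksAux M w (u ++ r) = fullChunks M w u ++ chunksAux M (unfinished M w u) r := by
  induction u generalizing w with
  | nil => simp [fullChunks, unfinished]
  | cons b s ih =>
    simp only [List.cons_append, chunksAux, fullChunks, unfinished]
    split_ifs <;> simp [ih]

theorem chunksAux_eq (M : ℕ) (w u : List Bool) : chunksAux M w u =
    fullChunks M w u ++ if unfinished M w u = [] then [] else [unfinished M w u] := by
  have := chunksAux_append M w u []
  simpa [chunksAux] using this

theorem unfinished_append (M : ℕ) (w u r : List Bool) :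
    unfinished M w (u ++ r) = unfinished M (unfinished M w u) r := by
  induction u generalizing w with
  | nil => simp [unfinished]
  | cons b s ih =>
    simp only [List.cons_append, unfinished]
    split_ifs <;> simp [ih]

theorem fullChunks_flatten (M : ℕ) (w u : List Bool) :
    (fullChunks M w u).flatten ++ unfinished M w u = w ++ u := by
  induction u generalizing w with
  | nil => simp [fullChunks, unfinished]
  | cons b s ih =>
    simp only [fullChunks, unfinished]
    split_ifs <;> simp [ih]

theorem not_complete_unfinished (M : ℕ) {w : List Bool} (hw : ¬ Complete M w) (u : List Bool) :
    ¬ Complete M (unfinished M w u) := by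
  induction u generalizing w with
  | nil => simpa [unfinished]
  | cons b s ih =>
    simp only [unfinished]
    split_ifs with h
    · exact ih (not_complete_nil M)
    · exact ih h

theorem complete_of_mem_fullChunks {M : ℕ} {w u z : List Bool} (hz : z ∈ fullChunks M w u) :
    Complete M z := by
  induction u generalizing w with
  | nil => simp [fullChunks] at hz
  | cons b s ih =>
    simp only [fullChunks] at hz
    split_ifs at hz with h
    · rcases List.mem_cons.1 hz with rfl | hz
      · exact h
      · exact ih hz
    · exact ih hz

theorem chunks_flatten (M : ℕ) (s : List Bool) : (chunks M s).flatten = s := by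
  have h := fullChunks_flatten M [] s
  unfold chunks
  rw [chunksAux_eq]
  split_ifs with h0
  · simpa [h0] using h
  · simpa using h

theorem ne_nil_of_mem_chunks {M : ℕ} {s z : List Bool} (hz : z ∈ chunks M s) : z ≠ [] := by
  unfold chunks at hz
  rw [chunksAux_eq, List.mem_append] at hz
  rcases hz with hz | hz
  · exact (complete_of_mem_fullChunks hz).ne_nil
  · split_ifs at hz with h0
    · simp at hz
    · simp at hz
      rwa [hz]

theorem chunks_eq_fullChunks {M : ℕ} {u : List Bool} (h : unfinished M [] u = []) :
    chunks M u = fullChunks M [] u := by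
  unfold chunks
  simp [chunksAux_eq, h]

theorem chunks_append {M : ℕ} {u : List Bool} (h : unfinished M [] u = []) (r : List Bool) :
    chunks M (u ++ r) = chunks M u ++ chunks M r := by
  rw [chunks_eq_fullChunks h]
  unfold chunks
  rw [chunksAux_append, h]

theorem chunks_nil (M : ℕ) : chunks M [] = [] := by simp [chunks, chunksAux]

theorem length_fullChunks_mul_le (M : ℕ) (w u : List Bool) :
    (fullChunks M w u).length * 2 ^ (M - 1) ≤ w.length + u.length := by
  have h : ∀ L : List (List Bool), (∀ z ∈ L, Complete M z) →
      L.length * 2 ^ (M - 1) ≤ L.flatten.length := by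
    intro L
    induction L with
    | nil => simp
    | cons z L ih =>
      intro hL
      have h1 := (hL z (by simp)).1
      have h2 := ih fun z hz => hL z (by simp [hz])
      simp only [List.length_cons, List.flatten_cons, List.length_append, Nat.succ_mul]
      omega
  have h1 := h (fullChunks M w u) fun z hz => complete_of_mem_fullChunks hz
  have h2 := congrArg List.length (fullChunks_flatten M w u)
  simp only [List.length_append] at h2
  omega

theorem length_chunks_mul_le (M : ℕ) (s : List Bool) :
    (chunks M s).length * 2 ^ (M - 1) ≤ s.length + 2 ^ (M - 1) := by
  have h := length_fullChunks_mul_le M [] s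
  unfold chunks
  rw [chunksAux_eq, List.length_append, Nat.add_mul]
  have h2 : (if unfinished M [] s = [] then [] else [unfinished M [] s]).length ≤ 1 := by
    split_ifs <;> simp
  have h3 := Nat.mul_le_mul_right (2 ^ (M - 1)) h2
  simp only [List.length_nil, zero_add] at h
  omega

theorem length_chunks_le (M : ℕ) (s : List Bool) : (chunks M s).length ≤ s.length := by
  conv_rhs => rw [← chunks_flatten M s]
  have h : ∀ L : List (List Bool), (∀ z ∈ L, z ≠ []) → L.length ≤ L.flatten.length := by
    intro L
    induction L with
    | nil => simp
    | cons z L ih =>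
      intro hL
      have h1 := List.length_pos_iff.2 (hL z (by simp))
      have h2 := ih fun z hz => hL z (by simp [hz])
      simp only [List.length_cons, List.flatten_cons, List.length_append]
      omega
  exact h _ fun z hz => ne_nil_of_mem_chunks hz

theorem exists_of_chunksAux_eq_cons {M : ℕ} {w u z : List Bool} {tl : List (List Bool)}
    (h : chunksAux M w u = z :: tl) : ∃ t, w ++ u = z ++ t ∧ tl = chunks M t := by
  induction u generalizing w with
  | nil =>
    simp only [chunksAux] at h
    split_ifs at h with h0
    simp only [List.cons.injEq] at h
    exact ⟨[], by simp [h.1], by simp [← h.2, chunks_nil]⟩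
  | cons b s ih =>
    simp only [chunksAux] at h
    split_ifs at h with h0
    · simp only [List.cons.injEq] at h
      exact ⟨s, by simp [← h.1], h.2.symm⟩
    · obtain ⟨t, ht, h'⟩ := ih h
      exact ⟨t, by simpa using ht, h'⟩

theorem exists_drop_chunks (M : ℕ) (s : List Bool) (c : ℕ) (hc : c ≤ (chunks M s).length) :
    ∃ t, (chunks M s).drop c = chunks M t ∧ s = ((chunks M s).take c).flatten ++ t := by
  induction c with
  | zero => exact ⟨s, by simp⟩
  | succ c ih =>
    obtain ⟨t, ht, hs⟩ := ih (by omega)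
    have hc' : c < (chunks M s).length := hc
    rw [List.drop_eq_getElem_cons hc'] at ht
    obtain ⟨t', ht', h'⟩ := exists_of_chunksAux_eq_cons ht.symm
    refine ⟨t', h', ?_⟩
    rw [List.take_succ_eq_append_getElem hc', List.flatten_append, List.append_assoc]
    simp only [List.flatten_singleton]
    rw [← ht', List.nil_append]
    exact hs

theorem prefix_of_chunksAux_eq_cons {M : ℕ} {w u z : List Bool} {tl : List (List Bool)}
    (h : chunksAux M w u = z :: tl) : w <+: z := by
  induction u generalizing w with
  | nil =>
    simp only [chunksAux] at h
    split_ifs at h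
    simp only [List.cons.injEq] at h
    rw [h.1]
  | cons b s ih =>
    simp only [chunksAux] at h
    split_ifs at h with h0
    · simp only [List.cons.injEq] at h
      exact h.1 ▸ List.prefix_append _ _
    · exact (List.prefix_append _ _).trans (ih h)

/-- Both parsers read the same bits as long as neither has closed its chunk, so they close together.
Equal total lengths cover the case where a chunk is closed by the end of the string rather than by
an anchor; this is why the scheme transmits the length first. -/
theorem first_chunk_unique {M : ℕ} {w u u' z z' : List Bool} {tl tl' : List (List Bool)}
    (hlen : u.length = u'.length) (h : chunksAux M w u = z :: tl)
    (h' : chunksAux M w u' = z' :: tl') {r r' : List Bool} (hr : z ++ r = z' ++ r') : z = z' := by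
  induction u generalizing w u' with
  | nil =>
    obtain rfl : u' = [] := by simpa using hlen.symm
    rw [h] at h'
    simpa using (List.cons.inj h').1
  | cons b s ih =>
    cases u' with
    | nil => simp at hlen
    | cons b' s' =>
      have hb : w ++ [b] <+: z := by
        simp only [chunksAux] at h
        split_ifs at h with h0
        · rw [(List.cons.inj h).1]
        · exact prefix_of_chunksAux_eq_cons h
      have hb' : w ++ [b'] <+: z' := by
        simp only [chunksAux] at h'
        split_ifs at h' with h0
        · rw [(List.cons.inj h').1]
        · exact prefix_of_chunksAux_eq_cons h'
      obtain ⟨x, hx⟩ := hb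
      obtain ⟨x', hx'⟩ := hb'
      have hbb : b = b' := by
        rw [← hx, ← hx'] at hr
        simp at hr
        exact hr.1
      subst hbb
      simp only [chunksAux] at h h'
      split_ifs at h h' with h0
      · rw [← (List.cons.inj h).1, ← (List.cons.inj h').1]
      · exact ih (by simpa using hlen) h h'

/-- Lets the decoder delimit a run of new chunks from their number alone, although they are written
without separators. -/
theorem take_chunks_unique {M V : ℕ} {u u' : List Bool} (hlen : u.length = u'.length)
    (hV : V ≤ (chunks M u).length) (hV' : V ≤ (chunks M u').length) {r r' : List Bool}
    (hr : ((chunks M u).take V).flatten ++ r = ((chunks M u').take V).flatten ++ r') :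
    (chunks M u).take V = (chunks M u').take V := by
  induction V generalizing u u' with
  | zero => simp
  | succ V ih =>
    obtain ⟨z, tl, h⟩ := List.exists_cons_of_length_pos (by omega : 0 < (chunks M u).length)
    obtain ⟨z', tl', h'⟩ := List.exists_cons_of_length_pos (by omega : 0 < (chunks M u').length)
    rw [h, h'] at hr ⊢
    rw [h] at hV
    rw [h'] at hV'
    simp only [List.take_succ_cons, List.flatten_cons, List.append_assoc] at hr ⊢
    obtain rfl := first_chunk_unique hlen h h' hr
    obtain ⟨t, ht, rfl⟩ := exists_of_chunksAux_eq_cons h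
    obtain ⟨t', ht', rfl⟩ := exists_of_chunksAux_eq_cons h'
    rw [ih _ (by simpa using hV) (by simpa using hV') (List.append_cancel_left hr)]
    simp only [List.nil_append] at ht ht'
    rw [ht, ht'] at hlen
    simpa using hlen

/-! ### Synchronizing patterns -/

/-- A pattern that ends in the only anchor occurring in it and is long enough to force a chunk
boundary at its end. -/
def SyncPattern (M : ℕ) (w : List Bool) : Prop :=
  2 ^ (M - 1) + M ≤ w.length + 1 ∧ List.replicate M false <:+ w ∧
    ¬ List.replicate M false <:+: w.dropLast

/-- `y` ends with a synchronizing pattern. -/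
def EndsSync (M : ℕ) (y : List Bool) : Prop := ∃ w, SyncPattern M w ∧ w <:+ y

/-- `y` contains a synchronizing pattern. -/
def HasSync (M : ℕ) (y : List Bool) : Prop := ∃ w, SyncPattern M w ∧ w <:+: y

theorem EndsSync.append_left {M : ℕ} {y : List Bool} (h : EndsSync M y) (x : List Bool) :
    EndsSync M (x ++ y) := by
  obtain ⟨w, hw, hwy⟩ := h
  exact ⟨w, hw, hwy.trans (List.suffix_append _ _)⟩

theorem HasSync.append_left {M : ℕ} {y : List Bool} (h : HasSync M y) (x : List Bool) :
    HasSync M (x ++ y) := by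
  obtain ⟨w, hw, hwy⟩ := h
  exact ⟨w, hw, hwy.trans (List.suffix_append _ _).isInfix⟩

theorem HasSync.append_right {M : ℕ} {y : List Bool} (h : HasSync M y) (x : List Bool) :
    HasSync M (y ++ x) := by
  obtain ⟨w, hw, hwy⟩ := h
  exact ⟨w, hw, hwy.trans (List.prefix_append _ _).isInfix⟩

theorem le_two_pow_pred {M : ℕ} : M ≤ 2 ^ (M - 1) := by
  have := (M - 1).lt_two_pow_self
  omega

theorem SyncPattern.length_pos {M : ℕ} {w : List Bool} (hM : 1 ≤ M) (h : SyncPattern M w) :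
    0 < w.length := by
  have := h.1
  have h2 : 0 < 2 ^ (M - 1) := by positivity
  omega

/-- Suppose a nonempty unfinished chunk `t` remained. The string ends in the anchor, so `t` is
shorter than `2^(M-1)`, since otherwise it would be complete. The chunk before it ends in an anchor
lying fewer than `2^(M-1) + M` positions from the end and not at the very end, hence inside the
pattern without its last bit. That contradicts the anchor being unique in the pattern. -/
theorem unfinished_eq_nil_of_endsSync {M : ℕ} (hM : 1 ≤ M) {u : List Bool} (h : EndsSync M u) :
    unfinished M [] u = [] := by
  by_contra hne
  obtain ⟨w, ⟨hwl, hws, hwi⟩, hwu⟩ := h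
  have hw0 : 0 < w.length := SyncPattern.length_pos hM ⟨hwl, hws, hwi⟩
  have hfl := fullChunks_flatten M [] u
  have hnc := not_complete_unfinished M (not_complete_nil M) u
  have hfull : ∀ z ∈ fullChunks M [] u, Complete M z := fun z hz => complete_of_mem_fullChunks hz
  set t := unfinished M [] u
  set o := fullChunks M [] u
  rw [List.nil_append] at hfl
  have htu : t <:+ u := ⟨_, hfl⟩
  have hzu : List.replicate M false <:+ u := hws.trans hwu
  have htN : t.length < 2 ^ (M - 1) := by
    by_contra hcon
    push Not at hcon
    refine hnc ⟨hcon, List.suffix_of_suffix_length_le hzu htu ?_⟩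
    simpa using le_two_pow_pred.trans hcon
  have hul := congrArg List.length hfl
  rw [List.length_append] at hul
  have hwul := hwu.length_le
  have ho : o ≠ [] := by
    intro ho
    rw [ho] at hul
    simp at hul
    omega
  obtain ⟨o', z, hoz⟩ := List.eq_nil_or_concat o |>.resolve_left ho
  obtain ⟨x, hx⟩ := (hfull z (by simp [hoz])).2
  have hu : u = (o'.flatten ++ x) ++ (List.replicate M false ++ t) := by
    rw [← hfl, hoz, ← hx]
    simp
  have hd : List.replicate M false ++ t.dropLast <:+ u.dropLast := by
    refine ⟨o'.flatten ++ x, ?_⟩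
    rw [hu, List.dropLast_append_of_ne_nil (l := List.replicate M false ++ t) (by simp [hne]),
      List.dropLast_append_of_ne_nil hne]
  have hd' : w.dropLast <:+ u.dropLast := by
    obtain ⟨a, rfl⟩ := hwu
    exact ⟨a, by rw [List.dropLast_append_of_ne_nil (List.length_pos_iff.1 hw0)]⟩
  refine hwi ((List.prefix_append _ t.dropLast).isInfix.trans
    (List.suffix_of_suffix_length_le hd hd' ?_).isInfix)
  have := List.length_pos_iff.2 hne
  simp
  omega

open Classical in
/-- The number of split points that have no synchronizing pattern before them, plus the number
of those that have none after them. -/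
noncomputable def syncCost (M : ℕ) (y : List Bool) : ℕ :=
  ∑ p ∈ Finset.range (y.length + 1),
    ((if HasSync M (y.take p) then 0 else 1) + (if HasSync M (y.drop p) then 0 else 1))

theorem length_le_syncCost {M : ℕ} {y : List Bool} (h : ¬ HasSync M y) :
    y.length ≤ syncCost M y := by
  classical
  have h1 : ∀ p, ¬ HasSync M (y.take p) := fun p hp => h (by
    have := hp.append_right (y.drop p)
    rwa [List.take_append_drop] at this)
  unfold syncCost
  calc y.length ≤ ∑ p ∈ Finset.range (y.length + 1), 1 := by simp
    _ ≤ _ := Finset.sum_le_sum fun p _ => by simp [h1 p]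

/-- Cut at the first and at the last position where a synchronizing pattern ends. No prefix shorter
than the first cut contains a pattern, and no suffix starting at or after the last cut does, so the
two outer pieces are counted by `syncCost`. -/
theorem exists_sync_split {M : ℕ} (hM : 1 ≤ M) {y : List Bool} (h : HasSync M y) :
    ∃ u m v, y = u ++ (m ++ v) ∧ EndsSync M u ∧ EndsSync M (u ++ m) ∧
      u.length + v.length ≤ syncCost M y := by
  classical
  have hlt : ∀ {x : List Bool}, HasSync M x → ∃ p ≤ x.length, 0 < p ∧ EndsSync M (x.take p) := by
    rintro x ⟨w, hw, a, b, rfl⟩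
    have := hw.length_pos hM
    refine ⟨(a ++ w).length, by simp, by simp; omega, w, hw, ?_⟩
    rw [List.take_left']
    · exact List.suffix_append _ _
    · rfl
  have hE : ∃ p, EndsSync M (y.take p) := (hlt h).imp fun p hp => hp.2.2
  set P := Nat.find hE with hP
  have hPs : EndsSync M (y.take P) := Nat.find_spec hE
  obtain ⟨p₀, hp₀, -, hp₀s⟩ := hlt h
  have hPle : P ≤ y.length := (Nat.find_min' hE hp₀s).trans hp₀
  set Q := Nat.findGreatest (fun p => EndsSync M (y.take p)) y.length with hQ
  have hQs : EndsSync M (y.take Q) := Nat.findGreatest_spec (P := fun p => EndsSync M (y.take p))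
    hp₀ hp₀s
  have hQle : Q ≤ y.length := Nat.findGreatest_le _
  have hPQ : P ≤ Q := Nat.find_min' hE hQs
  refine ⟨y.take P, (y.take Q).drop P, y.drop Q, ?_, hPs, ?_, ?_⟩
  · have hPt : y.take P = (y.take Q).take P := by rw [List.take_take, Nat.min_eq_left hPQ]
    rw [← List.append_assoc, hPt, List.take_append_drop, List.take_append_drop]
  · nth_rewrite 1 [← Nat.min_eq_left hPQ]
    rwa [← List.take_take, List.take_append_drop]
  · have h1 : ∀ p < P, ¬ HasSync M (y.take p) := by
      intro p hp hs
      obtain ⟨q, hq, -, hqs⟩ := hlt hs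
      rw [List.take_take] at hqs
      have := Nat.find_min' hE hqs
      omega
    have h2 : ∀ p, Q ≤ p → ¬ HasSync M (y.drop p) := by
      intro p hp hs
      obtain ⟨q, hq, hq0, hqs⟩ := hlt hs
      have h3 : EndsSync M (y.take (p + q)) := by
        have := hqs.append_left (y.take p)
        rwa [← List.take_add] at this
      rw [List.length_drop] at hq
      have := Nat.le_findGreatest (P := fun p => EndsSync M (y.take p))
        (by omega : p + q ≤ y.length) h3
      omega
    unfold syncCost
    rw [Finset.sum_add_distrib]
    refine add_le_add ?_ ?_
    · calc (y.take P).length ≤ ∑ p ∈ Finset.range P, 1 := by simp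
        _ ≤ ∑ p ∈ Finset.range P, (if HasSync M (y.take p) then 0 else 1) :=
          Finset.sum_le_sum fun p hp => by simp [h1 p (Finset.mem_range.1 hp)]
        _ ≤ _ := Finset.sum_le_sum_of_subset (by
          intro p
          simp only [Finset.mem_range]
          omega)
    · calc (y.drop Q).length ≤ ∑ p ∈ Finset.Ico Q (y.length + 1), 1 := by simp; omega
        _ ≤ ∑ p ∈ Finset.Ico Q (y.length + 1), (if HasSync M (y.drop p) then 0 else 1) :=
          Finset.sum_le_sum fun p hp => by simp [h2 p (Finset.mem_Ico.1 hp).1]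
        _ ≤ _ := Finset.sum_le_sum_of_subset (by
          intro p
          simp only [Finset.mem_range, Finset.mem_Ico]
          omega)

end Dedup

namespace Dedup

/-! ### Unique decodability of multi-chunk deduplication -/

theorem chunkAt_eq_getElem {Z : List (List Bool)} {c : ℕ} (hc : c < Z.length) :
    chunkAt Z c = Z[c] := by
  simp [chunkAt, hc]

theorem newRun_spec {Z : List (List Bool)} {c : ℕ} (hc : c < Z.length) :
    c + newRun Z c ≤ Z.length ∧ ∀ i < newRun Z c, IsNew Z (c + i) :=
  Nat.findGreatest_spec (P := fun v => c + v ≤ Z.length ∧ ∀ i < v, IsNew Z (c + i))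
    (Nat.zero_le _) ⟨hc.le, by simp⟩

theorem one_le_newRun {Z : List (List Bool)} {c : ℕ} (hc : c < Z.length) (h : IsNew Z c) :
    1 ≤ newRun Z c :=
  Nat.le_findGreatest (by omega) ⟨hc, fun i hi => by
    obtain rfl : i = 0 := by omega
    simpa⟩

theorem newRun_maximal {Z : List (List Bool)} {c : ℕ} (hc : c < Z.length)
    (h : c + newRun Z c < Z.length) : ¬ IsNew Z (c + newRun Z c) := by
  intro hn
  have hs := newRun_spec hc
  have : newRun Z c + 1 ≤ newRun Z c :=
    Nat.le_findGreatest (by omega) ⟨by omega, fun i hi => by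
      rcases Nat.lt_succ_iff_lt_or_eq.1 hi with hi | rfl
      · exact hs.2 i hi
      · exact hn⟩
  omega

theorem oldRun_spec {Z : List (List Bool)} {c : ℕ} (hc : c < Z.length) :
    c + oldRun Z c ≤ Z.length ∧
      ∀ i < oldRun Z c, chunkAt Z (firstIdx Z c + i) = chunkAt Z (c + i) :=
  Nat.findGreatest_spec (P := fun w => c + w ≤ Z.length ∧
    ∀ i < w, chunkAt Z (firstIdx Z c + i) = chunkAt Z (c + i)) (Nat.zero_le _) ⟨hc.le, by simp⟩

theorem le_oldRun {Z : List (List Bool)} {c w : ℕ} (hw : c + w ≤ Z.length)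
    (h : ∀ i < w, chunkAt Z (firstIdx Z c + i) = chunkAt Z (c + i)) : w ≤ oldRun Z c :=
  Nat.le_findGreatest (by omega) ⟨hw, h⟩

theorem chunkAt_firstIdx {Z : List (List Bool)} {c : ℕ} (hc : c < Z.length) :
    chunkAt Z (firstIdx Z c) = chunkAt Z c := by
  have hm : chunkAt Z c ∈ Z := by
    rw [chunkAt_eq_getElem hc]
    exact List.getElem_mem hc
  have h : firstIdx Z c < Z.length := List.idxOf_lt_length_iff.2 hm
  rw [chunkAt_eq_getElem h]
  exact List.getElem_idxOf h

theorem idxOf_eq_idxOf_take {Z : List (List Bool)} {z : List Bool} {k : ℕ} (h : z ∈ Z.take k) :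
    Z.idxOf z = (Z.take k).idxOf z := by
  conv_lhs => rw [← List.take_append_drop k Z]
  exact List.idxOf_append_of_mem h

theorem firstIdx_lt {Z : List (List Bool)} {c : ℕ} (h : ¬ IsNew Z c) :
    firstIdx Z c < c := by
  unfold IsNew at h
  rw [not_not] at h
  unfold firstIdx
  have h1 : (Z.take c).idxOf (chunkAt Z c) < (Z.take c).length := List.idxOf_lt_length_iff.2 h
  have h2 : Z.idxOf (chunkAt Z c) = (Z.take c).idxOf (chunkAt Z c) :=
    idxOf_eq_idxOf_take h
  rw [h2]
  exact h1.trans_le (List.length_take_le _ _)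

theorem firstIdx_eq {Z : List (List Bool)} {c i : ℕ} (hi : i < Z.length)
    (h : chunkAt Z i = chunkAt Z c) (hn : IsNew Z i) : firstIdx Z c = i := by
  unfold firstIdx
  rw [← h]
  unfold IsNew at hn
  have hz := chunkAt_eq_getElem hi
  generalize chunkAt Z i = z at hn hz
  conv_lhs => rw [← List.take_append_drop i Z]
  rw [List.idxOf_append_of_notMem hn, List.drop_eq_getElem_cons hi, hz, List.idxOf_cons_self,
    List.length_take]
  omega

theorem isNew_firstIdx {Z : List (List Bool)} {c : ℕ} (hc : c < Z.length) :
    IsNew Z (firstIdx Z c) := by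
  unfold IsNew
  rw [chunkAt_firstIdx hc]
  intro h
  have h1 : (Z.take (firstIdx Z c)).idxOf (chunkAt Z c) < (Z.take (firstIdx Z c)).length :=
    List.idxOf_lt_length_iff.2 h
  have h2 : Z.idxOf (chunkAt Z c) = (Z.take (firstIdx Z c)).idxOf (chunkAt Z c) :=
    idxOf_eq_idxOf_take h
  have h3 := List.length_take_le (firstIdx Z c) Z
  unfold firstIdx at *
  omega

theorem one_le_oldRun {Z : List (List Bool)} {c : ℕ} (hc : c < Z.length) : 1 ≤ oldRun Z c :=
  le_oldRun hc fun i hi => by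
    obtain rfl : i = 0 := by omega
    simpa using chunkAt_firstIdx hc

/-- Each new chunk enlarges the dictionary, so the dictionary size before a first appearance serves
as an injective address for it. -/
theorem dictSize_lt_dictSize {Z : List (List Bool)} {i c : ℕ} (hic : i < c)
    (hi : i < Z.length) (hn : IsNew Z i) : dictSize Z i < dictSize Z c := by
  unfold dictSize
  refine Finset.card_lt_card (Finset.ssubset_iff_subset_ne.2 ⟨?_, ?_⟩)
  · intro z hz
    rw [List.mem_toFinset] at hz ⊢
    exact (List.take_prefix_take_left hic.le).subset hz
  · intro h
    have h1 : chunkAt Z i ∈ (Z.take c).toFinset := by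
      rw [List.mem_toFinset, chunkAt_eq_getElem hi, List.mem_take_iff_getElem]
      exact ⟨i, by simp; omega, rfl⟩
    rw [← h, List.mem_toFinset] at h1
    exact hn h1

theorem dictSize_le (Z : List (List Bool)) (c : ℕ) : dictSize Z c ≤ Z.length :=
  (List.toFinset_card_le _).trans (by simp)

theorem toBits_inj {k n n' : ℕ} (hn : n < 2 ^ k) (hn' : n' < 2 ^ k)
    (h : toBits k n = toBits k n') : n = n' := by
  unfold toBits at h
  have h1 := List.ofFn_injective h
  refine Nat.eq_of_testBit_eq fun i => ?_
  by_cases hi : i < k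
  · have := congrFun h1 ⟨k - 1 - i, by omega⟩
    simp only at this
    rwa [show k - 1 - (k - 1 - i) = i by omega] at this
  · push Not at hi
    have h2 : 2 ^ k ≤ 2 ^ i := Nat.pow_le_pow_right (by norm_num) hi
    rw [Nat.testBit_eq_false_of_lt (hn.trans_le h2), Nat.testBit_eq_false_of_lt (hn'.trans_le h2)]

theorem length_pointer (Z : List (List Bool)) (c : ℕ) :
    (pointer Z c).length = Nat.clog 2 (dictSize Z c) := by
  simp [pointer, toBits]

theorem isNew_congr {Z Z' : List (List Bool)} {c : ℕ} (h : Z.take (c + 1) = Z'.take (c + 1)) :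
    IsNew Z c ↔ IsNew Z' c := by
  have h1 : Z.take c = Z'.take c := by
    have := congrArg (List.take c) h
    simpa [List.take_take] using this
  have h2 : chunkAt Z c = chunkAt Z' c := by
    have := congrArg (fun L => List.getD L c []) h
    simpa [chunkAt, List.getD_eq_getElem?_getD, List.getElem?_take] using this
  unfold IsNew
  rw [h1, h2]

theorem dictSize_congr {Z Z' : List (List Bool)} {c : ℕ} (h : Z.take c = Z'.take c) :
    dictSize Z c = dictSize Z' c := by
  unfold dictSize
  rw [h]

theorem chunkAt_congr {Z Z' : List (List Bool)} {c i : ℕ} (h : Z.take c = Z'.take c)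
    (hi : i < c) : chunkAt Z i = chunkAt Z' i := by
  have := congrArg (fun L => List.getD L i []) h
  simpa [chunkAt, List.getD_eq_getElem?_getD, List.getElem?_take, hi] using this

/-- Equal pointers with equal dictionaries designate the same first appearance. -/
theorem firstIdx_eq_of_pointer_eq {Z Z' : List (List Bool)} {c : ℕ} (hc : c < Z.length)
    (hc' : c < Z'.length) (h : Z.take c = Z'.take c) (hn : ¬ IsNew Z c) (hn' : ¬ IsNew Z' c)
    (hp : pointer Z c = pointer Z' c) : firstIdx Z c = firstIdx Z' c := by
  have hf := firstIdx_lt hn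
  have hf' := firstIdx_lt hn'
  have hlt := dictSize_lt_dictSize hf (hf.trans hc) (isNew_firstIdx hc)
  have hlt' := dictSize_lt_dictSize hf' (hf'.trans hc') (isNew_firstIdx hc')
  have hds := dictSize_congr h
  unfold pointer at hp
  rw [hds] at hp hlt
  have hpow : dictSize Z' c ≤ 2 ^ Nat.clog 2 (dictSize Z' c) := Nat.le_pow_clog (by norm_num) _
  have heq := toBits_inj (hlt.trans_le hpow) (hlt'.trans_le hpow) hp
  have htk : ∀ {i : ℕ}, i ≤ c → Z.take i = Z'.take i := by
    intro i hi
    have := congrArg (List.take i) h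
    simpa [List.take_take, hi] using this
  rcases lt_trichotomy (firstIdx Z c) (firstIdx Z' c) with hlt0 | h0 | hlt0
  · have h1 : IsNew Z' (firstIdx Z c) := (isNew_congr (htk (by omega))).1 (isNew_firstIdx hc)
    have := dictSize_lt_dictSize hlt0 (hf.trans hc') h1
    rw [← dictSize_congr (htk (by omega))] at this
    omega
  · exact h0
  · have h1 : IsNew Z (firstIdx Z' c) := (isNew_congr (htk (by omega))).2 (isNew_firstIdx hc')
    have := dictSize_lt_dictSize hlt0 (hf'.trans hc) h1
    rw [dictSize_congr (htk (i := firstIdx Z' c) (by omega))] at this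
    omega

/-- A match may overlap the chunks it produces, so agreement is extended one chunk at a time: the
source `i₀ + w` always precedes the target `c + w`. -/
theorem take_add_eq_of_old {Z Z' : List (List Bool)} {c w : ℕ} (hw : c + w ≤ Z.length)
    (hw' : c + w ≤ Z'.length) (h : Z.take c = Z'.take c) {i₀ : ℕ} (hi₀ : i₀ < c)
    (hZ : ∀ i < w, chunkAt Z (i₀ + i) = chunkAt Z (c + i))
    (hZ' : ∀ i < w, chunkAt Z' (i₀ + i) = chunkAt Z' (c + i)) :
    Z.take (c + w) = Z'.take (c + w) := by
  induction w with
  | zero => simpa using h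
  | succ w ih =>
    have ih' := ih (by omega) (by omega) (fun i hi => hZ i (by omega))
      (fun i hi => hZ' i (by omega))
    rw [← add_assoc, List.take_succ_eq_append_getElem (by omega),
      List.take_succ_eq_append_getElem (by omega), ih', ← chunkAt_eq_getElem,
      ← chunkAt_eq_getElem, ← hZ w (by omega), ← hZ' w (by omega),
      chunkAt_congr ih' (by omega)]

/-- Simulates the decoder: with the total length and the first `c` chunks known, the flag, run
length and payload determine the next run. Arbitrary continuations `r`, `r'` make this a prefix
statement, not just injectivity. The two step budgets may differ, as the chunk counts are not known
to agree. -/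
theorem encodeFrom_unique (K : IntCode) (M : ℕ) {s s' : List Bool} (hlen : s.length = s'.length)
    (n n' c : ℕ) (hn : (chunks M s).length ≤ n + c) (hn' : (chunks M s').length ≤ n' + c)
    (hc : c ≤ (chunks M s).length) (hc' : c ≤ (chunks M s').length)
    (htake : (chunks M s).take c = (chunks M s').take c) {r r' : List Bool}
    (h : encodeFrom K (chunks M s) n c ++ r = encodeFrom K (chunks M s') n' c ++ r') :
    s = s' := by
  induction n generalizing n' c r r' with
  | zero =>
    have hc0 : c = (chunks M s).length := by omega
    obtain ⟨t, ht, hst⟩ := exists_drop_chunks M s c hc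
    obtain ⟨t', ht', hst'⟩ := exists_drop_chunks M s' c hc'
    have ht0 : t = [] := by
      rw [hc0, List.drop_length] at ht
      rw [← chunks_flatten M t, ← ht, List.flatten_nil]
    rw [hst, hst', htake, ht0] at hlen ⊢
    have : t' = [] := by simpa using hlen
    rw [this]
  | succ n ih =>
    obtain ⟨t, ht, hst⟩ := exists_drop_chunks M s c hc
    obtain ⟨t', ht', hst'⟩ := exists_drop_chunks M s' c hc'
    have htl : t.length = t'.length := by
      have := hlen
      rw [hst, hst', htake] at this
      simpa using this
    by_cases hcl : c < (chunks M s).length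
    swap
    · have ht0 : t = [] := by
        rw [List.drop_eq_nil_of_le (by omega)] at ht
        rw [← chunks_flatten M t, ← ht, List.flatten_nil]
      rw [hst, hst', htake, ht0]
      rw [ht0] at htl
      have : t' = [] := by simpa using htl.symm
      rw [this]
    have hcl' : c < (chunks M s').length := by
      by_contra hcon
      rw [List.drop_eq_nil_of_le (by omega)] at ht'
      have ht0 : t' = [] := by rw [← chunks_flatten M t', ← ht', List.flatten_nil]
      rw [ht0] at htl
      have ht1 : t = [] := by simpa using htl
      rw [ht1, chunks_nil, List.drop_eq_nil_iff] at ht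
      omega
    obtain ⟨n', rfl⟩ : ∃ k, n' = k + 1 := ⟨n' - 1, by omega⟩
    simp only [encodeFrom, hcl, hcl', if_true] at h
    set Z := chunks M s with hZ
    set Z' := chunks M s' with hZ'
    by_cases hnew : IsNew Z c
    · have hnew' : IsNew Z' c := by
        by_contra hcon
        simp [hnew, hcon] at h
      simp only [hnew, hnew', if_true, List.append_assoc, List.cons_append, List.nil_append,
        List.cons.injEq, true_and] at h
      have h1 := one_le_newRun hcl hnew
      have hV := K.prefixFree.eq_of_append_eq h1 (one_le_newRun hcl' hnew') h
      rw [← hV] at h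
      have h := List.append_cancel_left h
      have hs1 := newRun_spec hcl
      have hs1' := newRun_spec hcl'
      have hle : newRun Z c ≤ (chunks M t).length := by
        rw [← ht, List.length_drop]
        omega
      have hle' : newRun Z c ≤ (chunks M t').length := by
        rw [← ht', List.length_drop]
        omega
      have hdrop : (Z.drop c).take (newRun Z c) = (Z'.drop c).take (newRun Z c) := by
        rw [ht, ht']
        rw [ht, ht'] at h
        exact take_chunks_unique htl hle hle' h
      rw [hdrop] at h
      have h := List.append_cancel_left h
      refine ih n' (c + newRun Z c) (by omega) (by omega) hs1.1 (by omega) ?_ h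
      rw [List.take_add, List.take_add, htake, hdrop]
    · have hnew' : ¬ IsNew Z' c := by
        intro hcon
        simp [hnew, hcon] at h
      simp only [hnew, hnew', if_false, List.append_assoc, List.cons_append, List.nil_append,
        List.cons.injEq, true_and] at h
      have h1 := one_le_oldRun hcl
      have hV := K.prefixFree.eq_of_append_eq h1 (one_le_oldRun hcl') h
      rw [← hV] at h
      have h := List.append_cancel_left h
      have hpl : (pointer Z c).length = (pointer Z' c).length := by
        rw [length_pointer, length_pointer, dictSize_congr htake]
      obtain ⟨hp, h⟩ := List.append_inj h hpl
      have hfi := firstIdx_eq_of_pointer_eq hcl hcl' htake hnew hnew' hp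
      have hs1 := oldRun_spec hcl
      have hs1' := oldRun_spec hcl'
      rw [← hV, ← hfi] at hs1'
      exact ih n' (c + oldRun Z c) (by omega) (by omega) hs1.1 hs1'.1
        (take_add_eq_of_old hs1.1 hs1'.1 htake (firstIdx_lt hnew) hs1.2 hs1'.2) h

/-- The empty string is excluded because the integer code is unconstrained at 0; source strings are
never empty. -/
theorem prefixFreeOn_mcEncode (K : IntCode) (M : ℕ) :
    PrefixFreeOn (mcEncode K M) {s | s ≠ []} := by
  intro s hs t ht hst ⟨r, hr⟩
  apply hst
  have hs' : 1 ≤ s.length := List.length_pos_iff.2 hs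
  have ht' : 1 ≤ t.length := List.length_pos_iff.2 ht
  unfold mcEncode at hr
  rw [List.append_assoc] at hr
  have hlen := K.prefixFree.eq_of_append_eq hs' ht' hr
  rw [hlen] at hr
  have hr := List.append_cancel_left hr
  refine encodeFrom_unique K M hlen (chunks M s).length (chunks M t).length 0 (by simp) (by simp) (by simp) (by simp) (by simp)
    (r := r) (r' := []) ?_
  simpa using hr

end Dedup

namespace Dedup

/-! ### The length of the encoding -/

theorem length_flatten_take_drop (Z : List (List Bool)) {c V : ℕ} (h : c + V ≤ Z.length) :
    ((Z.drop c).take V).flatten.length = ∑ i ∈ Finset.Ico c (c + V), (chunkAt Z i).length := by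
  induction V with
  | zero => simp
  | succ V ih =>
    rw [← add_assoc, Finset.sum_Ico_succ_top (by omega), ← ih (by omega),
      List.take_succ_eq_append_getElem (by simp; omega), List.flatten_append, List.length_append,
      chunkAt_eq_getElem (by omega)]
    simp

/-- The encoding spends the length of the new chunks and an overhead `κ` per run; the number of
runs is controlled by a set of marked chunks that meets every old run. -/
theorem length_encodeFrom_le (K : IntCode) (Z : List (List Bool)) {κ : ℕ}
    (hκ : ∀ v, 1 ≤ v → v ≤ Z.length → 1 + (K.enc v).length + Nat.clog 2 Z.length ≤ κ)
    {marks : Finset ℕ} (hmarks : ∀ c < Z.length, ¬ IsNew Z c →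
      ∃ i ∈ marks, c ≤ i ∧ i < c + oldRun Z c) (n c : ℕ) :
    (encodeFrom K Z n c).length ≤
      ∑ i ∈ (Finset.Ico c Z.length).filter (IsNew Z ·), (chunkAt Z i).length +
        κ * (2 * (marks.filter (c ≤ ·)).card + if c < Z.length ∧ IsNew Z c then 1 else 0) := by
  induction n generalizing c with
  | zero => simp [encodeFrom]
  | succ n ih =>
    by_cases hc : c < Z.length
    swap
    · simp [encodeFrom, hc]
    simp only [encodeFrom, hc, if_true, true_and]
    by_cases hn : IsNew Z c
    · simp only [hn, if_true, List.length_append, List.length_cons, List.length_nil]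
      have hs := newRun_spec hc
      have h1 := one_le_newRun hc hn
      have hk := hκ _ h1 (by omega)
      have h2 := ih (c + newRun Z c)
      -- A maximal new run is followed by an old run or by the end, so the extra unit in the bound
      -- pays for the current run and is not needed afterwards.
      have h3 : ¬ (c + newRun Z c < Z.length ∧ IsNew Z (c + newRun Z c)) :=
        fun h => newRun_maximal hc h.1 h.2
      rw [if_neg h3] at h2
      have h4 : (marks.filter (c + newRun Z c ≤ ·)).card ≤ (marks.filter (c ≤ ·)).card := by
        refine Finset.card_le_card fun i => ?_
        simp only [Finset.mem_filter]
        rintro ⟨h, h'⟩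
        exact ⟨h, by omega⟩
      have h5 : ∑ i ∈ (Finset.Ico c Z.length).filter (IsNew Z ·), (chunkAt Z i).length =
          ∑ i ∈ Finset.Ico c (c + newRun Z c), (chunkAt Z i).length +
          ∑ i ∈ (Finset.Ico (c + newRun Z c) Z.length).filter (IsNew Z ·),
            (chunkAt Z i).length := by
        rw [Finset.sum_filter, Finset.sum_filter,
          ← Finset.sum_Ico_consecutive _ (Nat.le_add_right c _) hs.1]
        congr 1
        refine Finset.sum_congr rfl fun i hi => ?_
        rw [Finset.mem_Ico] at hi
        have := hs.2 (i - c) (by omega)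
        rw [show c + (i - c) = i by omega] at this
        rw [if_pos this]
      rw [length_flatten_take_drop Z hs.1, h5]
      have h6 := Nat.mul_le_mul_left κ (Nat.mul_le_mul_left 2 h4)
      simp only [add_zero, Nat.mul_add, mul_one] at h2 h6 ⊢
      omega
    · simp only [hn, if_false, List.length_append, List.length_cons, List.length_nil,
        length_pointer]
      have hs := oldRun_spec hc
      have h1 := one_le_oldRun hc
      have hk := hκ _ h1 (by omega)
      have h2 := ih (c + oldRun Z c)
      have hcl : Nat.clog 2 (dictSize Z c) ≤ Nat.clog 2 Z.length :=
        Nat.clog_mono_right 2 (dictSize_le Z c)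
      obtain ⟨i, him, hi1, hi2⟩ := hmarks c hc hn
      have h4 : (marks.filter (c + oldRun Z c ≤ ·)).card + 1 ≤ (marks.filter (c ≤ ·)).card := by
        refine Finset.card_lt_card (Finset.ssubset_iff_of_subset ?_ |>.2 ⟨i, ?_, ?_⟩)
        · intro j
          simp only [Finset.mem_filter]
          rintro ⟨h, h'⟩
          exact ⟨h, by omega⟩
        · simp [him, hi1]
        · simp [him, hi2]
      have h5 : ∑ i ∈ (Finset.Ico (c + oldRun Z c) Z.length).filter (IsNew Z ·),
            (chunkAt Z i).length ≤
          ∑ i ∈ (Finset.Ico c Z.length).filter (IsNew Z ·), (chunkAt Z i).length := by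
        refine Finset.sum_le_sum_of_subset (Finset.filter_subset_filter _ ?_)
        exact Finset.Ico_subset_Ico (by omega) le_rfl
      have h6 := Nat.mul_le_mul_left κ (Nat.mul_le_mul_left 2 h4)
      -- The mark inside this old run pays for two overheads: that of the old run and that of a
      -- possible new run following it.
      have h7 : κ * (2 * (marks.filter (c + oldRun Z c ≤ ·)).card +
          if c + oldRun Z c < Z.length ∧ IsNew Z (c + oldRun Z c) then 1 else 0) ≤
          κ * (2 * (marks.filter (c + oldRun Z c ≤ ·)).card + 1) := by
        gcongr
        split_ifs <;> simp
      simp only [add_zero, Nat.mul_add, mul_one] at h2 h6 h7 ⊢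
      omega

/-- Two equal chunks cannot both be new, so chunk values are injective on the new indices. -/
theorem sum_new_le (Z : List (List Bool)) :
    ∑ i ∈ (Finset.Ico 0 Z.length).filter (IsNew Z ·), (chunkAt Z i).length ≤
      ∑ z ∈ Z.toFinset, z.length := by
  rw [← Finset.sum_image (f := fun z : List Bool => z.length) (g := fun i => chunkAt Z i)]
  · refine Finset.sum_le_sum_of_subset fun z hz => ?_
    simp only [Finset.mem_image, Finset.mem_filter, Finset.mem_Ico] at hz
    obtain ⟨i, ⟨⟨-, hi⟩, -⟩, rfl⟩ := hz
    rw [List.mem_toFinset, chunkAt_eq_getElem hi]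
    exact List.getElem_mem hi
  · have key : ∀ i k, i < k → k < Z.length → IsNew Z k → chunkAt Z i ≠ chunkAt Z k := by
      intro i k hik hk hn heq
      apply hn
      rw [← heq, chunkAt_eq_getElem (by omega), List.mem_take_iff_getElem]
      exact ⟨i, by simp; omega, rfl⟩
    intro i hi k hk hik
    simp only [Finset.coe_filter, Finset.mem_Ico, Set.mem_ofPred_eq] at hi hk
    rcases lt_trichotomy i k with h | h | h
    · exact absurd hik (key i k h hk.1.2 hk.2)
    · exact h
    · exact absurd hik.symm (key k i h hi.1.2 hi.2)

theorem length_encodeFrom_zero_le (K : IntCode) (Z : List (List Bool)) {κ : ℕ}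
    (hκ : ∀ v, 1 ≤ v → v ≤ Z.length → 1 + (K.enc v).length + Nat.clog 2 Z.length ≤ κ)
    {marks : Finset ℕ} (hmarks : ∀ c < Z.length, ¬ IsNew Z c →
      ∃ i ∈ marks, c ≤ i ∧ i < c + oldRun Z c) (n : ℕ) :
    (encodeFrom K Z n 0).length ≤
      ∑ z ∈ Z.toFinset, z.length + κ * (2 * marks.card + 1) := by
  refine (length_encodeFrom_le K Z hκ hmarks n 0).trans
    (add_le_add (sum_new_le Z) (Nat.mul_le_mul_left κ ?_))
  simp only [Nat.zero_le, Finset.filter_true]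
  split_ifs <;> omega

theorem sum_toFinset_length_le (L : List (List Bool)) :
    ∑ z ∈ L.toFinset, z.length ≤ L.flatten.length := by
  induction L with
  | nil => simp
  | cons z L ih =>
    rw [List.toFinset_cons, List.flatten_cons, List.length_append]
    by_cases h : z ∈ L.toFinset
    · rw [Finset.insert_eq_of_mem h]
      omega
    · rw [Finset.sum_insert h]
      omega

/-- Takes every chunk as marked, which requires no structure of the source. -/
theorem length_encodeFrom_trivial (K : IntCode) (M : ℕ) (s : List Bool) {κ : ℕ}
    (hκ : ∀ v, 1 ≤ v → v ≤ (chunks M s).length →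
      1 + (K.enc v).length + Nat.clog 2 (chunks M s).length ≤ κ) (n : ℕ) :
    (encodeFrom K (chunks M s) n 0).length ≤
      s.length + κ * (2 * (chunks M s).length + 1) := by
  have h := length_encodeFrom_zero_le K (chunks M s) hκ
    (marks := Finset.range (chunks M s).length) (fun c hc _ =>
      ⟨c, by simpa using hc, le_rfl, by have := one_le_oldRun hc; omega⟩) n
  have h2 := sum_toFinset_length_le (chunks M s)
  rw [chunks_flatten] at h2
  rw [Finset.card_range] at h
  omega

/-! ### Decomposition of the chunks into cores of the blocks and glue between them -/

open Classical in
/-- The split of a block at its first and its last synchronizing pattern. -/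
noncomputable def syncParts (M : ℕ) (y : List Bool) : List Bool × List Bool × List Bool :=
  if h : ∃ q : List Bool × List Bool × List Bool, y = q.1 ++ (q.2.1 ++ q.2.2) ∧
      EndsSync M q.1 ∧ EndsSync M (q.1 ++ q.2.1) ∧ q.1.length + q.2.2.length ≤ syncCost M y
  then h.choose else ([], [], [])

/-- The part of a block between its first and its last synchronizing pattern. -/
noncomputable def core (M : ℕ) (y : List Bool) : List Bool := (syncParts M y).2.1

/-- The split is chosen as a function of the block alone, so all occurrences of a block have
literally the same core. -/
theorem syncParts_spec {M : ℕ} (hM : 1 ≤ M) {y : List Bool} (hy : HasSync M y) :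
    y = (syncParts M y).1 ++ (core M y ++ (syncParts M y).2.2) ∧
      EndsSync M (syncParts M y).1 ∧ EndsSync M ((syncParts M y).1 ++ core M y) ∧
      (syncParts M y).1.length + (syncParts M y).2.2.length ≤ syncCost M y := by
  obtain ⟨u, m, v, h⟩ := exists_sync_split hM hy
  have h' : ∃ q : List Bool × List Bool × List Bool, y = q.1 ++ (q.2.1 ++ q.2.2) ∧
      EndsSync M q.1 ∧ EndsSync M (q.1 ++ q.2.1) ∧ q.1.length + q.2.2.length ≤ syncCost M y :=
    ⟨(u, m, v), h⟩
  have := h'.choose_spec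
  unfold core syncParts
  rw [dif_pos h']
  exact this

/-- There are forced boundaries both before and after the core. Hence its parsing from a fresh start
ends on a boundary, and its chunks do not depend on the context. -/
theorem unfinished_core {M : ℕ} (hM : 1 ≤ M) {y : List Bool} (hy : HasSync M y) :
    unfinished M [] (core M y) = [] := by
  obtain ⟨-, h1, h2, -⟩ := syncParts_spec hM hy
  have h3 := unfinished_eq_nil_of_endsSync hM h2
  rwa [unfinished_append, unfinished_eq_nil_of_endsSync hM h1] at h3

open Classical in
/-- The chunks of a string `g` followed by the blocks `ys`, grouped in segments: the cores of the
blocks, tagged with the block, and the glue between them. -/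
noncomputable def segments (M : ℕ) : List Bool → List (List Bool) →
    List (Option (List Bool) × List (List Bool))
  | g, [] => [(none, chunks M g)]
  | g, y :: ys =>
      if HasSync M y then
        (none, chunks M (g ++ (syncParts M y).1)) :: (some y, chunks M (core M y)) ::
          segments M (syncParts M y).2.2 ys
      else segments M (g ++ y) ys

/-- The chunks in a list of segments. -/
def segChunks (G : List (Option (List Bool) × List (List Bool))) : List (List Bool) :=
  (G.map Prod.snd).flatten

theorem segChunks_append (G G' : List (Option (List Bool) × List (List Bool))) :
    segChunks (G ++ G') = segChunks G ++ segChunks G' := by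
  simp [segChunks]

theorem segChunks_cons (q : Option (List Bool) × List (List Bool))
    (G : List (Option (List Bool) × List (List Bool))) :
    segChunks (q :: G) = q.2 ++ segChunks G := by
  simp [segChunks]

/-- The string `g` carries the text since the last forced boundary: the tail of the last
synchronizing block and any later blocks without a pattern. -/
theorem segChunks_segments {M : ℕ} (hM : 1 ≤ M) (g : List Bool) (ys : List (List Bool)) :
    segChunks (segments M g ys) = chunks M (g ++ ys.flatten) := by
  induction ys generalizing g with
  | nil => simp [segments, segChunks]
  | cons y ys ih =>
    simp only [segments]
    split_ifs with h
    · obtain ⟨hy, h1, h2, -⟩ := syncParts_spec hM h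
      rw [segChunks_cons, segChunks_cons, ih, List.flatten_cons]
      conv_rhs => rw [hy]
      simp only
      rw [← chunks_append (unfinished_core hM h),
        ← chunks_append (unfinished_eq_nil_of_endsSync hM (h1.append_left g))]
      simp
    · rw [ih]
      simp

/-- The marked chunks: all glue and the last chunk of each core. -/
def segMarks : ℕ → List (Option (List Bool) × List (List Bool)) → Finset ℕ
  | _, [] => ∅
  | off, (none, h) :: G => Finset.Ico off (off + h.length) ∪ segMarks (off + h.length) G
  | off, (some _, h) :: G => {off + h.length - 1} ∪ segMarks (off + h.length) G

theorem exists_segMarks (off : ℕ) (G : List (Option (List Bool) × List (List Bool))) {c : ℕ}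
    (hc : c < (segChunks G).length) :
    ∃ G₁ t h G₂ i, G = G₁ ++ (t, h) :: G₂ ∧ i < h.length ∧ c = (segChunks G₁).length + i ∧
      (t = none → off + c ∈ segMarks off G) ∧
      (t ≠ none → off + (segChunks G₁).length + h.length - 1 ∈ segMarks off G) := by
  induction G generalizing off c with
  | nil => simp [segChunks] at hc
  | cons q G ih =>
    obtain ⟨t, h⟩ := q
    by_cases hch : c < h.length
    · refine ⟨[], t, h, G, c, rfl, hch, by simp [segChunks], ?_, ?_⟩
      · rintro rfl
        simp [segMarks, hch]
      · intro ht
        obtain ⟨y, rfl⟩ := Option.ne_none_iff_exists'.1 ht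
        simp [segMarks, segChunks]
    · rw [segChunks_cons, List.length_append] at hc
      simp only at hc
      obtain ⟨G₁, t', h', G₂, i, hG, hi, hci, h1, h2⟩ :=
        ih (off + h.length) (c := c - h.length) (by omega)
      have hsub : segMarks (off + h.length) G ⊆ segMarks off ((t, h) :: G) := by
        cases t <;> simp only [segMarks] <;> exact Finset.subset_union_right
      refine ⟨(t, h) :: G₁, t', h', G₂, i, by simp [hG], hi, ?_, ?_, ?_⟩
      · rw [segChunks_cons, List.length_append]
        simp only
        omega
      · intro ht
        have := hsub (h1 ht)
        rwa [show off + h.length + (c - h.length) = off + c by omega] at this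
      · intro ht
        have := hsub (h2 ht)
        rw [segChunks_cons, List.length_append]
        simp only
        rwa [show off + (h.length + (segChunks G₁).length) + h'.length - 1 =
          off + h.length + (segChunks G₁).length + h'.length - 1 by omega]

/-- A glue segment has at most one chunk more than its length divided by `2^(M-1)`. Each
synchronizing block contributes such a rounding unit and one mark for its core, whence `2 *
ys.length + 1`. Blocks without a pattern lie entirely in the glue, but `syncCost` dominates their
length. For an empty core the mark is only a superfluous index, which does not harm the count. -/
theorem card_segMarks_mul_le {M : ℕ} (hM : 1 ≤ M) (off : ℕ) (g : List Bool)
    (ys : List (List Bool)) :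
    (segMarks off (segments M g ys)).card * 2 ^ (M - 1) ≤
      g.length + (ys.map (syncCost M)).sum + (2 * ys.length + 1) * 2 ^ (M - 1) := by
  induction ys generalizing g off with
  | nil =>
    simpa [segments, segMarks] using length_chunks_mul_le M g
  | cons y ys ih =>
    simp only [segments, List.map_cons, List.sum_cons, List.length_cons]
    split_ifs with h
    · obtain ⟨-, -, -, h4⟩ := syncParts_spec hM h
      simp only [segMarks]
      have h1 := length_chunks_mul_le M (g ++ (syncParts M y).1)
      set n₁ := (chunks M (g ++ (syncParts M y).1)).length
      set n₂ := (chunks M (core M y)).length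
      have h2 := ih (off + n₁ + n₂) (syncParts M y).2.2
      have h3 : (Finset.Ico off (off + n₁) ∪ ({off + n₁ + n₂ - 1} ∪
          segMarks (off + n₁ + n₂) (segments M (syncParts M y).2.2 ys))).card ≤
          n₁ + (1 + (segMarks (off + n₁ + n₂) (segments M (syncParts M y).2.2 ys)).card) := by
        refine (Finset.card_union_le _ _).trans (add_le_add (by simp) ?_)
        exact (Finset.card_union_le _ _).trans (by simp)
      have h5 := Nat.mul_le_mul_right (2 ^ (M - 1)) h3
      rw [List.length_append] at h1
      simp only [Nat.add_mul, Nat.mul_add, one_mul] at h1 h2 h5 ⊢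
      omega
    · have h1 := ih off (g ++ y)
      have h2 := length_le_syncCost h
      rw [List.length_append] at h1
      simp only [Nat.add_mul, Nat.mul_add] at h1 ⊢
      omega

/-- Every chunk comes either from the glue, charged at full length, or from a core that depends only
on its block and is charged once per distinct block. -/
theorem sum_toFinset_segments_le {M : ℕ} (hM : 1 ≤ M) (g : List Bool) (ys : List (List Bool)) :
    ∑ z ∈ (segChunks (segments M g ys)).toFinset, z.length ≤
      g.length + (ys.map (syncCost M)).sum + ∑ y ∈ ys.toFinset, y.length := by
  have key : ∃ glue : List (List Bool),
      (∀ z ∈ segChunks (segments M g ys), z ∈ glue ∨ ∃ y ∈ ys, HasSync M y ∧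
        z ∈ chunks M (core M y)) ∧
      glue.flatten.length ≤ g.length + (ys.map (syncCost M)).sum := by
    induction ys generalizing g with
    | nil => exact ⟨chunks M g, by simp [segments, segChunks], by simp [chunks_flatten]⟩
    | cons y ys ih =>
      simp only [segments]
      split_ifs with h
      · obtain ⟨-, -, -, h4⟩ := syncParts_spec hM h
        obtain ⟨glue, h1, h2⟩ := ih (syncParts M y).2.2
        refine ⟨chunks M (g ++ (syncParts M y).1) ++ glue, ?_, ?_⟩
        · intro z hz
          rw [segChunks_cons, segChunks_cons, List.mem_append, List.mem_append] at hz
          rcases hz with hz | hz | hz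
          · exact Or.inl (List.mem_append_left _ hz)
          · exact Or.inr ⟨y, by simp, h, hz⟩
          · rcases h1 z hz with h1 | ⟨y', hy', h1⟩
            · exact Or.inl (List.mem_append_right _ h1)
            · exact Or.inr ⟨y', by simp [hy'], h1⟩
        · rw [List.flatten_append, chunks_flatten, List.length_append, List.length_append,
            List.map_cons, List.sum_cons]
          omega
      · obtain ⟨glue, h1, h2⟩ := ih (g ++ y)
        refine ⟨glue, fun z hz => (h1 z hz).imp_right ?_, ?_⟩
        · rintro ⟨y', hy', h1⟩
          exact ⟨y', by simp [hy'], h1⟩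
        · have h3 := length_le_syncCost h
          rw [List.length_append] at h2
          rw [List.map_cons, List.sum_cons]
          omega
  classical
  obtain ⟨glue, h1, h2⟩ := key
  have hsub : (segChunks (segments M g ys)).toFinset ⊆
      glue.toFinset ∪ (ys.toFinset.filter (HasSync M)).biUnion
        fun y => (chunks M (core M y)).toFinset := by
    intro z hz
    rw [List.mem_toFinset] at hz
    simp only [Finset.mem_union, Finset.mem_biUnion, Finset.mem_filter, List.mem_toFinset]
    rcases h1 z hz with h | ⟨y, hy, hs, h⟩
    · exact Or.inl h
    · exact Or.inr ⟨y, ⟨hy, hs⟩, h⟩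
  have hunion : ∀ S T : Finset (List Bool), ∑ z ∈ S ∪ T, z.length ≤
      ∑ z ∈ S, z.length + ∑ z ∈ T, z.length := by
    intro S T
    rw [← Finset.sum_union_inter]
    omega
  have hbi : ∀ S : Finset (List Bool), (∀ y ∈ S, HasSync M y) →
      ∑ z ∈ S.biUnion (fun y => (chunks M (core M y)).toFinset), z.length ≤
        ∑ y ∈ S, y.length := by
    intro S
    induction S using Finset.induction_on with
    | empty => simp
    | insert y S hy ih =>
      intro hS
      rw [Finset.biUnion_insert, Finset.sum_insert hy]
      refine (hunion _ _).trans (add_le_add ?_ (ih fun y' hy' => hS y' (by simp [hy'])))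
      have h3 := sum_toFinset_length_le (chunks M (core M y))
      rw [chunks_flatten] at h3
      have h4 := congrArg List.length (syncParts_spec hM (hS y (by simp))).1
      rw [List.length_append, List.length_append] at h4
      omega
  have h3 := (Finset.sum_le_sum_of_subset hsub).trans (hunion _ _)
  have h4 := hbi (ys.toFinset.filter (HasSync M)) (by simp)
  have h5 : ∑ y ∈ ys.toFinset.filter (HasSync M), y.length ≤ ∑ y ∈ ys.toFinset, y.length :=
    Finset.sum_le_sum_of_subset (Finset.filter_subset _ _)
  have h6 := sum_toFinset_length_le glue
  omega

/-- No substring of length `N` inside the first occurrence of a block occurs earlier in the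
concatenation of the blocks. -/
def NoRepeat (N : ℕ) (ys : List (List Bool)) : Prop :=
  ∀ ys₁ y ys₂, ys = ys₁ ++ y :: ys₂ → y ∉ ys₁ → ∀ o, o + N ≤ y.length →
    ∀ p < ys₁.flatten.length + o, (ys.flatten.drop p).take N ≠ (y.drop o).take N

theorem segments_split {M : ℕ} (hM : 1 ≤ M) {g : List Bool} {ys : List (List Bool)}
    {G₁ G₂ : List (Option (List Bool) × List (List Bool))} {y : List Bool}
    {h : List (List Bool)} (hG : segments M g ys = G₁ ++ (some y, h) :: G₂) :
    h = chunks M (core M y) ∧ HasSync M y ∧ ∃ ys₁ ys₂, ys = ys₁ ++ y :: ys₂ ∧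
      (segChunks G₁).flatten = g ++ ys₁.flatten ++ (syncParts M y).1 ∧
      ∀ y' ∈ ys₁, HasSync M y' → some y' ∈ G₁.map Prod.fst := by
  induction ys generalizing g G₁ with
  | nil =>
    exfalso
    cases G₁ <;> simp [segments] at hG
  | cons x ys ih =>
    simp only [segments] at hG
    split_ifs at hG with hx
    · cases G₁ with
      | nil => simp at hG
      | cons q G₁ =>
        simp only [List.cons_append, List.cons.injEq] at hG
        obtain ⟨rfl, hG⟩ := hG
        cases G₁ with
        | nil =>
          simp only [List.nil_append, List.cons.injEq, Prod.mk.injEq, Option.some.injEq] at hG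
          obtain ⟨⟨rfl, rfl⟩, -⟩ := hG
          exact ⟨rfl, hx, [], ys, rfl, by simp [segChunks, chunks_flatten], by simp⟩
        | cons q G₁ =>
          simp only [List.cons_append, List.cons.injEq] at hG
          obtain ⟨rfl, hG⟩ := hG
          obtain ⟨h1, h2, ys₁, ys₂, rfl, h4, h5⟩ := ih hG
          refine ⟨h1, h2, x :: ys₁, ys₂, rfl, ?_, ?_⟩
          · obtain ⟨hxe, -⟩ := syncParts_spec hM hx
            rw [segChunks_cons, segChunks_cons, List.flatten_append, List.flatten_append, h4,
              chunks_flatten, chunks_flatten, List.flatten_cons]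
            conv_rhs => rw [hxe]
            simp
          · intro y' hy' hs
            rcases List.mem_cons.1 hy' with rfl | hy'
            · simp
            · have := h5 y' hy' hs
              simp only [List.map_cons, List.mem_cons]
              exact Or.inr (Or.inr this)
    · obtain ⟨h1, h2, ys₁, ys₂, rfl, h4, h5⟩ := ih hG
      refine ⟨h1, h2, x :: ys₁, ys₂, rfl, by simp [h4], ?_⟩
      intro y' hy' hs
      rcases List.mem_cons.1 hy' with rfl | hy'
      · exact absurd hs hx
      · exact h5 y' hy' hs

theorem take_drop_flatten {Z : List (List Bool)} {k N : ℕ} (hk : k < Z.length)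
    (hN : N ≤ Z[k].length) :
    (Z.flatten.drop (Z.take k).flatten.length).take N = Z[k].take N := by
  have : Z.flatten = (Z.take k).flatten ++ (Z[k] ++ (Z.drop (k + 1)).flatten) := by
    conv_lhs => rw [← List.take_append_drop k Z, List.drop_eq_getElem_cons hk,
      List.flatten_append, List.flatten_cons]
  rw [this, List.drop_left, List.take_append_of_le_length hN]

/-- Core chunks are complete, so they have at least `2^(M-1)` bits. An earlier equal chunk would
place the initial window of that length at an earlier position of the text, which `NoRepeat` forbids
inside the first occurrence of a block. -/
theorem isNew_of_first_core {M : ℕ} (hM : 1 ≤ M) {ys : List (List Bool)}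
    (hys : NoRepeat (2 ^ (M - 1)) ys) {G₁ G₂ : List (Option (List Bool) × List (List Bool))}
    {y : List Bool} {h : List (List Bool)} (hG : segments M [] ys = G₁ ++ (some y, h) :: G₂)
    (hy : some y ∉ G₁.map Prod.fst) {i : ℕ} (hi : i < h.length) :
    IsNew (chunks M ys.flatten) ((segChunks G₁).length + i) := by
  obtain ⟨hh, hs, ys₁, ys₂, hysplit, hfl, htag⟩ := segments_split hM hG
  have hZ : chunks M ys.flatten = segChunks G₁ ++ (h ++ segChunks G₂) := by
    have := segChunks_segments hM [] ys
    rw [List.nil_append] at this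
    rw [← this, hG, segChunks_append, segChunks_cons]
  have hyn : y ∉ ys₁ := fun hmem => hy (htag y hmem hs)
  have hcomp : Complete M h[i] := by
    have hmem : h[i] ∈ h := List.getElem_mem hi
    generalize h[i] = z at hmem
    rw [hh, chunks_eq_fullChunks (unfinished_core hM hs)] at hmem
    exact complete_of_mem_fullChunks hmem
  have hS := chunks_flatten M ys.flatten
  set Z := chunks M ys.flatten with hZdef
  have hlen : (segChunks G₁).length + i < Z.length := by
    rw [hZ]
    simp only [List.length_append]
    omega
  have hZi : Z[(segChunks G₁).length + i] = h[i] := by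
    simp only [hZ]
    rw [List.getElem_append_right (by omega), List.getElem_append_left (by omega)]
    simp
  have htk : Z.take ((segChunks G₁).length + i) = segChunks G₁ ++ h.take i := by
    rw [hZ, List.take_length_add_append, List.take_append_of_le_length hi.le]
  unfold IsNew
  rw [chunkAt_eq_getElem hlen, hZi]
  intro hmem
  obtain ⟨k, hk, hkeq⟩ := List.mem_take_iff_getElem.1 hmem
  have hk1 : k < (segChunks G₁).length + i := by omega
  have hk2 : k < Z.length := by omega
  obtain ⟨hyp, -⟩ := syncParts_spec hM hs
  have hcore : core M y = (h.take i).flatten ++ (h[i] ++ (h.drop (i + 1)).flatten) := by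
    rw [← chunks_flatten M (core M y), ← hh]
    conv_lhs => rw [← List.take_append_drop i h, List.drop_eq_getElem_cons hi,
      List.flatten_append, List.flatten_cons]
  have hydrop : (y.drop ((syncParts M y).1 ++ (h.take i).flatten).length).take (2 ^ (M - 1)) =
      h[i].take (2 ^ (M - 1)) := by
    have h1 : y = ((syncParts M y).1 ++ (h.take i).flatten) ++
        (h[i] ++ ((h.drop (i + 1)).flatten ++ (syncParts M y).2.2)) := by
      conv_lhs => rw [hyp, hcore]
      simp
    conv_lhs => enter [2, 2]; rw [h1]
    rw [List.drop_left, List.take_append_of_le_length hcomp.1]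
  refine hys ys₁ y ys₂ hysplit hyn ((syncParts M y).1 ++ (h.take i).flatten).length ?_
    (Z.take k).flatten.length ?_ ?_
  · have h1 := congrArg List.length hyp
    have h2 := congrArg List.length hcore
    have h3 := hcomp.1
    simp only [List.length_append] at h1 h2 ⊢
    omega
  · have h1 : (Z.take ((segChunks G₁).length + i)).flatten.length =
        ys₁.flatten.length + ((syncParts M y).1 ++ (h.take i).flatten).length := by
      rw [htk, List.flatten_append, hfl]
      simp
    rw [← h1]
    have h2 : Z.take (k + 1) <+: Z.take ((segChunks G₁).length + i) :=
      List.take_prefix_take_left (by omega)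
    obtain ⟨r, hr⟩ := h2
    rw [← hr, List.take_succ_eq_append_getElem hk2, hkeq]
    have h3 := List.length_pos_iff.2 hcomp.ne_nil
    simp only [List.flatten_append, List.length_append, List.flatten_singleton]
    omega
  · conv_lhs => rw [← hS]
    rw [take_drop_flatten hk2 (by rw [hkeq]; exact hcomp.1), hkeq, hydrop]

/-- Glue chunks are themselves marked. An old chunk in a core belongs to a repeated block, since the
first core has only new chunks. Its first appearance is then the corresponding chunk of the first
core, so the match runs at least to the marked last chunk of the core. -/
theorem exists_mark_of_old {M : ℕ} (hM : 1 ≤ M) {ys : List (List Bool)}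
    (hys : NoRepeat (2 ^ (M - 1)) ys) {c : ℕ} (hc : c < (chunks M ys.flatten).length)
    (hold : ¬ IsNew (chunks M ys.flatten) c) :
    ∃ i ∈ segMarks 0 (segments M [] ys), c ≤ i ∧ i < c + oldRun (chunks M ys.flatten) c := by
  have hseg : segChunks (segments M [] ys) = chunks M ys.flatten := by
    simpa using segChunks_segments hM [] ys
  obtain ⟨G₁, t, h, G₂, i, hG, hi, rfl, h1, h2⟩ := exists_segMarks 0 (segments M [] ys)
    (hseg ▸ hc)
  set Z := chunks M ys.flatten with hZdef
  cases t with
  | none =>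
    have := one_le_oldRun hc
    exact ⟨_, by simpa using h1 rfl, le_rfl, by omega⟩
  | some y =>
    have hnth : ∀ {A C : List (Option (List Bool) × List (List Bool))},
        segments M [] ys = A ++ (some y, h) :: C →
        (segChunks A).length + h.length ≤ Z.length ∧
        ∀ k < h.length, chunkAt Z ((segChunks A).length + k) = chunkAt h k := by
      intro A C hAC
      have hZ : Z = segChunks A ++ (h ++ segChunks C) := by
        rw [← hseg, hAC, segChunks_append, segChunks_cons]
      refine ⟨by rw [hZ]; simp only [List.length_append]; omega, fun k hk => ?_⟩
      rw [hZ]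
      unfold chunkAt
      rw [List.getD_append_right _ _ _ _ (by omega), List.getD_append _ _ _ _ (by omega)]
      simp
    by_cases hy : some y ∈ G₁.map Prod.fst
    · obtain ⟨as, bs, hab, hya⟩ := List.eq_append_cons_of_mem hy
      obtain ⟨A, B', hAB, rfl, hB⟩ := List.map_eq_append_iff.1 hab
      obtain ⟨⟨t', h'⟩, B, rfl, ht, rfl⟩ := List.map_eq_cons_iff.1 hB
      simp only at ht
      subst ht
      have hG' : segments M [] ys = A ++ (some y, h') :: (B ++ (some y, h) :: G₂) := by
        rw [hG, hAB]
        simp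
      have hh : h' = h := by
        rw [(segments_split hM hG').1, (segments_split hM hG).1]
      rw [hh] at hG'
      have hnew := isNew_of_first_core hM hys hG' hya hi
      obtain ⟨hl, hn⟩ := hnth hG
      obtain ⟨hl', hn'⟩ := hnth hG'
      have hfi : firstIdx Z ((segChunks G₁).length + i) = (segChunks A).length + i :=
        firstIdx_eq (by omega) (by rw [hn i hi, hn' i hi]) hnew
      have hrun : h.length - i ≤ oldRun Z ((segChunks G₁).length + i) := by
        refine le_oldRun (by omega) fun k hk => ?_
        rw [hfi, add_assoc, add_assoc, hn _ (by omega), hn' _ (by omega)]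
      exact ⟨_, h2 (by simp), by omega, by omega⟩
    · exact absurd (isNew_of_first_core hM hys hG hy hi) hold

/-- The length of the encoding of a concatenation of blocks in terms of the distinct blocks and
the synchronization costs. -/
theorem length_encodeFrom_blocks (K : IntCode) {M : ℕ} (hM : 1 ≤ M) {ys : List (List Bool)}
    (hys : NoRepeat (2 ^ (M - 1)) ys) {κ : ℕ}
    (hκ : ∀ v, 1 ≤ v → v ≤ (chunks M ys.flatten).length →
      1 + (K.enc v).length + Nat.clog 2 (chunks M ys.flatten).length ≤ κ) (n : ℕ) :
    ∃ k, k * 2 ^ (M - 1) ≤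
        (ys.map (syncCost M)).sum + (2 * ys.length + 1) * 2 ^ (M - 1) ∧
      (encodeFrom K (chunks M ys.flatten) n 0).length ≤
        ∑ y ∈ ys.toFinset, y.length + (ys.map (syncCost M)).sum + κ * (2 * k + 1) := by
  refine ⟨(segMarks 0 (segments M [] ys)).card, ?_, ?_⟩
  · simpa using card_segMarks_mul_le hM 0 [] ys
  · have h1 := length_encodeFrom_zero_le K (chunks M ys.flatten) hκ
      (fun c hc hold => exists_mark_of_old hM hys hc hold) n
    have h2 := sum_toFinset_segments_le hM [] ys
    have hseg : segChunks (segments M [] ys) = chunks M ys.flatten := by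
      simpa using segChunks_segments hM [] ys
    rw [hseg] at h2
    simp only [List.length_nil] at h2
    omega

end Dedup

namespace Dedup

open scoped ENNReal

/-! ### Probabilities -/

open Classical in
/-- The probability of an event. -/
noncomputable def pr {α : Type} (p : PMF α) (E : α → Prop) : ℝ≥0∞ :=
  ex p fun a => if E a then 1 else 0

section pr

variable {α β : Type}

theorem pr_mono_support (p : PMF α) {E F : α → Prop} (h : ∀ a ∈ p.support, E a → F a) :
    pr p E ≤ pr p F := by
  classical
  refine ex_mono_support p fun a ha => ?_
  by_cases hE : E a
  · simp [hE, h a ha hE]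
  · simp [hE]

theorem pr_mono (p : PMF α) {E F : α → Prop} (h : ∀ a, E a → F a) : pr p E ≤ pr p F :=
  pr_mono_support p fun a _ => h a

theorem pr_le_one (p : PMF α) (E : α → Prop) : pr p E ≤ 1 := by
  classical
  refine ex_le_of_support p fun a _ => ?_
  split_ifs <;> simp

theorem pr_or_le (p : PMF α) (E F : α → Prop) : pr p (fun a => E a ∨ F a) ≤ pr p E + pr p F := by
  classical
  unfold pr
  rw [← ex_add]
  refine ex_mono p fun a => ?_
  by_cases hE : E a <;> by_cases hF : F a <;> simp [hE, hF]

theorem pr_add_pr_not (p : PMF α) (E : α → Prop) : pr p E + pr p (fun a => ¬ E a) = 1 := by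
  classical
  unfold pr
  rw [← ex_add]
  refine Eq.trans ?_ (ex_const p 1)
  refine ex_congr_support p fun a _ => ?_
  by_cases hE : E a <;> simp [hE]

theorem pr_eq_zero (p : PMF α) {E : α → Prop} (h : ∀ a ∈ p.support, ¬ E a) : pr p E = 0 := by
  classical
  refine le_antisymm (ex_le_of_support p fun a ha => ?_) (zero_le)
  simp [h a ha]

theorem pr_exists_mem_le {ι : Type*} (p : PMF α) (s : Finset ι) (E : ι → α → Prop) :
    pr p (fun a => ∃ i ∈ s, E i a) ≤ ∑ i ∈ s, pr p (E i) := by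
  classical
  unfold pr
  rw [← ex_sum]
  refine ex_mono p fun a => ?_
  split_ifs with h
  · obtain ⟨i, hi, hE⟩ := h
    exact (by simp [hE] : (1 : ℝ≥0∞) = if E i a then 1 else 0).trans_le
      (Finset.single_le_sum (f := fun i => if E i a then (1 : ℝ≥0∞) else 0)
        (fun _ _ => zero_le) hi)
  · exact zero_le

theorem ex_ex_indep (p : PMF α) (q : PMF β) (f : α → ℝ≥0∞) (g : β → ℝ≥0∞) :
    (ex p fun a => ex q fun b => f a * g b) = ex p f * ex q g := by
  simp_rw [ex_mul_left]
  rw [mul_comm, ← ex_mul_left]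
  exact ex_congr_support p fun a _ => mul_comm _ _

end pr

/-! ### Uniform bit strings -/

/-- The uniform distribution on the bit strings of length `n`. -/
noncomputable def bits : ℕ → PMF (List Bool)
  | 0 => PMF.pure []
  | n + 1 => (PMF.uniformOfFintype Bool).bind fun b => (bits n).map (b :: ·)

theorem ex_bits_zero (f : List Bool → ℝ≥0∞) : ex (bits 0) f = f [] := ex_pure _ _

theorem ex_bits_succ (n : ℕ) (f : List Bool → ℝ≥0∞) : ex (bits (n + 1)) f =
    2⁻¹ * (ex (bits n) (fun s => f (true :: s)) + ex (bits n) fun s => f (false :: s)) := by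
  rw [bits, ex_bind, ex_uniformOfFintype]
  simp [ex_map]

theorem ex_bits_add (m n : ℕ) (f : List Bool → ℝ≥0∞) : ex (bits (m + n)) f =
    ex (bits m) fun u => ex (bits n) fun w => f (u ++ w) := by
  induction m generalizing f with
  | zero => simp [ex_bits_zero]
  | succ m ih =>
    rw [show m + 1 + n = m + n + 1 by omega, ex_bits_succ, ex_bits_succ, ih, ih]
    rfl

theorem length_of_mem_support_bits {n : ℕ} {s : List Bool} (hs : s ∈ (bits n).support) :
    s.length = n := by
  induction n generalizing s with
  | zero =>
    simp only [bits, PMF.support_pure, Set.mem_singleton_iff] at hs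
    simp [hs]
  | succ n ih =>
    simp only [bits, PMF.mem_support_bind_iff, PMF.mem_support_map_iff] at hs
    obtain ⟨b, -, t, ht, rfl⟩ := hs
    simp [ih ht]

theorem pr_bits_succ (n : ℕ) (E : List Bool → Prop) : pr (bits (n + 1)) E =
    2⁻¹ * (pr (bits n) (fun s => E (true :: s)) + pr (bits n) fun s => E (false :: s)) :=
  ex_bits_succ n _

theorem pr_bits_eq {n : ℕ} {s : List Bool} (hs : s.length = n) :
    pr (bits n) (fun t => t = s) = (2⁻¹ : ℝ≥0∞) ^ n := by
  induction n generalizing s with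
  | zero =>
    rw [List.length_eq_zero_iff] at hs
    simp [pr, ex_bits_zero, hs]
  | succ n ih =>
    cases s with
    | nil => simp at hs
    | cons b s =>
      have hs' : s.length = n := by simpa using hs
      have h0 : pr (bits n) (fun _ => False) = 0 := pr_eq_zero _ (by simp)
      rw [pr_bits_succ, pow_succ, mul_comm]
      congr 1
      cases b <;> simp [h0, ih hs']

theorem bits_apply {n : ℕ} {s : List Bool} (hs : s.length = n) :
    bits n s = (2⁻¹ : ℝ≥0∞) ^ n := by
  rw [← pr_bits_eq hs, apply_eq_ex, pr]

theorem ex_bits_take {n p : ℕ} (hp : p ≤ n) (f : List Bool → ℝ≥0∞) :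
    (ex (bits n) fun s => f (s.take p)) = ex (bits p) f := by
  obtain ⟨k, rfl⟩ := Nat.exists_eq_add_of_le hp
  rw [ex_bits_add]
  refine ex_congr_support _ fun u hu => ?_
  simp_rw [List.take_left' (length_of_mem_support_bits hu)]
  exact ex_const _ _

theorem ex_bits_drop {n p : ℕ} (hp : p ≤ n) (f : List Bool → ℝ≥0∞) :
    (ex (bits n) fun s => f (s.drop p)) = ex (bits (n - p)) f := by
  obtain ⟨k, rfl⟩ := Nat.exists_eq_add_of_le hp
  rw [ex_bits_add, Nat.add_sub_cancel_left, ← ex_const (bits p) (ex (bits k) f)]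
  refine ex_congr_support _ fun u hu => ?_
  simp_rw [List.drop_left' (length_of_mem_support_bits hu)]

theorem pr_bits_drop_one (n : ℕ) (E : List Bool → Prop) :
    pr (bits (n + 1)) (fun s => E (s.drop 1)) = pr (bits n) E := by
  classical
  simp only [pr]
  exact ex_bits_drop (Nat.le_add_left 1 n) fun s => if E s then 1 else 0

/-! ### Waiting time for an anchor -/

theorem not_replicate_prefix {M k : ℕ} (hk : k < M) (y : List Bool) :
    ¬ List.replicate M false <+: List.replicate k false ++ true :: y := by
  rintro ⟨r, hr⟩
  have := congrArg (fun l => l[k]?) hr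
  simp [List.getElem?_append, hk] at this

/-- An anchor cannot fit into fewer than `M` zeros, nor can it cross the bit 1. -/
theorem replicate_infix_of_append {M k : ℕ} (hk : k < M) {y : List Bool}
    (h : List.replicate M false <:+: List.replicate k false ++ true :: y) :
    List.replicate M false <:+: y := by
  induction k with
  | zero =>
    rw [List.replicate_zero, List.nil_append, List.infix_cons_iff] at h
    exact h.resolve_left (by simpa using not_replicate_prefix hk y)
  | succ k ih =>
    rw [List.replicate_succ, List.cons_append, List.infix_cons_iff] at h
    refine ih (by omega) (h.resolve_left ?_)
    have := not_replicate_prefix hk y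
    rwa [List.replicate_succ, List.cons_append] at this

/-- The probability that `n` random bits do not contain the anchor. -/
noncomputable def anchorFree (M n : ℕ) : ℝ≥0∞ :=
  pr (bits n) fun s => ¬ List.replicate M false <:+: s

theorem anchorFree_succ_le (M n : ℕ) : anchorFree M (n + 1) ≤ anchorFree M n := by
  unfold anchorFree
  rw [← pr_bits_drop_one n]
  exact pr_mono _ fun s h h' => h (h'.trans (List.drop_suffix 1 s).isInfix)

theorem anchorFree_antitone (M : ℕ) : Antitone (anchorFree M) :=
  antitone_nat_of_succ_le (anchorFree_succ_le M)

/-- Among words of length `M + n + 1`, the anchor-free ones and those of the form `0^M 1 y` with `y`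
anchor-free are disjoint. Deleting the first bit leaves an anchor-free word in both cases. -/
theorem anchorFree_step {M n : ℕ} (hM : 1 ≤ M) :
    anchorFree M (M + n + 1) + (2⁻¹ : ℝ≥0∞) ^ (M + 1) * anchorFree M n ≤
      anchorFree M (M + n) := by
  classical
  set E : List Bool → Prop := fun x => ∃ y, x = List.replicate M false ++ true :: y ∧
    ¬ List.replicate M false <:+: y with hE
  have h1 : (2⁻¹ : ℝ≥0∞) ^ (M + 1) * anchorFree M n ≤ pr (bits (M + n + 1)) E := by
    have h2 : 2⁻¹ * anchorFree M n ≤ ex (bits (n + 1)) fun w =>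
        if ∃ y, w = true :: y ∧ ¬ List.replicate M false <:+: y then 1 else 0 := by
      rw [ex_bits_succ]
      gcongr
      unfold anchorFree pr
      refine le_trans (ex_mono _ fun s => ?_) le_self_add
      by_cases h : List.replicate M false <:+: s <;> simp [h]
    unfold pr
    rw [add_assoc, ex_bits_add]
    calc (2⁻¹ : ℝ≥0∞) ^ (M + 1) * anchorFree M n
        = 2⁻¹ ^ M * (2⁻¹ * anchorFree M n) := by ring
      _ ≤ 2⁻¹ ^ M * ex (bits (n + 1)) fun w =>
        if ∃ y, w = true :: y ∧ ¬ List.replicate M false <:+: y then 1 else 0 := by gcongr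
      _ = pr (bits M) (fun t => t = List.replicate M false) * ex (bits (n + 1)) fun w =>
        if ∃ y, w = true :: y ∧ ¬ List.replicate M false <:+: y then 1 else 0 := by
        rw [pr_bits_eq List.length_replicate]
      _ = _ := by
        simp only [pr]
        rw [← ex_ex_indep]
      _ ≤ _ := by
        refine ex_mono _ fun u => ex_mono _ fun w => ?_
        by_cases hu : u = List.replicate M false
        · by_cases hw : ∃ y, w = true :: y ∧ ¬ List.replicate M false <:+: y
          · have : E (u ++ w) := by
              obtain ⟨y, rfl, hy⟩ := hw
              exact ⟨y, by rw [hu], hy⟩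
            rw [if_pos hu, if_pos hw, if_pos this, one_mul]
          · simp [hw]
        · simp [hu]
  refine (add_le_add_right h1 _).trans ?_
  unfold anchorFree
  rw [← pr_bits_drop_one (M + n)]
  simp only [pr]
  rw [← ex_add]
  refine ex_mono _ fun x => ?_
  by_cases hx : E x
  · obtain ⟨y, rfl, hy⟩ := id hx
    have h4 : List.replicate M false <:+: List.replicate M false ++ true :: y :=
      (List.prefix_append _ _).isInfix
    have h5 : ¬ List.replicate M false <:+:
        (List.replicate M false ++ true :: y).drop 1 := by
      obtain ⟨k, rfl⟩ : ∃ k, M = k + 1 := ⟨M - 1, by omega⟩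
      intro h
      rw [List.replicate_succ (n := k), List.cons_append, List.drop_one, List.tail_cons,
        ← List.replicate_succ] at h
      exact hy (replicate_infix_of_append (by omega) h)
    rw [if_neg (not_not.2 h4), if_pos hx, if_pos h5, zero_add]
  · simp only [hx, if_false, add_zero]
    by_cases h : List.replicate M false <:+: x
    · simp [h]
    · have : ¬ List.replicate M false <:+: x.drop 1 :=
        fun h' => h (h'.trans (List.drop_suffix 1 x).isInfix)
      simp only [h, this, not_false_eq_true, if_true, le_refl]

/-- Monotonicity turns the recursion into `(1 + k 2^(-(M+1))) anchorFree (M + k) ≤ 1`; at `k =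
2^(M+1)` the factor is 2. -/
theorem two_mul_anchorFree_le {M : ℕ} (hM : 1 ≤ M) :
    2 * anchorFree M (M + 2 ^ (M + 1)) ≤ 1 := by
  have key : ∀ k : ℕ, (1 + k * (2⁻¹ : ℝ≥0∞) ^ (M + 1)) * anchorFree M (M + k) ≤ 1 := by
    intro k
    induction k with
    | zero =>
      simp only [Nat.cast_zero, zero_mul, add_zero, one_mul]
      exact pr_le_one _ _
    | succ k ih =>
      refine le_trans ?_ ih
      have h1 := anchorFree_step (n := k) hM
      have h2 := anchorFree_antitone M (show k ≤ M + (k + 1) by omega)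
      have h3 := anchorFree_antitone M (show M + k ≤ M + (k + 1) by omega)
      calc (1 + ((k + 1 : ℕ) : ℝ≥0∞) * 2⁻¹ ^ (M + 1)) * anchorFree M (M + (k + 1))
          = (anchorFree M (M + (k + 1)) + 2⁻¹ ^ (M + 1) * anchorFree M (M + (k + 1))) +
            k * 2⁻¹ ^ (M + 1) * anchorFree M (M + (k + 1)) := by
              push_cast
              ring
        _ ≤ (anchorFree M (M + (k + 1)) + 2⁻¹ ^ (M + 1) * anchorFree M k) +
            k * 2⁻¹ ^ (M + 1) * anchorFree M (M + k) := by gcongr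
        _ ≤ anchorFree M (M + k) + k * 2⁻¹ ^ (M + 1) * anchorFree M (M + k) := by
            gcongr
            exact h1
        _ = _ := by ring
  have := key (2 ^ (M + 1))
  have h2 : ((2 ^ (M + 1) : ℕ) : ℝ≥0∞) * 2⁻¹ ^ (M + 1) = 1 := by
    push_cast
    rw [← mul_pow, ENNReal.mul_inv_cancel (by norm_num) (by norm_num), one_pow]
  rw [h2] at this
  convert this using 2
  norm_num

/-- Union bound over the starting positions of the anchor. -/
theorem pr_anchor_le {M : ℕ} (hM : 1 ≤ M) (n : ℕ) :
    pr (bits n) (fun s => List.replicate M false <:+: s) ≤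
      ((n + 1 - M : ℕ) : ℝ≥0∞) * 2⁻¹ ^ M := by
  classical
  induction n with
  | zero =>
    rw [pr_eq_zero]
    · exact zero_le
    · intro a ha h
      have h1 := h.length_le
      rw [length_of_mem_support_bits ha, List.length_replicate] at h1
      omega
  | succ n ih =>
    by_cases hn : n + 1 < M
    · rw [pr_eq_zero]
      · exact zero_le
      · intro a ha h
        have h1 := h.length_le
        rw [length_of_mem_support_bits ha, List.length_replicate] at h1
        omega
    have h1 : pr (bits (n + 1)) (fun s => List.replicate M false <:+: s) ≤
        pr (bits (n + 1)) (fun s => List.replicate M false <+: s) +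
        pr (bits (n + 1)) (fun s => List.replicate M false <:+: s.drop 1) := by
      refine (pr_mono _ fun s hs => ?_).trans (pr_or_le _ _ _)
      cases s with
      | nil => exact Or.inr hs
      | cons b s => exact List.infix_cons_iff.1 hs
    have h2 : pr (bits (n + 1)) (fun s => List.replicate M false <+: s) ≤ 2⁻¹ ^ M := by
      obtain ⟨r, hr⟩ : ∃ r, n + 1 = M + r := ⟨n + 1 - M, by omega⟩
      rw [hr, ← pr_bits_eq (List.length_replicate (n := M) (a := false))]
      unfold pr
      rw [ex_bits_add]
      refine ex_mono_support _ fun u hu => ex_le_of_support _ fun w _ => ?_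
      by_cases h : List.replicate M false <+: u ++ w
      · have : u = List.replicate M false := by
          have hl := length_of_mem_support_bits hu
          exact ((List.prefix_of_prefix_length_le h (List.prefix_append u w)
            (by simp [hl])).eq_of_length (by simp [hl])).symm
        simp [this]
      · simp [h]
    have h3 : pr (bits (n + 1)) (fun s => List.replicate M false <:+: s.drop 1) =
        pr (bits n) (fun s => List.replicate M false <:+: s) := pr_bits_drop_one n _
    rw [h3] at h1
    refine h1.trans ((add_le_add h2 ih).trans_eq ?_)
    rw [show n + 1 + 1 - M = (n + 1 - M) + 1 by omega]
    push_cast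
    ring

/-! ### Expected synchronization cost -/

/-- The shortest prefix containing an anchor ends in it and has no other. It is longer than `u`,
which meets the length requirement. -/
theorem hasSync_append {M : ℕ} {u w : List Bool}
    (hul : 2 ^ (M - 1) + M ≤ u.length + 1) (hu : ¬ List.replicate M false <:+: u)
    (hw : List.replicate M false <:+: w) : HasSync M (u ++ w) := by
  classical
  have hex : ∃ p, List.replicate M false <:+: (u ++ w).take p :=
    ⟨(u ++ w).length, by
      rw [List.take_length]
      exact hw.trans (List.suffix_append _ _).isInfix⟩
  set p := Nat.find hex with hp
  have hps : List.replicate M false <:+: (u ++ w).take p := Nat.find_spec hex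
  have hmin : ∀ q < p, ¬ List.replicate M false <:+: (u ++ w).take q := fun q hq =>
    Nat.find_min hex hq
  have hpu : u.length < p := by
    by_contra hcon
    rw [List.take_append_of_le_length (by omega)] at hps
    exact hu (hps.trans (List.take_prefix _ _).isInfix)
  have hpl : p ≤ (u ++ w).length := Nat.find_min' hex (by
    rw [List.take_length]
    exact hw.trans (List.suffix_append _ _).isInfix)
  have hdl : ((u ++ w).take p).dropLast = (u ++ w).take (p - 1) := by
    rw [List.dropLast_eq_take, List.take_take, List.length_take, Nat.min_eq_left hpl,
      Nat.min_eq_left (Nat.sub_le _ _)]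
  have hdn : ¬ List.replicate M false <:+: ((u ++ w).take p).dropLast := by
    rw [hdl]
    exact hmin _ (by omega)
  refine ⟨(u ++ w).take p, ⟨?_, ?_, hdn⟩, (List.take_prefix _ _).isInfix⟩
  · rw [List.length_take, Nat.min_eq_left hpl]
    omega
  · have hne : (u ++ w).take p ≠ [] := by
      rw [← List.length_pos_iff, List.length_take]
      omega
    obtain ⟨a, b, hab⟩ := hps
    rcases List.eq_nil_or_concat b with rfl | ⟨b', c, rfl⟩
    · exact ⟨a, by simpa using hab⟩
    · refine absurd ⟨a, b', ?_⟩ hdn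
      rw [← hab]
      simp [← List.append_assoc]

theorem half_le_of_le {a b : ℝ≥0∞} (h : a + b = 1) (ha : a ≤ 2⁻¹) : 2⁻¹ ≤ b := by
  have h1 : (2⁻¹ : ℝ≥0∞) + 2⁻¹ ≤ 2⁻¹ + b := by
    rw [ENNReal.inv_two_add_inv_two, ← h]
    gcongr
  exact (ENNReal.add_le_add_iff_left (by norm_num)).1 h1

/-- A length within which a synchronizing pattern is likely. -/
def syncWindow (M : ℕ) : ℕ := (2 ^ (M - 1) + M - 1) + (M + 2 ^ (M + 1))

theorem syncWindow_le {M : ℕ} (hM : 1 ≤ M) : syncWindow M ≤ 7 * 2 ^ (M - 1) := by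
  unfold syncWindow
  have h1 := le_two_pow_pred (M := M)
  obtain ⟨k, rfl⟩ : ∃ k, M = k + 1 := ⟨M - 1, by omega⟩
  simp only [Nat.add_sub_cancel, pow_succ] at *
  omega

/-- The probability that `n` random bits contain no synchronizing pattern. -/
noncomputable def noSync (M n : ℕ) : ℝ≥0∞ := pr (bits n) fun s => ¬ HasSync M s

/-- The first `2^(M-1) + M - 1` bits are anchor-free with probability at least 1/2, because the
union bound has `2^(M-1)` terms `2^(-M)`. The remaining bits independently contain an anchor with
probability at least 1/2. -/
theorem noSync_syncWindow_le {M : ℕ} (hM : 1 ≤ M) : noSync M (syncWindow M) ≤ 3 / 4 := by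
  classical
  have h1 : 2⁻¹ ≤ pr (bits (2 ^ (M - 1) + M - 1)) fun s => ¬ List.replicate M false <:+: s := by
    refine half_le_of_le (pr_add_pr_not _ _) ((pr_anchor_le hM _).trans_eq ?_)
    have h0 : 0 < 2 ^ (M - 1) := by positivity
    rw [show 2 ^ (M - 1) + M - 1 + 1 - M = 2 ^ (M - 1) by omega]
    obtain ⟨k, rfl⟩ : ∃ k, M = k + 1 := ⟨M - 1, by omega⟩
    rw [Nat.add_sub_cancel, pow_succ, ← mul_assoc]
    push_cast
    rw [← mul_pow, ENNReal.mul_inv_cancel (by norm_num) (by norm_num), one_pow, one_mul]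
  have h2 : 2⁻¹ ≤ pr (bits (M + 2 ^ (M + 1))) fun s => List.replicate M false <:+: s := by
    refine half_le_of_le (a := anchorFree M (M + 2 ^ (M + 1)))
      (by rw [add_comm]; exact pr_add_pr_not _ _) ?_
    rw [ENNReal.le_inv_iff_mul_le, mul_comm]
    exact two_mul_anchorFree_le hM
  have h3 : 4⁻¹ ≤ pr (bits (syncWindow M)) (HasSync M) := by
    calc (4⁻¹ : ℝ≥0∞) = 2⁻¹ * 2⁻¹ := by
          rw [← ENNReal.mul_inv (by norm_num) (by norm_num)]
          norm_num
      _ ≤ _ := mul_le_mul' h1 h2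
      _ = _ := by
          unfold pr
          rw [← ex_ex_indep]
      _ ≤ _ := by
          unfold pr syncWindow
          rw [ex_bits_add]
          refine ex_mono_support _ fun u hu => ex_mono _ fun w => ?_
          have hul := length_of_mem_support_bits hu
          by_cases h1 : List.replicate M false <:+: u
          · simp [h1]
          by_cases h2 : List.replicate M false <:+: w
          · have : HasSync M (u ++ w) := hasSync_append (by omega) h1 h2
            simp [h1, h2, this]
          · simp [h2]
  have h4 := pr_add_pr_not (bits (syncWindow M)) (HasSync M)
  have h5 : (4⁻¹ : ℝ≥0∞) + noSync M (syncWindow M) ≤ 4⁻¹ + 3 / 4 := by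
    have : (4⁻¹ : ℝ≥0∞) + 3 / 4 = 1 := by
      rw [← one_div, ENNReal.div_add_div_same]
      norm_num
      exact ENNReal.div_self (by norm_num) (by norm_num)
    rw [this, ← h4]
    exact add_le_add_left h3 _
  exact (ENNReal.add_le_add_iff_left (by norm_num)).1 h5

theorem noSync_add_le (M m n : ℕ) : noSync M (m + n) ≤ noSync M m * noSync M n := by
  classical
  unfold noSync pr
  rw [ex_bits_add, ← ex_ex_indep]
  refine ex_mono _ fun u => ex_mono _ fun w => ?_
  by_cases h1 : HasSync M u
  · simp [h1, h1.append_right w]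
  by_cases h2 : HasSync M w
  · simp [h2, h2.append_left u]
  · simp only [h1, h2, not_false_eq_true, if_true, mul_one]
    split_ifs <;> simp

/-- Geometric decay at ratio 3/4 per window: with `W` the window length, the claim reproduces itself
through `W + (3/4)(4W) = 4W`. -/
theorem sum_noSync_le {M : ℕ} (hM : 1 ≤ M) (n : ℕ) :
    ∑ p ∈ Finset.range n, noSync M p ≤ 4 * syncWindow M := by
  induction n using Nat.strong_induction_on with
  | _ n ih =>
    have h1 : ∀ k, ∑ p ∈ Finset.range k, noSync M p ≤ k := fun k =>
      (Finset.sum_le_sum fun p _ => pr_le_one _ _).trans_eq (by simp)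
    rcases le_or_gt n (syncWindow M) with hn | hn
    · refine (h1 n).trans ?_
      have h2 : ((n : ℕ) : ℝ≥0∞) ≤ syncWindow M := by exact_mod_cast hn
      exact h2.trans (le_mul_of_one_le_left (zero_le) (by norm_num))
    · obtain ⟨k, rfl⟩ := Nat.exists_eq_add_of_le hn.le
      have hpos : 0 < syncWindow M := by
        unfold syncWindow
        positivity
      rw [Finset.sum_range_add]
      have h2 : ∑ p ∈ Finset.range k, noSync M (syncWindow M + p) ≤
          3 / 4 * (4 * syncWindow M) := by
        refine le_trans ?_ (mul_le_mul_right (ih k (by omega)) (3 / 4))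
        rw [Finset.mul_sum]
        exact Finset.sum_le_sum fun p _ => (noSync_add_le M _ p).trans
          (mul_le_mul_left (noSync_syncWindow_le hM) _)
      refine (add_le_add (h1 _) h2).trans_eq ?_
      rw [← mul_assoc, ENNReal.div_mul_cancel (by norm_num) (by norm_num)]
      ring

/-- The expected synchronization cost of a uniform bit string is of the order of the chunk
length. -/
theorem ex_syncCost_le {M : ℕ} (hM : 1 ≤ M) (n : ℕ) :
    (ex (bits n) fun s => (syncCost M s : ℝ≥0∞)) ≤ 56 * 2 ^ (M - 1) := by
  classical
  have h1 : (ex (bits n) fun s => (syncCost M s : ℝ≥0∞)) =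
      ∑ p ∈ Finset.range (n + 1), (noSync M p + noSync M (n - p)) := by
    have : (ex (bits n) fun s => (syncCost M s : ℝ≥0∞)) = ex (bits n) fun s =>
        ∑ p ∈ Finset.range (n + 1), ((if ¬ HasSync M (s.take p) then 1 else 0) +
          if ¬ HasSync M (s.drop p) then 1 else 0) := by
      refine ex_congr_support _ fun s hs => ?_
      unfold syncCost
      rw [length_of_mem_support_bits hs]
      push_cast
      simp only [ite_not]
    rw [this, ex_sum]
    refine Finset.sum_congr rfl fun p hp => ?_
    have hp' : p ≤ n := by simpa [Nat.lt_succ_iff] using hp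
    rw [ex_add]
    simp only [noSync, pr]
    rw [← ex_bits_take hp', ← ex_bits_drop hp']
    congr!
  rw [h1, Finset.sum_add_distrib]
  have h2 : ∑ p ∈ Finset.range (n + 1), noSync M (n - p) =
      ∑ p ∈ Finset.range (n + 1), noSync M p := by
    rw [← Finset.sum_range_reflect]
    refine Finset.sum_congr rfl fun p hp => ?_
    rw [Finset.mem_range] at hp
    congr 1
    omega
  rw [h2]
  have h3 : ((syncWindow M : ℕ) : ℝ≥0∞) ≤ 7 * 2 ^ (M - 1) := by
    have := syncWindow_le hM
    exact_mod_cast this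
  calc _ ≤ 4 * (syncWindow M : ℝ≥0∞) + 4 * syncWindow M :=
        add_le_add (sum_noSync_le hM _) (sum_noSync_le hM _)
    _ ≤ 4 * (7 * 2 ^ (M - 1)) + 4 * (7 * 2 ^ (M - 1)) := by gcongr
    _ = _ := by ring

end Dedup

namespace Dedup

open scoped ENNReal

/-! ### Independent draws -/

section iid

variable {α : Type}

theorem ex_iid_succ (p : PMF α) (n : ℕ) (F : (Fin (n + 1) → α) → ℝ≥0∞) :
    ex (iid p (n + 1)) F = ex (iid p n) fun x => ex p fun a => F (Fin.snoc x a) := by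
  rw [iid, ex_bind]
  simp_rw [ex_map]

theorem ex_iid_prod (p : PMF α) (n : ℕ) (g : Fin n → α → ℝ≥0∞) :
    (ex (iid p n) fun x => ∏ i, g i (x i)) = ∏ i, ex p (g i) := by
  induction n with
  | zero => simp [ex_const]
  | succ n ih =>
    rw [ex_iid_succ]
    simp_rw [Fin.prod_univ_castSucc, Fin.snoc_castSucc, Fin.snoc_last]
    rw [ex_ex_indep, ih]

theorem ex_iid_apply (p : PMF α) {n : ℕ} (i : Fin n) (g : α → ℝ≥0∞) :
    (ex (iid p n) fun x => g (x i)) = ex p g := by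
  have h := ex_iid_prod p n fun k a => if k = i then g a else 1
  have h1 : ∀ x : Fin n → α, (∏ k, if k = i then g (x k) else 1) = g (x i) := fun x => by
    simp
  simp_rw [h1] at h
  rw [h, Finset.prod_eq_single i]
  · simp
  · intro k _ hk
    simp [hk, ex_const]
  · simp

theorem mem_support_of_iid {p : PMF α} {n : ℕ} {x : Fin n → α} (hx : x ∈ (iid p n).support)
    (i : Fin n) : x i ∈ p.support := by
  induction n with
  | zero => exact i.elim0
  | succ n ih =>
    simp only [iid, PMF.mem_support_bind_iff, PMF.mem_support_map_iff] at hx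
    obtain ⟨y, hy, a, ha, rfl⟩ := hx
    refine Fin.lastCases ?_ (fun i => ?_) i
    · simpa using ha
    · simpa using ih hy i

end iid

/-! ### Drawing without replacement -/

theorem mem_freshStrings {l n : ℕ} {x : Fin n → List Bool} {y : List Bool} :
    y ∈ freshStrings l x ↔ y.length = l ∧ ∀ i, x i ≠ y := by
  unfold freshStrings
  rw [Finset.mem_sdiff]
  refine and_congr ?_ (by simp)
  simp only [Finset.mem_image, Finset.mem_univ, true_and]
  constructor
  · rintro ⟨v, rfl⟩
    simp
  · rintro rfl
    exact ⟨y.get, by simp⟩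

theorem le_card_freshStrings (l : ℕ) {n : ℕ} (x : Fin n → List Bool) :
    2 ^ l - n ≤ (freshStrings l x).card := by
  unfold freshStrings
  refine le_trans ?_ (Finset.le_card_sdiff _ _)
  rw [Finset.card_image_of_injective _ List.ofFn_injective]
  have : (Finset.univ.image x).card ≤ n := by
    simpa using Finset.card_image_le (s := Finset.univ) (f := x)
  simp only [Finset.card_univ, Fintype.card_fun, Fintype.card_bool, Fintype.card_fin]
  omega

theorem freshStrings_nonempty {l n : ℕ} (h : n < 2 ^ l) (x : Fin n → List Bool) :
    (freshStrings l x).Nonempty := by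
  rw [← Finset.card_pos]
  have := le_card_freshStrings l x
  omega

theorem mem_support_drawFresh {l n : ℕ} (h : n < 2 ^ l) {x : Fin n → List Bool} {y : List Bool}
    (hy : y ∈ (drawFresh l x).support) : y.length = l ∧ ∀ i, x i ≠ y := by
  unfold drawFresh at hy
  rw [dif_pos (freshStrings_nonempty h x), PMF.mem_support_uniformOfFinset_iff] at hy
  exact mem_freshStrings.1 hy

theorem drawFresh_apply_le {l n : ℕ} (h : n < 2 ^ l) (x : Fin n → List Bool) (y : List Bool) :
    drawFresh l x y ≤ ((2 ^ l - n : ℕ) : ℝ≥0∞)⁻¹ := by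
  unfold drawFresh
  rw [dif_pos (freshStrings_nonempty h x), PMF.uniformOfFinset_apply]
  split_ifs
  · rw [ENNReal.inv_le_inv]
    exact_mod_cast le_card_freshStrings l x
  · exact zero_le

theorem ex_drawFresh_le {l n : ℕ} (h : n < 2 ^ l) (x : Fin n → List Bool)
    {r : ℝ≥0∞} (hr : ((2 ^ l - n : ℕ) : ℝ≥0∞)⁻¹ ≤ r * 2⁻¹ ^ l) (g : List Bool → ℝ≥0∞) :
    ex (drawFresh l x) g ≤ r * ex (bits l) g := by
  unfold ex
  rw [← ENNReal.tsum_mul_left]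
  refine ENNReal.tsum_le_tsum fun y => ?_
  by_cases hy : y ∈ (drawFresh l x).support
  · rw [← mul_assoc, bits_apply (mem_support_drawFresh h hy).1]
    gcongr
    exact (drawFresh_apply_le h x y).trans hr
  · rw [PMF.mem_support_iff, not_not] at hy
    simp [hy]

theorem ex_drawSymbols_succ (n : ℕ) (l : Fin (n + 1) → ℕ)
    (F : (Fin (n + 1) → List Bool) → ℝ≥0∞) : ex (drawSymbols (n + 1) l) F =
      ex (drawSymbols n (Fin.init l)) fun x =>
        ex (drawFresh (l (Fin.last n)) x) fun y => F (Fin.snoc x y) := by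
  rw [drawSymbols, ex_bind]
  simp_rw [ex_map]

theorem mem_support_drawSymbols {n : ℕ} {l : Fin n → ℕ} (h : ∀ a, n ≤ 2 ^ l a)
    {x : Fin n → List Bool} (hx : x ∈ (drawSymbols n l).support) :
    (∀ a, (x a).length = l a) ∧ Function.Injective x := by
  induction n with
  | zero => exact ⟨fun a => a.elim0, fun a => a.elim0⟩
  | succ n ih =>
    simp only [drawSymbols, PMF.mem_support_bind_iff, PMF.mem_support_map_iff] at hx
    obtain ⟨x, hx, y, hy, rfl⟩ := hx
    obtain ⟨h1, h2⟩ := ih (fun a => by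
      have := h a.castSucc
      simp only [Fin.init]
      omega) hx
    obtain ⟨h3, h4⟩ := mem_support_drawFresh (by have := h (Fin.last n); omega) hy
    refine ⟨fun a => ?_, Fin.snoc_injective_of_injective h2 ?_⟩
    · refine Fin.lastCases ?_ (fun i => ?_) a
      · simpa using h3
      · simpa [Fin.init] using h1 i
    · rintro ⟨i, hi⟩
      exact h4 i hi

/-- Integrates out the last symbol first; its bound is uniform in the symbols already drawn, so
dependence between draws is harmless. -/
theorem ex_drawSymbols_prod_le (n : ℕ) (l : Fin n → ℕ) (g : Fin n → List Bool → ℝ≥0∞)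
    (c : Fin n → ℝ≥0∞)
    (h : ∀ a, ∀ k < n, ∀ x : Fin k → List Bool, ex (drawFresh (l a) x) (g a) ≤ c a) :
    (ex (drawSymbols n l) fun x => ∏ a, g a (x a)) ≤ ∏ a, c a := by
  induction n with
  | zero => simp [ex_const]
  | succ n ih =>
    rw [ex_drawSymbols_succ, Fin.prod_univ_castSucc]
    simp_rw [Fin.prod_univ_castSucc, Fin.snoc_castSucc, Fin.snoc_last, ex_mul_left]
    refine (ex_mono _ fun x => mul_le_mul_right (h (Fin.last n) n (by omega) x) _).trans ?_
    simp_rw [mul_comm _ (c (Fin.last n))]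
    rw [ex_mul_left]
    refine mul_le_mul_right (ih (Fin.init l) (fun a => g a.castSucc) (fun a => c a.castSucc)
      fun a k hk x => h a.castSucc k (by omega) x) _

/-- The probability that prescribed symbols take prescribed values. -/
theorem pr_drawSymbols_eq_le {n : ℕ} {l : Fin n → ℕ} (h : ∀ a, 2 * n ≤ 2 ^ l a)
    (I : Finset (Fin n)) (y : Fin n → List Bool) :
    pr (drawSymbols n l) (fun x => ∀ a ∈ I, x a = y a) ≤ ∏ a ∈ I, 2 * (2⁻¹ : ℝ≥0∞) ^ l a := by
  classical
  have h1 := ex_drawSymbols_prod_le n l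
    (fun a s => if a ∈ I then (if s = y a then 1 else 0) else 1)
    (fun a => if a ∈ I then 2 * (2⁻¹ : ℝ≥0∞) ^ l a else 1) (by
      intro a k hk x
      by_cases ha : a ∈ I
      · simp only [ha, if_true]
        have h2 := h a
        have h3 := drawFresh_apply_le (l := l a) (by omega) x (y a)
        rw [apply_eq_ex] at h3
        refine le_trans (le_of_eq ?_) (h3.trans ?_)
        · congr!
        · have h4 : (2 ^ l a : ℝ≥0∞) ≤ 2 * ((2 ^ l a - k : ℕ) : ℝ≥0∞) := by
            have : 2 ^ l a ≤ 2 * (2 ^ l a - k) := by omega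
            exact_mod_cast this
          rw [← ENNReal.inv_pow]
          calc ((2 ^ l a - k : ℕ) : ℝ≥0∞)⁻¹ = 2 * (2 * ((2 ^ l a - k : ℕ) : ℝ≥0∞))⁻¹ := by
                rw [ENNReal.mul_inv (by simp) (by simp), ← mul_assoc,
                  ENNReal.mul_inv_cancel (by norm_num) (by norm_num), one_mul]
            _ ≤ _ := by
                gcongr
      · simp [ha, ex_const])
  rw [Finset.prod_ite_mem, Finset.univ_inter] at h1
  refine le_trans (ex_mono _ fun x => ?_) h1
  split_ifs with hx
  · refine le_of_eq (Finset.prod_eq_one fun a _ => ?_).symm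
    by_cases ha : a ∈ I
    · simp [ha, hx a ha]
    · simp [ha]
  · exact zero_le

/-! ### Independent uniform symbols -/

/-- Independent uniform strings with the given lengths. -/
noncomputable def prodBits : (n : ℕ) → (Fin n → ℕ) → PMF (Fin n → List Bool)
  | 0, _ => PMF.pure Fin.elim0
  | n + 1, l => (prodBits n (Fin.init l)).bind fun x =>
      (bits (l (Fin.last n))).map fun y => Fin.snoc x y

theorem ex_prodBits_succ (n : ℕ) (l : Fin (n + 1) → ℕ)
    (F : (Fin (n + 1) → List Bool) → ℝ≥0∞) : ex (prodBits (n + 1) l) F =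
      ex (prodBits n (Fin.init l)) fun x =>
        ex (bits (l (Fin.last n))) fun y => F (Fin.snoc x y) := by
  rw [prodBits, ex_bind]
  simp_rw [ex_map]

theorem length_of_mem_support_prodBits {n : ℕ} {l : Fin n → ℕ} {x : Fin n → List Bool}
    (hx : x ∈ (prodBits n l).support) (a : Fin n) : (x a).length = l a := by
  induction n with
  | zero => exact a.elim0
  | succ n ih =>
    simp only [prodBits, PMF.mem_support_bind_iff, PMF.mem_support_map_iff] at hx
    obtain ⟨x, hx, y, hy, rfl⟩ := hx
    refine Fin.lastCases ?_ (fun i => ?_) a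
    · simpa using length_of_mem_support_bits hy
    · simpa [Fin.init] using ih hx i

/-- Resampling one symbol does not change the distribution. -/
theorem ex_prodBits_resample {n : ℕ} (l : Fin n → ℕ) (a : Fin n)
    (F : (Fin n → List Bool) → ℝ≥0∞) : ex (prodBits n l) F =
      ex (prodBits n l) fun x => ex (bits (l a)) fun v => F (Function.update x a v) := by
  induction n with
  | zero => exact a.elim0
  | succ n ih =>
    rw [ex_prodBits_succ, ex_prodBits_succ]
    induction a using Fin.lastCases with
    | last =>
      simp_rw [Fin.update_snoc_last, ex_const]
    | cast a =>
      rw [ih (Fin.init l) a]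
      refine congrArg _ (funext fun x => ?_)
      simp_rw [Fin.snoc_update]
      exact ex_comm _ _ _

theorem ex_prodBits_apply {n : ℕ} (l : Fin n → ℕ) (a : Fin n) (g : List Bool → ℝ≥0∞) :
    (ex (prodBits n l) fun x => g (x a)) = ex (bits (l a)) g := by
  rw [ex_prodBits_resample l a]
  simp_rw [Function.update_self, ex_const]

theorem ex_drawSymbols_le_of_drawFresh_le {n : ℕ} {l : Fin n → ℕ} {r : ℝ≥0∞}
    (h : ∀ a, ∀ k < n, ∀ (x : Fin k → List Bool) (g : List Bool → ℝ≥0∞),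
      ex (drawFresh (l a) x) g ≤ r * ex (bits (l a)) g) (F : (Fin n → List Bool) → ℝ≥0∞) :
    ex (drawSymbols n l) F ≤ r ^ n * ex (prodBits n l) F := by
  induction n with
  | zero => simp [drawSymbols, prodBits]
  | succ n ih =>
    rw [ex_drawSymbols_succ, ex_prodBits_succ]
    refine (ex_mono _ fun x => h (Fin.last n) n (by omega) x _).trans ?_
    rw [ex_mul_left, pow_succ, mul_comm (r ^ n), mul_assoc]
    exact mul_le_mul_right (ih (fun a k hk x g => h a.castSucc k (by omega) x g) _) _

/-- If the lengths are large, drawing without replacement is dominated by independent draws. -/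
theorem ex_drawSymbols_le {n : ℕ} {l : Fin n → ℕ} (h : ∀ a, 2 * n ^ 2 ≤ 2 ^ l a)
    (F : (Fin n → List Bool) → ℝ≥0∞) :
    ex (drawSymbols n l) F ≤ 2 * ex (prodBits n l) F := by
  rcases Nat.eq_zero_or_pos n with rfl | hn
  · simp only [drawSymbols, prodBits]
    exact le_mul_of_one_le_left zero_le (by norm_num)
  have hn1 : (1 : ℝ) ≤ n := by exact_mod_cast hn
  -- Excluding `k < n` strings multiplies a uniform density by at most `2^l / (2^l - k) ≤ 1/t` when
  -- `2^l ≥ 2 n^2`. Bernoulli's inequality keeps `t^n ≥ 1/2`, so the accumulated factor is at most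
  -- 2.
  set t : ℝ := 1 - 1 / (2 * n) with ht
  have hinv : 1 / (2 * (n : ℝ)) ≤ 1 / 2 := by
    apply one_div_le_one_div_of_le <;> linarith
  have ht0 : 0 < t := by linarith
  have hb : (1 / 2 : ℝ) ≤ t ^ n := by
    have := one_add_mul_le_pow (a := -(1 / (2 * (n : ℝ)))) (by linarith) n
    have h2 : 1 + (n : ℝ) * -(1 / (2 * n)) = 1 / 2 := by
      field_simp
      norm_num
    rw [h2, ← sub_eq_add_neg] at this
    exact this
  refine (ex_drawSymbols_le_of_drawFresh_le (r := (ENNReal.ofReal t)⁻¹)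
    (fun a k hk x g => ex_drawFresh_le ?_ x ?_ g) F).trans ?_
  · have := h a
    nlinarith
  · have hka := h a
    have h1 : k ≤ 2 ^ l a := by nlinarith
    rw [← ENNReal.inv_pow, ← ENNReal.mul_inv (by simp [ht0]) (by simp), ENNReal.inv_le_inv]
    have h3 : t * 2 ^ l a ≤ ((2 ^ l a - k : ℕ) : ℝ) := by
      rw [Nat.cast_sub h1, ht, sub_mul, one_mul]
      push_cast
      have h4 : (2 * (n : ℝ) ^ 2) ≤ 2 ^ l a := by exact_mod_cast hka
      have h5 : (k : ℝ) ≤ n := by exact_mod_cast hk.le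
      have h6 : (n : ℝ) ≤ 1 / (2 * n) * 2 ^ l a := by
        calc (n : ℝ) = 1 / (2 * n) * (2 * (n : ℝ) ^ 2) := by field_simp
          _ ≤ _ := by gcongr
      linarith
    calc ENNReal.ofReal t * 2 ^ l a = ENNReal.ofReal (t * 2 ^ l a) := by
          rw [ENNReal.ofReal_mul ht0.le, ENNReal.ofReal_pow (by norm_num)]
          norm_num
      _ ≤ ENNReal.ofReal ((2 ^ l a - k : ℕ) : ℝ) := ENNReal.ofReal_le_ofReal h3
      _ = _ := ENNReal.ofReal_natCast _
  · gcongr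
    rw [← ENNReal.inv_pow, ← ENNReal.ofReal_pow ht0.le, ENNReal.inv_le_iff_inv_le]
    calc (2⁻¹ : ℝ≥0∞) = ENNReal.ofReal (1 / 2) := by
          rw [one_div, ENNReal.ofReal_inv_of_pos (by norm_num)]
          norm_num
      _ ≤ _ := ENNReal.ofReal_le_ofReal hb

/-! ### Repeated substrings are unlikely -/

theorem pr_bits_le_of_unique {N : ℕ} {E : List Bool → Prop}
    (h : ∀ s t, s.length = N → t.length = N → E s → E t → s = t) :
    pr (bits N) E ≤ 2⁻¹ ^ N := by
  by_cases hex : ∃ s, s.length = N ∧ E s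
  · obtain ⟨s, hs, hE⟩ := hex
    rw [← pr_bits_eq hs]
    exact pr_mono_support _ fun t ht hEt => h t s (length_of_mem_support_bits ht) hs hEt hE
  · push Not at hex
    rw [pr_eq_zero]
    · exact zero_le
    · exact fun a ha => hex a (length_of_mem_support_bits ha)

/-- Each bit of `w` is copied from `P.length - p ≥ 1` positions earlier. Hence `P` determines `w`
bit by bit, even when the copy overlaps `w`. -/
theorem self_copy_unique {P w w' : List Bool} {p N : ℕ} (hp : p < P.length) (hw : w.length = N)
    (hw' : w'.length = N) (h : ((P ++ w).drop p).take N = w)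
    (h' : ((P ++ w').drop p).take N = w') : w = w' := by
  have key : ∀ i ≤ N, w.take i = w'.take i := by
    intro i
    induction i with
    | zero => simp
    | succ i ih =>
      intro hi
      have hstep : ∀ v : List Bool, ((P ++ v).drop p).take N = v →
          v.take (i + 1) = ((P ++ v.take i).take (p + (i + 1))).drop p := by
        intro v hv
        conv_lhs => rw [← hv]
        rw [List.take_take, Nat.min_eq_left hi, List.take_drop]
        congr 1
        have h1 : P ++ v.take i = (P ++ v).take (P.length + i) := by
          rw [List.take_length_add_append]
        rw [h1, List.take_take, Nat.min_eq_left (by omega)]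
      rw [hstep w h, hstep w' h', ih (by omega)]
  have := key N le_rfl
  rwa [List.take_of_length_le hw.le, List.take_of_length_le hw'.le] at this

/-- Given the first `o` bits of `v`, at most one value of the next `N` bits reproduces an earlier
window, and later bits play no role. -/
theorem pr_copy_le {P : List Bool} {p o N n : ℕ} (ho : o + N ≤ n) (hp : p < P.length + o) :
    pr (bits n) (fun v => ((P ++ v.take (o + N)).drop p).take N = (v.drop o).take N) ≤
      2⁻¹ ^ N := by
  obtain ⟨k, rfl⟩ := Nat.exists_eq_add_of_le ho
  unfold pr
  rw [ex_bits_add, ex_bits_add]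
  refine ex_le_of_support _ fun u hu => ?_
  have hul := length_of_mem_support_bits hu
  have hu' := pr_bits_le_of_unique (N := N)
    (E := fun w => ((P ++ (u ++ w)).drop p).take N = w) fun s t hs ht h h' => by
      rw [← List.append_assoc] at h h'
      exact self_copy_unique (by simp [hul]; omega) hs ht h h'
  refine le_trans (ex_mono_support _ fun w hw => ?_) hu'
  have hwl := length_of_mem_support_bits hw
  refine ex_le_of_support _ fun z _ => ?_
  have h1 : (u ++ w ++ z).take (o + N) = u ++ w := List.take_left' (by simp [hul, hwl])
  have h2 : ((u ++ w ++ z).drop o).take N = w := by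
    rw [List.append_assoc, List.drop_left' hul, List.take_left' hwl]
  beta_reduce
  rw [h1, h2]

/-- The blocks of the source with alphabet `x` and index sequence `j`. -/
def blocks {A B : ℕ} (x : Fin A → List Bool) (j : Fin B → Fin A) : List (List Bool) :=
  List.ofFn fun b => x (j b)

theorem length_flatten_blocks {A B : ℕ} {x : Fin A → List Bool} {l : Fin A → ℕ}
    (h : ∀ a, (x a).length = l a) (j : Fin B → Fin A) :
    (blocks x j).flatten.length = ∑ b, l (j b) := by
  simp [blocks, List.length_flatten, List.map_ofFn, List.sum_ofFn, h]

/-- Union bound over at most `n` window positions in first occurrences and `n` earlier positions.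
For each pair the block containing the window is resampled; as it is a first occurrence, the
preceding text stays fixed. -/
theorem pr_not_noRepeat_le {A B N : ℕ} (hN : 1 ≤ N) (l : Fin A → ℕ) (j : Fin B → Fin A) :
    pr (prodBits A l) (fun x => ¬ NoRepeat N (blocks x j)) ≤
      ((∑ b, l (j b) : ℕ) : ℝ≥0∞) ^ 2 * 2⁻¹ ^ N := by
  classical
  set n := ∑ b, l (j b) with hn
  set s : Finset ((_ : Fin B) × ℕ) := Finset.univ.sigma fun b => Finset.range (l (j b)) with hs
  have hcard : (s ×ˢ Finset.range n).card = n ^ 2 := by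
    rw [Finset.card_product, hs, Finset.card_sigma]
    simp [hn, sq]
  set E : ((_ : Fin B) × ℕ) × ℕ → (Fin A → List Bool) → Prop := fun q x =>
    (∀ b' < q.1.1, j b' ≠ j q.1.1) ∧ q.1.2 + N ≤ l (j q.1.1) ∧
    q.2 < ((blocks x j).take q.1.1).flatten.length + q.1.2 ∧
    ((((blocks x j).take q.1.1).flatten ++ (x (j q.1.1)).take (q.1.2 + N)).drop q.2).take N =
      ((x (j q.1.1)).drop q.1.2).take N with hE
  have h1 : pr (prodBits A l) (fun x => ¬ NoRepeat N (blocks x j)) ≤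
      pr (prodBits A l) (fun x => ∃ q ∈ s ×ˢ Finset.range n, E q x) := by
    refine pr_mono_support _ fun x hx hr => ?_
    have hxl := length_of_mem_support_prodBits hx
    unfold NoRepeat at hr
    push Not at hr
    obtain ⟨ys₁, y, ys₂, hys, hy, o, ho, p, hp, heq⟩ := hr
    have hlen := congrArg List.length hys
    simp only [blocks, List.length_ofFn, List.length_append, List.length_cons] at hlen
    obtain ⟨b, hb⟩ : ∃ b : Fin B, (b : ℕ) = ys₁.length := ⟨⟨ys₁.length, by omega⟩, rfl⟩
    have htk : (blocks x j).take b = ys₁ := by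
      rw [hys, hb]
      exact List.take_left' rfl
    have hget : y = x (j b) := by
      have h2 : (blocks x j)[ys₁.length]? = some y := by
        rw [hys]
        simp
      have h3 : (blocks x j)[ys₁.length]? = some (x (j b)) := by
        rw [List.getElem?_eq_getElem (by simp [blocks]; omega)]
        simp [blocks, ← hb]
      rw [h2] at h3
      exact Option.some.inj h3
    have hflen := length_flatten_blocks hxl j
    rw [← hn] at hflen
    have hflen' := congrArg (fun L => (List.flatten L).length) hys
    simp only [List.flatten_append, List.flatten_cons, List.length_append] at hflen'
    subst hget
    rw [hxl] at hflen' ho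
    refine ⟨(⟨b, o⟩, p), ?_, ?_, ho, ?_, ?_⟩
    · simp only [hs, Finset.mem_product, Finset.mem_sigma, Finset.mem_univ, true_and,
        Finset.mem_range]
      omega
    · intro b' hb' hj
      apply hy
      rw [← htk, ← hj, List.mem_take_iff_getElem]
      refine ⟨b', ?_, by simp [blocks]⟩
      simp only [blocks, List.length_ofFn, lt_inf_iff]
      exact ⟨hb', b'.2⟩
    · simp only [htk]
      exact hp
    · simp only [htk]
      rw [← heq]
      have h4 : ys₁.flatten ++ (x (j b)).take (o + N) =
          (blocks x j).flatten.take (ys₁.flatten.length + (o + N)) := by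
        rw [hys, List.flatten_append, List.take_length_add_append, List.flatten_cons,
          List.take_append_of_le_length (by rw [hxl]; exact ho)]
      -- The earlier window starts before the later one, so it ends before the later one does; the
      -- text up to the end of the later window is enough.
      rw [h4, List.take_drop, List.take_drop, List.take_take, Nat.min_eq_left (by omega)]
  refine h1.trans ((pr_exists_mem_le _ _ _).trans ?_)
  calc ∑ q ∈ s ×ˢ Finset.range n, pr (prodBits A l) (E q)
      ≤ ∑ q ∈ s ×ˢ Finset.range n, 2⁻¹ ^ N := by
        refine Finset.sum_le_sum fun q _ => ?_
        unfold pr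
        rw [ex_prodBits_resample l (j q.1.1)]
        refine ex_le_of_support _ fun x _ => ?_
        by_cases hq : (∀ b' < q.1.1, j b' ≠ j q.1.1) ∧ q.1.2 + N ≤ l (j q.1.1) ∧
            q.2 < ((blocks x j).take q.1.1).flatten.length + q.1.2
        · have htk : ∀ v, (blocks (Function.update x (j q.1.1) v) j).take q.1.1 =
              (blocks x j).take q.1.1 := by
            intro v
            refine List.ext_getElem (by simp [blocks]) fun i h2 h3 => ?_
            simp only [blocks, List.length_take, List.length_ofFn, lt_inf_iff] at h2
            simp only [blocks, List.getElem_take, List.getElem_ofFn]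
            exact Function.update_of_ne (hq.1 ⟨i, h2.2⟩ h2.1) _ _
          refine le_trans (pr_mono _ fun v hv => ?_) (pr_copy_le hq.2.1 hq.2.2)
          have := hv.2.2.2
          rwa [htk, Function.update_self] at this
        · refine le_trans (ex_le_of_support _ fun v _ => ?_) zero_le
          rw [if_neg]
          rintro ⟨h2, h3, h4, -⟩
          apply hq
          refine ⟨h2, h3, ?_⟩
          have htk : (blocks (Function.update x (j q.1.1) v) j).take q.1.1 =
              (blocks x j).take q.1.1 := by
            refine List.ext_getElem (by simp [blocks]) fun i h5 h6 => ?_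
            simp only [blocks, List.length_take, List.length_ofFn, lt_inf_iff] at h5
            simp only [blocks, List.getElem_take, List.getElem_ofFn]
            exact Function.update_of_ne (h2 ⟨i, h5.2⟩ h5.1) _ _
          rwa [htk] at h4
    _ = _ := by
        rw [Finset.sum_const, hcard, nsmul_eq_mul]
        push_cast
        rfl

end Dedup

namespace Dedup

open scoped ENNReal

namespace SourceModel

/-! ### Elementary facts on the source model -/

variable (m : SourceModel)

/-- The two constraints on `A` give `2 ≤ 2^(E(L)/2 - 1)`. -/
theorem four_le_EL : 4 ≤ m.EL := by
  have h1 : (2 : ℝ) ≤ m.A := by exact_mod_cast m.two_le_A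
  have h2 := h1.trans m.A_le
  have h3 : (2 : ℝ) ^ (1 : ℝ) ≤ 2 ^ (mean m.lengthLaw / 2 - 1) := by rwa [Real.rpow_one]
  rw [Real.rpow_le_rpow_left_iff (by norm_num)] at h3
  unfold EL
  linarith

theorem EL_div_two_le {n : ℕ} (hn : n ∈ m.lengthLaw.support) : m.EL / 2 ≤ n :=
  (m.concentrated n hn).1

theorem le_two_mul_EL {n : ℕ} (hn : n ∈ m.lengthLaw.support) : (n : ℝ) ≤ 2 * m.EL :=
  (m.concentrated n hn).2

theorem two_le_of_mem {n : ℕ} (hn : n ∈ m.lengthLaw.support) : 2 ≤ n := by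
  have h1 := m.EL_div_two_le hn
  have h2 := m.four_le_EL
  have : (2 : ℝ) ≤ n := by linarith
  exact_mod_cast this

theorem two_mul_A_le {n : ℕ} (hn : n ∈ m.lengthLaw.support) : 2 * m.A ≤ 2 ^ n := by
  have h1 := m.EL_div_two_le hn
  have h2 : (2 : ℝ) * m.A ≤ 2 ^ n := by
    calc (2 : ℝ) * m.A ≤ 2 * (2 : ℝ) ^ (mean m.lengthLaw / 2 - 1) := by
          have := m.A_le
          linarith
      _ = (2 : ℝ) ^ (mean m.lengthLaw / 2) := by
          rw [Real.rpow_sub (by norm_num), Real.rpow_one]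
          ring
      _ ≤ (2 : ℝ) ^ (n : ℝ) := Real.rpow_le_rpow_of_exponent_le (by norm_num) h1
      _ = 2 ^ n := Real.rpow_natCast _ _
  exact_mod_cast h2

theorem ex_length : (ex m.lengthLaw fun n => (n : ℝ≥0∞)) = ENNReal.ofReal m.EL := by
  unfold ex EL mean
  rw [ENNReal.ofReal_tsum_of_nonneg (fun n => by positivity) m.summable_mean]
  refine tsum_congr fun n => ?_
  rw [ENNReal.ofReal_mul ENNReal.toReal_nonneg, ENNReal.ofReal_toReal (PMF.apply_ne_top _ _),
    ENNReal.ofReal_natCast]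

/-- The indices are independent of the alphabet, so they can be drawn between the lengths and the
symbols. This is the order needed to condition on lengths and indices. -/
theorem ex_sourceLaw (g : List Bool → ℝ≥0∞) : ex m.sourceLaw g =
    ex (iid m.lengthLaw m.A) fun l => ex (iid (PMF.uniformOfFintype (Fin m.A)) m.B) fun j =>
      ex (drawSymbols m.A l) fun x => g (blocks x j).flatten := by
  unfold sourceLaw alphabetLaw
  rw [ex_bind, ex_bind]
  refine congrArg _ (funext fun l => ?_)
  rw [ex_comm]
  refine congrArg _ (funext fun x => ?_)
  rw [ex_map]
  rfl

theorem mem_support_sourceLaw {s : List Bool} : s ∈ m.sourceLaw.support ↔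
    ∃ l ∈ (iid m.lengthLaw m.A).support, ∃ x ∈ (drawSymbols m.A l).support,
      ∃ j ∈ (iid (PMF.uniformOfFintype (Fin m.A)) m.B).support, (blocks x j).flatten = s := by
  unfold sourceLaw alphabetLaw blocks
  simp only [PMF.mem_support_bind_iff, PMF.mem_support_map_iff]
  constructor
  · rintro ⟨x, ⟨l, hl, hx⟩, j, hj, rfl⟩
    exact ⟨l, hl, x, hx, j, hj, rfl⟩
  · rintro ⟨l, hl, x, hx, j, hj, rfl⟩
    exact ⟨x, ⟨l, hl, hx⟩, j, hj, rfl⟩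

variable {m}

theorem drawSymbols_spec {l : Fin m.A → ℕ} (hl : l ∈ (iid m.lengthLaw m.A).support)
    {x : Fin m.A → List Bool} (hx : x ∈ (drawSymbols m.A l).support) :
    (∀ a, (x a).length = l a) ∧ Function.Injective x :=
  mem_support_drawSymbols (fun a => by
    have := m.two_mul_A_le (mem_support_of_iid hl a)
    omega) hx

theorem sum_lengths_le {l : Fin m.A → ℕ} (hl : l ∈ (iid m.lengthLaw m.A).support)
    (j : Fin m.B → Fin m.A) : ((∑ b, l (j b) : ℕ) : ℝ) ≤ 2 * m.B * m.EL := by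
  push_cast
  calc ∑ b, (l (j b) : ℝ) ≤ ∑ _b : Fin m.B, 2 * m.EL :=
        Finset.sum_le_sum fun b _ => m.le_two_mul_EL (mem_support_of_iid hl _)
    _ = 2 * m.B * m.EL := by
        simp
        ring

theorem length_of_mem_support {s : List Bool} (hs : s ∈ m.sourceLaw.support) :
    1 ≤ s.length ∧ (s.length : ℝ) ≤ 2 * m.B * m.EL := by
  obtain ⟨l, hl, x, hx, j, -, rfl⟩ := m.mem_support_sourceLaw.1 hs
  have h := length_flatten_blocks (drawSymbols_spec hl hx).1 j
  refine ⟨?_, by rw [h]; exact sum_lengths_le hl j⟩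
  rw [h]
  have hB := m.one_le_B
  calc 1 ≤ l (j ⟨0, hB⟩) := by
        have := m.two_le_of_mem (mem_support_of_iid hl (j ⟨0, hB⟩))
        omega
    _ ≤ _ := Finset.single_le_sum (f := fun b => l (j b)) (fun _ _ => Nat.zero_le _)
        (Finset.mem_univ _)

theorem finite_support : m.sourceLaw.support.Finite := by
  refine (List.finite_length_le Bool ⌊2 * m.B * m.EL⌋₊).subset fun s hs => ?_
  exact Nat.le_floor (length_of_mem_support hs).2

theorem ex_ne_top (f : List Bool → List Bool) :
    (ex m.sourceLaw fun s => ((f s).length : ℝ≥0∞)) ≠ ⊤ := by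
  unfold ex
  rw [tsum_eq_sum (s := (finite_support (m := m)).toFinset)]
  · exact ENNReal.sum_ne_top.2 fun s _ =>
      ENNReal.mul_ne_top (PMF.apply_ne_top _ _) (ENNReal.natCast_ne_top _)
  · intro s hs
    rw [Set.Finite.mem_toFinset, PMF.mem_support_iff, not_not] at hs
    simp [hs]

/-- The integer code supplies an admissible code, so the infimum is over a nonempty set; over the
empty set the real infimum would be 0. -/
theorem le_optimalRate (K : IntCode) {r : ℝ} (h : ∀ f : List Bool → List Bool,
    PrefixFreeOn f m.sourceLaw.support →
      ENNReal.ofReal r ≤ ex m.sourceLaw fun s => ((f s).length : ℝ≥0∞)) :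
    r ≤ optimalRate m := by
  refine le_csInf ⟨_, mcEncode K 1, (prefixFreeOn_mcEncode K 1).mono fun s hs => ?_, rfl⟩ ?_
  · have := (length_of_mem_support hs).1
    exact List.length_pos_iff.1 this
  · rintro _ ⟨f, hf, rfl⟩
    rw [expectedBits_eq]
    exact (ENNReal.ofReal_le_iff_le_toReal (ex_ne_top f)).1 (h f hf)

theorem optimalRate_le {f : List Bool → List Bool} (hf : PrefixFreeOn f m.sourceLaw.support) :
    optimalRate m ≤ expectedBits m.sourceLaw f := by
  refine csInf_le ⟨0, ?_⟩ ⟨f, hf, rfl⟩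
  rintro _ ⟨f, -, rfl⟩
  rw [expectedBits_eq]
  exact ENNReal.toReal_nonneg

/-! ### Lower bounds on the optimal rate -/

/-- The set of the symbols that occur in an index sequence. -/
def used {A B : ℕ} (j : Fin B → Fin A) : Finset (Fin A) := Finset.univ.image j

theorem card_used_le {A B : ℕ} (j : Fin B → Fin A) : (used j).card ≤ B := by
  simpa [used] using Finset.card_image_le (s := Finset.univ) (f := j)

theorem prod_two_mul_eq {A : ℕ} (l : Fin A → ℕ) (hl : ∀ a, 1 ≤ l a) (I : Finset (Fin A)) :
    ∏ a ∈ I, 2 * (2⁻¹ : ℝ≥0∞) ^ l a =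
      ENNReal.ofReal ((2 : ℝ) ^ (-((∑ a ∈ I, (l a - 1) : ℕ) : ℝ))) := by
  have h1 : ∀ a, 2 * (2⁻¹ : ℝ≥0∞) ^ l a = 2⁻¹ ^ (l a - 1) := by
    intro a
    obtain ⟨k, hk⟩ : ∃ k, l a = k + 1 := ⟨l a - 1, by have := hl a; omega⟩
    rw [hk, pow_succ, Nat.add_sub_cancel, mul_comm, mul_assoc,
      ENNReal.inv_mul_cancel (by norm_num) (by norm_num), mul_one]
  simp_rw [h1]
  rw [Finset.prod_pow_eq_pow_sum, Real.rpow_neg (by norm_num), Real.rpow_natCast,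
    ENNReal.ofReal_inv_of_pos (by positivity), ENNReal.ofReal_pow (by norm_num), ENNReal.inv_pow]
  norm_num

/-- Given the lengths and the indices, the source string is almost uniform. -/
theorem ex_sum_used_le {f : List Bool → List Bool} (hf : PrefixFreeOn f m.sourceLaw.support) :
    (ex (iid m.lengthLaw m.A) fun l => ex (iid (PMF.uniformOfFintype (Fin m.A)) m.B) fun j =>
      ((∑ a ∈ used j, (l a - 1) : ℕ) : ℝ≥0∞)) ≤
      ex m.sourceLaw fun s => ((f s).length : ℝ≥0∞) := by
  rw [ex_sourceLaw]
  refine ex_mono_support _ fun l hl => ex_mono_support _ fun j hj => ?_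
  rw [← ex_map (drawSymbols m.A l) (fun x => (blocks x j).flatten)
    (fun s => ((f s).length : ℝ≥0∞)), ← ENNReal.ofReal_natCast]
  refine PrefixFreeOn.le_ex_length (hf.mono fun s hs => ?_) fun s => ?_
  · rw [PMF.mem_support_map_iff] at hs
    obtain ⟨x, hx, rfl⟩ := hs
    exact m.mem_support_sourceLaw.2 ⟨l, hl, x, hx, j, hj, rfl⟩
  · classical
    rw [apply_eq_ex, ex_map, ← prod_two_mul_eq l (fun a => by
      have := m.two_le_of_mem (mem_support_of_iid hl a)
      omega)]
    by_cases hex : ∃ y ∈ (drawSymbols m.A l).support, (blocks y j).flatten = s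
    · obtain ⟨y, hy, rfl⟩ := hex
      refine le_trans ?_ (pr_drawSymbols_eq_le
        (fun a => m.two_mul_A_le (mem_support_of_iid hl a)) (used j) y)
      refine le_trans (b := pr (drawSymbols m.A l)
        fun x => (blocks x j).flatten = (blocks y j).flatten) (le_of_eq ?_)
        (pr_mono_support _ fun x hx hxy => ?_)
      · unfold pr
        congr!
      -- With lengths and indices fixed, the cut points of the string are known, so equal
      -- concatenations have equal blocks.
      have h1 : blocks x j = blocks y j := by
        refine List.eq_iff_flatten_eq.2 ⟨hxy, ?_⟩
        simp [blocks, List.map_ofFn, Function.comp_def, (drawSymbols_spec hl hx).1,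
          (drawSymbols_spec hl hy).1]
      have h2 := List.ofFn_injective h1
      intro a ha
      obtain ⟨b, -, rfl⟩ := Finset.mem_image.1 ha
      exact congrFun h2 b
    · push Not at hex
      refine le_trans (ex_le_of_support _ fun x hx => ?_) zero_le
      simp [hex x hx]

theorem one_le_optimalRate (K : IntCode) : 1 ≤ optimalRate m := by
  refine le_optimalRate K fun f hf => le_trans ?_ (ex_sum_used_le hf)
  rw [ENNReal.ofReal_one]
  refine le_ex_of_support _ fun l hl => le_ex_of_support _ fun j _ => ?_
  have h1 : 1 ≤ ∑ a ∈ used j, (l a - 1) := by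
    have hB := m.one_le_B
    calc 1 ≤ l (j ⟨0, hB⟩) - 1 := by
          have := m.two_le_of_mem (mem_support_of_iid hl (j ⟨0, hB⟩))
          omega
      _ ≤ _ := Finset.single_le_sum (f := fun a => l a - 1) (fun _ _ => Nat.zero_le _)
          (Finset.mem_image_of_mem _ (Finset.mem_univ _))
  exact_mod_cast h1

/-- The expected total length of the symbols that occur. -/
noncomputable def usedLength (m : SourceModel) : ℝ≥0∞ :=
  ex (iid m.lengthLaw m.A) fun l => ex (iid (PMF.uniformOfFintype (Fin m.A)) m.B) fun j =>
    ((∑ a ∈ used j, l a : ℕ) : ℝ≥0∞)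

theorem usedLength_le {f : List Bool → List Bool} (hf : PrefixFreeOn f m.sourceLaw.support) :
    m.usedLength ≤ (ex m.sourceLaw fun s => ((f s).length : ℝ≥0∞)) + m.B := by
  refine le_trans ?_ (add_le_add_left (ex_sum_used_le hf) _)
  rw [← ex_const (iid m.lengthLaw m.A) (m.B : ℝ≥0∞), ← ex_add]
  refine ex_mono _ fun l => ?_
  rw [← ex_const (iid (PMF.uniformOfFintype (Fin m.A)) m.B) (m.B : ℝ≥0∞), ← ex_add]
  refine ex_mono _ fun j => ?_
  have h1 : ∑ a ∈ used j, l a ≤ ∑ a ∈ used j, (l a - 1) + m.B := by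
    calc ∑ a ∈ used j, l a ≤ ∑ a ∈ used j, ((l a - 1) + 1) :=
          Finset.sum_le_sum fun a _ => by omega
      _ = ∑ a ∈ used j, (l a - 1) + (used j).card := by
          rw [Finset.sum_add_distrib]
          simp
      _ ≤ _ := by
          have := card_used_le j
          omega
  exact_mod_cast h1

/-- With `x = n/A ≤ 1`, Bernoulli and `(1 - 1/A)^n (1 + 1/A)^n ≤ 1` bound the power by `1/(1 + x) ≤
1 - x/2`. -/
theorem one_sub_pow_le {A n : ℕ} (hA : 1 ≤ A) (hn : n ≤ A) :
    (1 - 1 / (A : ℝ)) ^ n ≤ 1 - n / (2 * A) := by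
  have hA' : (1 : ℝ) ≤ A := by exact_mod_cast hA
  have hn' : (n : ℝ) ≤ A := by exact_mod_cast hn
  have h0 : 0 ≤ 1 - 1 / (A : ℝ) := by
    rw [sub_nonneg, div_le_one (by linarith)]
    exact hA'
  have h1 : 1 + (n : ℝ) * (1 / A) ≤ (1 + 1 / (A : ℝ)) ^ n :=
    one_add_mul_le_pow (by have : 0 ≤ 1 / (A : ℝ) := by positivity
                           linarith) n
  have h2 : (1 - 1 / (A : ℝ)) ^ n * (1 + 1 / (A : ℝ)) ^ n ≤ 1 := by
    rw [← mul_pow]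
    refine pow_le_one₀ (mul_nonneg h0 (by positivity)) ?_
    have : 0 ≤ (1 / (A : ℝ)) ^ 2 := by positivity
    nlinarith
  set x : ℝ := n * (1 / A) with hx
  have hx0 : 0 ≤ x := by positivity
  have hx1 : x ≤ 1 := by
    rw [hx, mul_one_div, div_le_one (by linarith)]
    exact hn'
  have h3 : (1 - 1 / (A : ℝ)) ^ n * (1 + x) ≤ 1 :=
    (mul_le_mul_of_nonneg_left h1 (pow_nonneg h0 n)).trans h2
  have h4 : (n : ℝ) / (2 * A) = x / 2 := by
    rw [hx]
    field_simp
  rw [h4]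
  nlinarith [pow_nonneg h0 n]

/-- A symbol is missed with probability `(1 - 1/A)^B`; since this decreases in `B`, the exponent may
be replaced by `min A B`, which brings it within reach of `one_sub_pow_le`. -/
theorem min_div_le_pr_used (a : Fin m.A) :
    ENNReal.ofReal ((min m.A m.B : ℕ) / (2 * m.A)) ≤
      pr (iid (PMF.uniformOfFintype (Fin m.A)) m.B) fun j => a ∈ used j := by
  classical
  have hA : 1 ≤ m.A := by
    have := m.two_le_A
    omega
  have hA' : (1 : ℝ) ≤ m.A := by exact_mod_cast hA
  have h0 : 0 ≤ 1 - 1 / (m.A : ℝ) := by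
    rw [sub_nonneg, div_le_one (by linarith)]
    exact hA'
  have h1 : pr (iid (PMF.uniformOfFintype (Fin m.A)) m.B) (fun j => ¬ a ∈ used j) =
      ENNReal.ofReal ((1 - 1 / (m.A : ℝ)) ^ m.B) := by
    have h2 := ex_iid_prod (PMF.uniformOfFintype (Fin m.A)) m.B
      (fun _ k => if k = a then 0 else 1)
    have h3 : pr (iid (PMF.uniformOfFintype (Fin m.A)) m.B) (fun j => ¬ a ∈ used j) =
        ex (iid (PMF.uniformOfFintype (Fin m.A)) m.B)
          fun j => ∏ b, if j b = a then (0 : ℝ≥0∞) else 1 := by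
      refine congrArg (ex _) (funext fun j => ?_)
      by_cases ha : a ∈ used j
      · obtain ⟨b, -, hb⟩ := Finset.mem_image.1 ha
        rw [if_neg (not_not.2 ha), Finset.prod_eq_zero (Finset.mem_univ b)]
        simp [hb]
      · rw [if_pos ha, Finset.prod_eq_one]
        intro b _
        rw [if_neg]
        rintro rfl
        exact ha (Finset.mem_image_of_mem _ (Finset.mem_univ _))
    rw [h3, h2, Finset.prod_const, Finset.card_univ, Fintype.card_fin, ENNReal.ofReal_pow h0]
    congr 1
    rw [ex_uniformOfFintype, Fintype.card_fin]
    have h4 : ∑ k : Fin m.A, (if k = a then (0 : ℝ≥0∞) else 1) = ((m.A - 1 : ℕ) : ℝ≥0∞) := by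
      rw [Finset.sum_ite]
      simp only [Finset.sum_const_zero, zero_add, Finset.sum_const, nsmul_eq_mul, mul_one]
      congr 1
      rw [Finset.filter_ne', Finset.card_erase_of_mem (Finset.mem_univ _)]
      simp
    rw [h4, ← ENNReal.ofReal_natCast, ← ENNReal.ofReal_natCast,
      ← ENNReal.ofReal_inv_of_pos (by linarith), ← ENNReal.ofReal_mul (by positivity)]
    congr 1
    rw [Nat.cast_sub hA]
    have : (m.A : ℝ) ≠ 0 := by positivity
    field_simp
    norm_num
  have h5 : (1 - 1 / (m.A : ℝ)) ^ m.B ≤ 1 - (min m.A m.B : ℕ) / (2 * m.A) := by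
    refine le_trans ?_ (one_sub_pow_le hA (min_le_left _ _))
    refine pow_le_pow_of_le_one h0 ?_ (min_le_right _ _)
    have : 0 ≤ 1 / (m.A : ℝ) := by positivity
    linarith
  have h6 := pr_add_pr_not (iid (PMF.uniformOfFintype (Fin m.A)) m.B) fun j => a ∈ used j
  rw [h1] at h6
  have h7 : ENNReal.ofReal ((min m.A m.B : ℕ) / (2 * m.A)) +
      ENNReal.ofReal ((1 - 1 / (m.A : ℝ)) ^ m.B) ≤
      pr (iid (PMF.uniformOfFintype (Fin m.A)) m.B) (fun j => a ∈ used j) +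
      ENNReal.ofReal ((1 - 1 / (m.A : ℝ)) ^ m.B) := by
    rw [h6, ← ENNReal.ofReal_add (by positivity) (pow_nonneg h0 _), ← ENNReal.ofReal_one]
    exact ENNReal.ofReal_le_ofReal (by linarith)
  exact (ENNReal.add_le_add_iff_right ENNReal.ofReal_ne_top).1 h7

/-- The length of a symbol is independent of whether it is used, so the expectation factors and is
summed over the `A` symbols. -/
theorem min_mul_le_optimalRate (K : IntCode) :
    min (m.A : ℝ) m.B / 2 * (m.EL - 1) ≤ optimalRate m := by
  classical
  have hA : 1 ≤ m.A := by
    have := m.two_le_A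
    omega
  have hA' : (0 : ℝ) < m.A := by exact_mod_cast hA
  have hEL := m.four_le_EL
  refine le_optimalRate K fun f hf => le_trans ?_ (ex_sum_used_le hf)
  have h1 : ∀ (l : Fin m.A → ℕ) (j : Fin m.B → Fin m.A),
      ((∑ a ∈ used j, (l a - 1) : ℕ) : ℝ≥0∞) =
        ∑ a, ((l a - 1 : ℕ) : ℝ≥0∞) * if a ∈ used j then 1 else 0 := by
    intro l j
    push_cast
    simp
  simp_rw [h1, ex_sum]
  have h2 : ∀ a, (ex (iid m.lengthLaw m.A) fun l =>
      ex (iid (PMF.uniformOfFintype (Fin m.A)) m.B) fun j =>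
        ((l a - 1 : ℕ) : ℝ≥0∞) * if a ∈ used j then 1 else 0) =
      (ex m.lengthLaw fun n => ((n - 1 : ℕ) : ℝ≥0∞)) *
        pr (iid (PMF.uniformOfFintype (Fin m.A)) m.B) fun j => a ∈ used j := by
    intro a
    rw [ex_ex_indep _ _ (fun l : Fin m.A → ℕ => ((l a - 1 : ℕ) : ℝ≥0∞)),
      ex_iid_apply m.lengthLaw a fun n => ((n - 1 : ℕ) : ℝ≥0∞)]
    unfold pr
    congr!
  have h3 : ENNReal.ofReal (m.EL - 1) ≤ ex m.lengthLaw fun n => ((n - 1 : ℕ) : ℝ≥0∞) := by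
    have h4 : ENNReal.ofReal (m.EL - 1) + 1 ≤
        (ex m.lengthLaw fun n => ((n - 1 : ℕ) : ℝ≥0∞)) + 1 := by
      rw [← ENNReal.ofReal_one, ← ENNReal.ofReal_add (by linarith) zero_le_one, sub_add_cancel,
        ← ex_length, ENNReal.ofReal_one, ← ex_const m.lengthLaw 1, ← ex_add]
      refine ex_mono _ fun n => ?_
      have : n ≤ n - 1 + 1 := by omega
      exact_mod_cast this
    exact (ENNReal.add_le_add_iff_right ENNReal.one_ne_top).1 h4
  calc ENNReal.ofReal (min (m.A : ℝ) m.B / 2 * (m.EL - 1))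
      = ∑ _a : Fin m.A, ENNReal.ofReal (m.EL - 1) *
          ENNReal.ofReal ((min m.A m.B : ℕ) / (2 * m.A)) := by
        rw [Finset.sum_const, Finset.card_univ, Fintype.card_fin, nsmul_eq_mul,
          ← ENNReal.ofReal_mul (by linarith), ← ENNReal.ofReal_natCast,
          ← ENNReal.ofReal_mul (by positivity)]
        congr 1
        push_cast
        field_simp
    _ ≤ _ := Finset.sum_le_sum fun a _ => by
        rw [h2]
        exact mul_le_mul' h3 (min_div_le_pr_used a)

/-- Given the alphabet, the source string determines the indices up to the lengths of the
blocks. -/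
theorem log_le_optimalRate (K : IntCode) :
    m.B * Real.logb 2 (m.A / (2 * m.EL)) ≤ optimalRate m := by
  classical
  have hEL := m.four_le_EL
  have hA : (0 : ℝ) < m.A := by
    have := m.two_le_A
    exact_mod_cast (by omega : 0 < m.A)
  refine le_optimalRate K fun f hf => ?_
  unfold sourceLaw
  rw [ex_bind]
  refine le_ex_of_support _ fun x hx => ?_
  have hx' := hx
  simp only [alphabetLaw, PMF.mem_support_bind_iff] at hx'
  obtain ⟨l, hl, hxl⟩ := hx'
  obtain ⟨hlen, hinj⟩ := drawSymbols_spec hl hxl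
  refine PrefixFreeOn.le_ex_length (hf.mono fun s hs => ?_) fun s => ?_
  · unfold sourceLaw
    rw [PMF.mem_support_bind_iff]
    exact ⟨x, hx, hs⟩
  set k := ⌊2 * m.EL⌋₊ with hk
  set J : Finset (Fin m.B → Fin m.A) := Finset.univ.filter fun j => (blocks x j).flatten = s
  -- The alphabet is injective, so the indices are recovered from the string and the pattern of
  -- block lengths; each length is an integer between 1 and `2 E(L)`.
  have hJ : J.card ≤ k ^ m.B := by
    have h1 : J.card ≤ (Fintype.piFinset fun _ : Fin m.B => Finset.Icc 1 k).card := by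
      refine Finset.card_le_card_of_injOn (fun j b => l (j b)) ?_ ?_
      · intro j _
        simp only [Finset.mem_coe, Fintype.mem_piFinset, Finset.mem_Icc]
        intro b
        have hb := mem_support_of_iid hl (j b)
        exact ⟨by have := m.two_le_of_mem hb; omega, Nat.le_floor (m.le_two_mul_EL hb)⟩
      · intro j hj j' hj' hjj
        simp only [J, Finset.coe_filter, Finset.mem_univ, true_and, Set.mem_ofPred_eq] at hj hj'
        have h2 : blocks x j = blocks x j' := by
          refine List.eq_iff_flatten_eq.2 ⟨hj.trans hj'.symm, ?_⟩
          simp only [blocks, List.map_ofFn, Function.comp_def, hlen]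
          exact congrArg List.ofFn hjj
        have h3 := List.ofFn_injective h2
        funext b
        exact hinj (congrFun h3 b)
    simpa using h1
  have hpt : ∀ j₀ : Fin m.B → Fin m.A,
      pr (iid (PMF.uniformOfFintype (Fin m.A)) m.B) (fun j => j = j₀) =
        ((m.A : ℝ≥0∞)⁻¹) ^ m.B := by
    intro j₀
    have h2 := ex_iid_prod (PMF.uniformOfFintype (Fin m.A)) m.B
      (fun b k => if k = j₀ b then 1 else 0)
    simp only [ex_uniformOfFintype, Finset.sum_ite_eq', Finset.mem_univ, if_true, mul_one,
      Finset.prod_const, Finset.card_univ, Fintype.card_fin] at h2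
    rw [← h2]
    refine congrArg (ex _) (funext fun j => ?_)
    by_cases hj : j = j₀
    · simp [hj]
    · obtain ⟨b, hb⟩ := Function.ne_iff.1 hj
      rw [if_neg hj, Finset.prod_eq_zero (Finset.mem_univ b)]
      simp [hb]
  have h1 : ((iid (PMF.uniformOfFintype (Fin m.A)) m.B).map fun j =>
      (List.ofFn fun b => x (j b)).flatten) s ≤ (k : ℝ≥0∞) ^ m.B * ((m.A : ℝ≥0∞)⁻¹) ^ m.B := by
    rw [apply_eq_ex, ex_map]
    calc _ = pr (iid (PMF.uniformOfFintype (Fin m.A)) m.B) (fun j => (blocks x j).flatten = s) := by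
          unfold pr
          congr!
      _ ≤ pr (iid (PMF.uniformOfFintype (Fin m.A)) m.B) (fun j => ∃ j₀ ∈ J, j = j₀) :=
          pr_mono _ fun j hj => ⟨j, by simpa [J] using hj, rfl⟩
      _ ≤ ∑ j₀ ∈ J, pr (iid (PMF.uniformOfFintype (Fin m.A)) m.B) (fun j => j = j₀) :=
          pr_exists_mem_le _ _ _
      _ = J.card * ((m.A : ℝ≥0∞)⁻¹) ^ m.B := by
          simp_rw [hpt]
          rw [Finset.sum_const, nsmul_eq_mul]
      _ ≤ _ := by
          gcongr
          exact_mod_cast hJ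
  refine h1.trans ?_
  have h2 : (2 : ℝ) ^ (-(m.B * Real.logb 2 (m.A / (2 * m.EL)))) = (2 * m.EL) ^ m.B *
      ((m.A : ℝ)⁻¹) ^ m.B := by
    rw [show -(m.B * Real.logb 2 (m.A / (2 * m.EL))) =
      Real.logb 2 (m.A / (2 * m.EL)) * (-(m.B : ℝ)) by ring, Real.rpow_mul (by norm_num),
      Real.rpow_logb (by norm_num) (by norm_num) (by positivity), Real.rpow_neg (by positivity),
      Real.rpow_natCast, ← inv_pow, inv_div, div_eq_mul_inv, mul_pow]
  rw [h2, ENNReal.ofReal_mul (by positivity), ENNReal.ofReal_pow (by positivity),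
    ENNReal.ofReal_pow (by positivity), ENNReal.ofReal_inv_of_pos hA, ENNReal.ofReal_natCast]
  gcongr
  rw [← ENNReal.ofReal_natCast]
  exact ENNReal.ofReal_le_ofReal (Nat.floor_le (by positivity))

end SourceModel

end Dedup

namespace Dedup

open scoped ENNReal

namespace SourceModel

/-! ### The rate of multi-chunk deduplication -/

/-- The logarithm `log (A B E(L))`. -/
noncomputable def logSize (m : SourceModel) : ℝ := Real.logb 2 ((m.A : ℝ) * (m.B : ℝ) * m.EL)

variable {m : SourceModel}

theorem size_pos : 0 < (m.A : ℝ) * m.B * m.EL := by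
  have h1 : (2 : ℝ) ≤ m.A := by exact_mod_cast m.two_le_A
  have h2 : (1 : ℝ) ≤ m.B := by exact_mod_cast m.one_le_B
  have h3 := m.four_le_EL
  positivity

theorem two_rpow_logSize : (2 : ℝ) ^ m.logSize = m.A * m.B * m.EL :=
  Real.rpow_logb (by norm_num) (by norm_num) size_pos

theorem three_le_logSize : 3 ≤ m.logSize := by
  unfold logSize
  rw [Real.le_logb_iff_rpow_le (by norm_num) size_pos]
  have h1 : (2 : ℝ) ≤ m.A := by exact_mod_cast m.two_le_A
  have h2 : (1 : ℝ) ≤ m.B := by exact_mod_cast m.one_le_B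
  have h3 := m.four_le_EL
  calc (2 : ℝ) ^ (3 : ℝ) = 2 * 1 * 4 := by norm_num
    _ ≤ _ := by gcongr

theorem length_le_two_rpow {n : ℝ} (hn : n ≤ 2 * m.B * m.EL) : n ≤ (2 : ℝ) ^ m.logSize := by
  rw [two_rpow_logSize]
  have h1 : (2 : ℝ) ≤ m.A := by exact_mod_cast m.two_le_A
  have h3 := m.four_le_EL
  refine hn.trans ?_
  gcongr

/-- An anchor length for which the chunks are a constant factor longer than `log (A B E(L))`. -/
theorem exists_anchor (m : SourceModel) : ∃ M : ℕ, 1 ≤ M ∧ 4 * m.logSize ≤ (2 ^ (M - 1) : ℕ) ∧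
    ((2 ^ (M - 1) : ℕ) : ℝ) ≤ 9 * m.logSize := by
  have hL := m.three_le_logSize
  set q := ⌈4 * m.logSize⌉₊ with hq
  have hq1 : 4 * m.logSize ≤ q := Nat.le_ceil _
  have hq2 : (q : ℝ) < 4 * m.logSize + 1 := Nat.ceil_lt_add_one (by linarith)
  have hq3 : 1 < q := by
    have : (1 : ℝ) < q := by linarith
    exact_mod_cast this
  -- Rounding `q` up to a power of two at most doubles it, and `2q ≤ 8L + 2 ≤ 9L` for `L = logSize ≥
  -- 3`.
  refine ⟨Nat.clog 2 q + 1, by omega, ?_, ?_⟩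
  · rw [Nat.add_sub_cancel]
    refine hq1.trans ?_
    exact_mod_cast Nat.le_pow_clog (by norm_num) q
  · rw [Nat.add_sub_cancel]
    have h1 : 2 ^ (Nat.clog 2 q - 1) < q := Nat.pow_pred_clog_lt_self (by norm_num) hq3
    have h2 : 0 < Nat.clog 2 q := Nat.clog_pos (by norm_num) hq3
    have h3 : 2 ^ Nat.clog 2 q ≤ 2 * q := by
      obtain ⟨k, hk⟩ : ∃ k, Nat.clog 2 q = k + 1 := ⟨Nat.clog 2 q - 1, by omega⟩
      rw [hk] at h1 ⊢
      rw [Nat.add_sub_cancel] at h1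
      rw [pow_succ]
      omega
    have h4 : ((2 ^ Nat.clog 2 q : ℕ) : ℝ) ≤ 2 * q := by exact_mod_cast h3
    linarith

theorem logb_le_of_le_rpow {n : ℕ} {L : ℝ} (hn : 1 ≤ n) (h : (n : ℝ) ≤ 2 ^ L) :
    Real.logb 2 n ≤ L := by
  rw [Real.logb_le_iff_le_rpow (by norm_num) (by exact_mod_cast hn)]
  exact h

theorem clog_le_of_le_rpow {n : ℕ} {L : ℝ} (hL : 0 ≤ L) (h : (n : ℝ) ≤ 2 ^ L) :
    (Nat.clog 2 n : ℝ) ≤ L + 1 := by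
  rcases le_or_gt n 1 with hn | hn
  · rw [Nat.clog_of_right_le_one hn]
    push_cast
    linarith
  · have h1 : 2 ^ (Nat.clog 2 n - 1) < n := Nat.pow_pred_clog_lt_self (by norm_num) hn
    have h2 : 0 < Nat.clog 2 n := Nat.clog_pos (by norm_num) hn
    have h3 : (2 : ℝ) ^ ((Nat.clog 2 n - 1 : ℕ) : ℝ) ≤ 2 ^ L := by
      rw [Real.rpow_natCast]
      refine le_trans ?_ h
      exact_mod_cast h1.le
    rw [Real.rpow_le_rpow_left_iff (by norm_num), Nat.cast_sub h2] at h3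
    push_cast at h3
    linarith

/-- The overhead of one run. -/
theorem overhead_le (K : IntCode) {L : ℝ} (hL : 0 ≤ L) {n : ℕ} (hn : (n : ℝ) ≤ 2 ^ L) {v : ℕ}
    (hv : 1 ≤ v) (hvn : v ≤ n) :
    1 + (K.enc v).length + Nat.clog 2 n ≤ ⌊3 * L + 5⌋₊ := by
  -- One flag bit, at most `2L + 3` bits for the run length and at most `L + 1` for the pointer.
  refine Nat.le_floor ?_
  have h1 := K.length_le v hv
  have h2 : (v : ℝ) ≤ n := by exact_mod_cast hvn
  have h3 := logb_le_of_le_rpow hv (h2.trans hn)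
  have h4 := clog_le_of_le_rpow hL hn
  push_cast
  linarith

/-- A chunk costs two overheads of at most `5L`. As chunks other than the last have length at least
`4L`, this amounts to at most `2.5` bits per source bit, beside the source bit itself and terms of
order `L`. -/
theorem length_mcEncode_trivial (K : IntCode) {M : ℕ} {L : ℝ} (hL : 3 ≤ L)
    (hN : 4 * L ≤ (2 ^ (M - 1) : ℕ)) {s : List Bool} (hs : 1 ≤ s.length)
    (hsL : (s.length : ℝ) ≤ 2 ^ L) :
    ((mcEncode K M s).length : ℝ) ≤ 4 * s.length + 18 * L := by
  have hZs : ((chunks M s).length : ℝ) ≤ s.length := by exact_mod_cast length_chunks_le M s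
  have h1 := length_encodeFrom_trivial K M s (κ := ⌊3 * L + 5⌋₊)
    (fun v hv hv' => overhead_le K (by linarith) (hZs.trans hsL) hv hv') (chunks M s).length
  have h2 : ((chunks M s).length : ℝ) * (2 ^ (M - 1) : ℕ) ≤ s.length + (2 ^ (M - 1) : ℕ) := by
    exact_mod_cast length_chunks_mul_le M s
  have h3 := K.length_le s.length hs
  have h4 := logb_le_of_le_rpow hs hsL
  have hκ : ((⌊3 * L + 5⌋₊ : ℕ) : ℝ) ≤ 5 * L := (Nat.floor_le (by linarith)).trans (by linarith)
  have h5 : ((encodeFrom K (chunks M s) (chunks M s).length 0).length : ℝ) ≤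
      s.length + ⌊3 * L + 5⌋₊ * (2 * (chunks M s).length + 1) := by exact_mod_cast h1
  have h6 : (⌊3 * L + 5⌋₊ : ℝ) * (2 * (chunks M s).length + 1) ≤
      5 * L * (2 * (chunks M s).length + 1) := by gcongr
  have h7 : 4 * L * ((chunks M s).length - 1) ≤ s.length := by
    rcases le_or_gt ((chunks M s).length : ℝ) 1 with h | h
    · have h8 : 4 * L * ((chunks M s).length - 1) ≤ 0 :=
        mul_nonpos_of_nonneg_of_nonpos (by linarith) (by linarith)
      exact h8.trans (Nat.cast_nonneg _)
    · have := mul_le_mul_of_nonneg_right hN (by linarith : 0 ≤ ((chunks M s).length : ℝ) - 1)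
      linarith
  unfold mcEncode
  rw [List.length_append]
  push_cast
  have h9 : (0 : ℝ) ≤ s.length := Nat.cast_nonneg _
  nlinarith

/-- The `2B + 1` unavoidable marks cost at most `10L` each, `B` being the number of blocks. The
other marks are paid by the synchronization cost at `10L / (4L) = 2.5` bits per unit, on top of the
one bit for writing the glue. -/
theorem length_mcEncode_blocks (K : IntCode) {M : ℕ} (hM : 1 ≤ M) {L : ℝ} (hL : 3 ≤ L)
    (hN : 4 * L ≤ (2 ^ (M - 1) : ℕ)) {ys : List (List Bool)} (hys : NoRepeat (2 ^ (M - 1)) ys)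
    (hB : 1 ≤ ys.length) (hs : 1 ≤ ys.flatten.length) (hsL : (ys.flatten.length : ℝ) ≤ 2 ^ L) :
    ((mcEncode K M ys.flatten).length : ℝ) ≤ (∑ y ∈ ys.toFinset, y.length : ℕ) +
      38 * ys.length * L + 4 * ((ys.map (syncCost M)).sum : ℕ) := by
  have hZs : ((chunks M ys.flatten).length : ℝ) ≤ ys.flatten.length := by
    exact_mod_cast length_chunks_le M ys.flatten
  obtain ⟨k, hk, h1⟩ := length_encodeFrom_blocks K hM hys (κ := ⌊3 * L + 5⌋₊)
    (fun v hv hv' => overhead_le K (by linarith) (hZs.trans hsL) hv hv')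
    (chunks M ys.flatten).length
  have h3 := K.length_le _ hs
  have h4 := logb_le_of_le_rpow hs hsL
  have hκ : ((⌊3 * L + 5⌋₊ : ℕ) : ℝ) ≤ 5 * L := (Nat.floor_le (by linarith)).trans (by linarith)
  set c := (ys.map (syncCost M)).sum
  set t := ∑ y ∈ ys.toFinset, y.length
  have h5 : ((encodeFrom K (chunks M ys.flatten) (chunks M ys.flatten).length 0).length : ℝ) ≤
      t + c + ⌊3 * L + 5⌋₊ * (2 * k + 1) := by exact_mod_cast h1
  have h6 : (⌊3 * L + 5⌋₊ : ℝ) * (2 * k + 1) ≤ 5 * L * (2 * k + 1) := by gcongr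
  have hk' : (k : ℝ) * (2 ^ (M - 1) : ℕ) ≤ c + (2 * ys.length + 1) * (2 ^ (M - 1) : ℕ) := by
    exact_mod_cast hk
  have hc0 : (0 : ℝ) ≤ c := Nat.cast_nonneg _
  have h7 : 4 * L * (k - (2 * ys.length + 1)) ≤ c := by
    rcases le_or_gt (k : ℝ) (2 * ys.length + 1) with h | h
    · have h8 : 4 * L * (k - (2 * ys.length + 1)) ≤ 0 :=
        mul_nonpos_of_nonneg_of_nonpos (by linarith) (by linarith)
      exact h8.trans hc0
    · have := mul_le_mul_of_nonneg_right hN (by linarith : 0 ≤ (k : ℝ) - (2 * ys.length + 1))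
      linarith
  have hB' : (1 : ℝ) ≤ ys.length := by exact_mod_cast hB
  have hBL : L ≤ ys.length * L := le_mul_of_one_le_left (by linarith) hB'
  unfold mcEncode
  rw [List.length_append]
  push_cast
  nlinarith

theorem sum_toFinset_blocks_le {A B : ℕ} (x : Fin A → List Bool) (j : Fin B → Fin A) :
    ∑ y ∈ (blocks x j).toFinset, y.length ≤ ∑ a ∈ used j, (x a).length := by
  have h : (blocks x j).toFinset = (used j).image x := by
    ext y
    simp [blocks, used, List.mem_ofFn]
  rw [h]
  exact Finset.sum_image_le_of_nonneg fun _ _ => Nat.zero_le _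

/-- The part of the code length that is not due to the first occurrences of the symbols. -/
theorem ex_excess_le {M : ℕ} (hM : 1 ≤ M) {L : ℝ} (hN : 4 * L ≤ (2 ^ (M - 1) : ℕ)) (hL : 0 ≤ L)
    {A B : ℕ} {l : Fin A → ℕ} {j : Fin B → Fin A}
    (hn : ((∑ b, l (j b) : ℕ) : ℝ) ≤ 2 ^ L) :
    (4 * ex (prodBits A l) fun x => (((blocks x j).map (syncCost M)).sum : ℝ≥0∞)) +
      4 * ((∑ b, l (j b) : ℕ) : ℝ≥0∞) *
        pr (prodBits A l) (fun x => ¬ NoRepeat (2 ^ (M - 1)) (blocks x j)) ≤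
      224 * B * (2 ^ (M - 1) : ℕ) + 4 := by
  refine add_le_add ?_ ?_
  · have h1 : ∀ x : Fin A → List Bool, (((blocks x j).map (syncCost M)).sum : ℝ≥0∞) =
        ∑ b, (syncCost M (x (j b)) : ℝ≥0∞) := by
      intro x
      rw [blocks, List.map_ofFn, List.sum_ofFn]
      push_cast
      rfl
    simp_rw [h1, ex_sum]
    calc 4 * ∑ b, (ex (prodBits A l) fun x => (syncCost M (x (j b)) : ℝ≥0∞))
        ≤ 4 * ∑ _b : Fin B, (56 * 2 ^ (M - 1) : ℝ≥0∞) := by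
          gcongr with b
          rw [ex_prodBits_apply l (j b) fun y => (syncCost M y : ℝ≥0∞)]
          exact ex_syncCost_le hM _
      _ = _ := by
          rw [Finset.sum_const, Finset.card_univ, Fintype.card_fin, nsmul_eq_mul]
          push_cast
          ring
  · set n := ∑ b, l (j b)
    calc 4 * (n : ℝ≥0∞) * pr (prodBits A l) (fun x => ¬ NoRepeat (2 ^ (M - 1)) (blocks x j))
        ≤ 4 * (n : ℝ≥0∞) * ((n : ℝ≥0∞) ^ 2 * 2⁻¹ ^ (2 ^ (M - 1))) := by
          gcongr
          exact pr_not_noRepeat_le (Nat.one_le_two_pow) l j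
      _ = 4 * ((n : ℝ≥0∞) ^ 3 * 2⁻¹ ^ (2 ^ (M - 1))) := by ring
      -- Here `n^3 ≤ 2^(3L)`, and a chunk length of at least `4L` absorbs the cube: two factors come
      -- from the union bound and one from the crude code length.
      _ ≤ 4 * ((2 : ℝ≥0∞) ^ (2 ^ (M - 1)) * 2⁻¹ ^ (2 ^ (M - 1))) := by
          gcongr 4 * (?_ * _)
          have h2 : (n : ℝ) ^ 3 ≤ 2 ^ (2 ^ (M - 1) : ℕ) := by
            calc (n : ℝ) ^ 3 ≤ ((2 : ℝ) ^ L) ^ 3 := by gcongr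
              _ = (2 : ℝ) ^ (L * 3) := by
                  rw [Real.rpow_mul (by norm_num)]
                  norm_cast
              _ ≤ (2 : ℝ) ^ (((2 ^ (M - 1) : ℕ) : ℝ)) :=
                  Real.rpow_le_rpow_of_exponent_le (by norm_num) (by linarith only [hN, hL])
              _ = _ := Real.rpow_natCast _ _
          exact_mod_cast h2
      _ = 4 := by
          rw [← mul_pow, ENNReal.mul_inv_cancel (by norm_num) (by norm_num), one_pow, mul_one]

theorem two_mul_A_sq_le (hEL : 6 * m.logSize ≤ m.EL) {n : ℕ} (hn : n ∈ m.lengthLaw.support) :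
    2 * m.A ^ 2 ≤ 2 ^ n := by
  have h1 : (2 : ℝ) ≤ m.A := by exact_mod_cast m.two_le_A
  have h2 : (1 : ℝ) ≤ m.B := by exact_mod_cast m.one_le_B
  have h3 := m.four_le_EL
  have h4 := m.EL_div_two_le hn
  have h5 : (2 : ℝ) * m.A ^ 2 ≤ 2 ^ n := by
    calc (2 : ℝ) * m.A ^ 2 ≤ (m.A : ℝ) * (m.A : ℝ) ^ 2 := by gcongr
      _ = ((m.A : ℝ) * 1 * 1) ^ 3 := by ring
      _ ≤ ((m.A : ℝ) * m.B * m.EL) ^ 3 := by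
          gcongr
          linarith
      _ = (2 : ℝ) ^ (m.logSize * 3) := by
          rw [← two_rpow_logSize, Real.rpow_mul (by norm_num)]
          norm_cast
      _ ≤ (2 : ℝ) ^ (n : ℝ) := Real.rpow_le_rpow_of_exponent_le (by norm_num) (by linarith)
      _ = 2 ^ n := Real.rpow_natCast _ _
  exact_mod_cast h5

/-- Long symbols: up to `O(B log (A B E(L)))` bits, only the first occurrences of the symbols
cost anything. -/
theorem ex_mcEncode_le (K : IntCode) (hEL : 6 * m.logSize ≤ m.EL) {M : ℕ} (hM : 1 ≤ M)
    (hN : 4 * m.logSize ≤ (2 ^ (M - 1) : ℕ)) (hN' : ((2 ^ (M - 1) : ℕ) : ℝ) ≤ 9 * m.logSize) :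
    (ex m.sourceLaw fun s => ((mcEncode K M s).length : ℝ≥0∞)) ≤
      m.usedLength + ENNReal.ofReal (4073 * m.B * m.logSize) := by
  classical
  have hL := m.three_le_logSize
  have hB : (1 : ℝ) ≤ m.B := by exact_mod_cast m.one_le_B
  set L := m.logSize with hLdef
  have hBL : L ≤ m.B * L := le_mul_of_one_le_left (by linarith) hB
  rw [ex_sourceLaw, usedLength, ← ex_const (iid m.lengthLaw m.A) (ENNReal.ofReal _), ← ex_add]
  refine ex_mono_support _ fun l hl => ?_
  rw [← ex_const (iid (PMF.uniformOfFintype (Fin m.A)) m.B) (ENNReal.ofReal _), ← ex_add]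
  refine ex_mono_support _ fun j hj => ?_
  set n := ∑ b, l (j b) with hn
  have hn2 : (n : ℝ) ≤ 2 ^ L := length_le_two_rpow (sum_lengths_le hl j)
  set g : (Fin m.A → List Bool) → ℝ≥0∞ := fun x =>
    4 * (((blocks x j).map (syncCost M)).sum : ℝ≥0∞) +
      4 * (n : ℝ≥0∞) * if ¬ NoRepeat (2 ^ (M - 1)) (blocks x j) then 1 else 0 with hg
  have hpt : ∀ x ∈ (drawSymbols m.A l).support,
      ((mcEncode K M (blocks x j).flatten).length : ℝ≥0∞) ≤
        (((∑ a ∈ used j, l a : ℕ) : ℝ≥0∞) + ENNReal.ofReal (38 * m.B * L)) + g x := by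
    intro x hx
    obtain ⟨hlen, -⟩ := drawSymbols_spec hl hx
    have hfl := length_flatten_blocks hlen j
    have hmem : (blocks x j).flatten ∈ m.sourceLaw.support :=
      m.mem_support_sourceLaw.2 ⟨l, hl, x, hx, j, hj, rfl⟩
    have h1 := (length_of_mem_support hmem).1
    have h2 : (((blocks x j).flatten.length : ℕ) : ℝ) ≤ 2 ^ L := by rwa [hfl]
    have hbl : (blocks x j).length = m.B := by simp [blocks]
    have hreal : ((mcEncode K M (blocks x j).flatten).length : ℝ) ≤
        (∑ a ∈ used j, l a : ℕ) + 38 * m.B * L +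
          ((4 * ((blocks x j).map (syncCost M)).sum +
            if ¬ NoRepeat (2 ^ (M - 1)) (blocks x j) then 4 * n else 0 : ℕ) : ℝ) := by
      by_cases hno : NoRepeat (2 ^ (M - 1)) (blocks x j)
      · have h3 := length_mcEncode_blocks K hM hL hN hno (by rw [hbl]; exact m.one_le_B) h1 h2
        have h4 := sum_toFinset_blocks_le x j
        simp_rw [hlen] at h4
        have h5 : ((∑ y ∈ (blocks x j).toFinset, y.length : ℕ) : ℝ) ≤
          (∑ a ∈ used j, l a : ℕ) := by exact_mod_cast h4
        rw [hbl] at h3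
        rw [if_neg (not_not.2 hno)]
        push_cast at h3 h5 ⊢
        linarith
      · have h3 := length_mcEncode_trivial K hL hN h1 h2
        rw [hfl, ← hn] at h3
        rw [if_pos hno]
        push_cast
        have h6 : (0 : ℝ) ≤ ∑ a ∈ used j, (l a : ℝ) :=
          Finset.sum_nonneg fun _ _ => Nat.cast_nonneg _
        have h7 : (0 : ℝ) ≤ (((blocks x j).map (syncCost M)).sum : ℕ) := Nat.cast_nonneg _
        push_cast at h7
        nlinarith
    rw [← ENNReal.ofReal_natCast]
    refine (ENNReal.ofReal_le_ofReal hreal).trans (le_of_eq ?_)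
    rw [ENNReal.ofReal_add (by positivity) (by positivity), ENNReal.ofReal_add (by positivity)
      (by positivity), ENNReal.ofReal_natCast, ENNReal.ofReal_natCast, hg]
    congr 1
    push_cast
    congr 1
    split_ifs <;> simp
  refine (ex_mono_support _ hpt).trans ?_
  rw [ex_add, ex_const, add_assoc]
  gcongr
  have hdom := ex_drawSymbols_le (fun a => two_mul_A_sq_le hEL (mem_support_of_iid hl a)) g
  have hexc := ex_excess_le hM hN (by linarith) (l := l) (j := j) hn2
  have hg2 : ex (prodBits m.A l) g ≤ 224 * m.B * (2 ^ (M - 1) : ℕ) + 4 := by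
    refine le_trans (le_of_eq ?_) hexc
    rw [hg, ex_add, ex_mul_left, ex_mul_left]
    unfold pr
    congr!
  calc ENNReal.ofReal (38 * m.B * L) + ex (drawSymbols m.A l) g
      ≤ ENNReal.ofReal (38 * m.B * L) + 2 * (224 * m.B * (2 ^ (M - 1) : ℕ) + 4) := by
        gcongr
        exact hdom.trans (by gcongr)
    _ = ENNReal.ofReal (38 * m.B * L + 2 * (224 * m.B * (2 ^ (M - 1) : ℕ) + 4)) := by
        rw [ENNReal.ofReal_add (by positivity) (by positivity)]
        congr 1
        have : (2 * (224 * m.B * (2 ^ (M - 1) : ℕ) + 4) : ℝ) =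
          ((2 * (224 * m.B * 2 ^ (M - 1) + 4) : ℕ) : ℝ) := by push_cast; ring
        rw [this, ENNReal.ofReal_natCast]
        push_cast
        ring
    -- With `2^(M-1) ≤ 9L` the sum is at most `(38 + 4032) B L + 8`, and `8 ≤ 3 B L` because `B L ≥
    -- 3`.
    _ ≤ _ := by
        apply ENNReal.ofReal_le_ofReal
        have : (m.B : ℝ) * (2 ^ (M - 1) : ℕ) ≤ m.B * (9 * L) := by gcongr
        nlinarith

theorem mcRate_le_expectedBits (K : IntCode) {M : ℕ} (hM : 1 ≤ M) :
    mcRate K m ≤ (ex m.sourceLaw fun s => ((mcEncode K M s).length : ℝ≥0∞)).toReal := by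
  have h := ciInf_le (f := fun M : ℕ+ => expectedBits m.sourceLaw (mcEncode K M)) ⟨0, by
    rintro _ ⟨M, rfl⟩
    simp only [expectedBits_eq]
    exact ENNReal.toReal_nonneg⟩ ⟨M, hM⟩
  rw [← expectedBits_eq]
  exact h

/-- Multi-chunk deduplication is optimal up to `O(B log (A B E(L)))` bits. -/
theorem mcRate_le (K : IntCode) (m : SourceModel) :
    mcRate K m ≤ optimalRate m + 4074 * (m.B * m.logSize) := by
  obtain ⟨M, hM, hN, hN'⟩ := m.exists_anchor
  have hmc := mcRate_le_expectedBits (m := m) K hM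
  have hL := m.three_le_logSize
  have hB : (1 : ℝ) ≤ m.B := by exact_mod_cast m.one_le_B
  have hBL : m.logSize ≤ m.B * m.logSize := le_mul_of_one_le_left (by linarith) hB
  have hBB : (m.B : ℝ) ≤ m.B * m.logSize := le_mul_of_one_le_right (by linarith) (by linarith)
  -- Long symbols allow comparison with independent draws, since then `2 A^2 ≤ 2^l`. Otherwise the
  -- string has at most `12 B L` bits, and the crude bound gives `48 B L + 18 L ≤ 66 B L`.
  rcases le_or_gt (6 * m.logSize) m.EL with hEL | hEL
  · have h1 := ex_mcEncode_le K hEL hM hN hN'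
    rw [← sub_le_iff_le_add]
    refine le_optimalRate K fun f hf => ?_
    rw [ENNReal.ofReal_le_iff_le_toReal (ex_ne_top f), sub_le_iff_le_add]
    have h2 := h1.trans (add_le_add_left (usedLength_le hf) _)
    have h3 := ENNReal.toReal_mono (ENNReal.add_ne_top.2
      ⟨ENNReal.add_ne_top.2 ⟨ex_ne_top f, ENNReal.natCast_ne_top _⟩, ENNReal.ofReal_ne_top⟩) h2
    rw [ENNReal.toReal_add (ENNReal.add_ne_top.2 ⟨ex_ne_top f, ENNReal.natCast_ne_top _⟩)
      ENNReal.ofReal_ne_top, ENNReal.toReal_add (ex_ne_top f) (ENNReal.natCast_ne_top _),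
      ENNReal.toReal_ofReal (by positivity), ENNReal.toReal_natCast] at h3
    linarith
  · have hopt := one_le_optimalRate (m := m) K
    have h1 : (ex m.sourceLaw fun s => ((mcEncode K M s).length : ℝ≥0∞)) ≤
        ENNReal.ofReal (66 * (m.B * m.logSize)) := by
      refine ex_le_of_support _ fun s hs => ?_
      obtain ⟨hs1, hs2⟩ := length_of_mem_support hs
      have h2 := length_mcEncode_trivial K hL hN hs1 (length_le_two_rpow hs2)
      rw [← ENNReal.ofReal_natCast]
      apply ENNReal.ofReal_le_ofReal
      have h3 : (m.B : ℝ) * m.EL ≤ m.B * (6 * m.logSize) := by gcongr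
      nlinarith
    have h2 := ENNReal.toReal_mono ENNReal.ofReal_ne_top h1
    rw [ENNReal.toReal_ofReal (by positivity)] at h2
    linarith

theorem optimalRate_le_mcRate (K : IntCode) (m : SourceModel) : optimalRate m ≤ mcRate K m :=
  le_ciInf fun M => optimalRate_le ((prefixFreeOn_mcEncode K M).mono fun _ hs =>
    List.length_pos_iff.1 (length_of_mem_support hs).1)

end SourceModel

end Dedup

/-! ### From additive redundancy to the ratio bounds in the two regimes -/

namespace Dedup

namespace SourceModel

/-- The first term is at most twice the optimal rate by `min_mul_le_optimalRate`. The rest is at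
most `B log A - 2 B log (2 E(L))`, hence at most the optimal rate by `log_le_optimalRate`. -/
theorem boundDenom_le (K : IntCode) (m : SourceModel) :
    boundDenom m ≤ 3 * optimalRate m := by
  have h1 := min_mul_le_optimalRate (m := m) K
  have h2 := log_le_optimalRate (m := m) K
  have h3 := one_le_optimalRate (m := m) K
  have hEL := m.four_le_EL
  have hA : (2 : ℝ) ≤ m.A := by exact_mod_cast m.two_le_A
  have hB : (1 : ℝ) ≤ m.B := by exact_mod_cast m.one_le_B
  refine max_le ?_ (by linarith)
  rw [Real.logb_div (by positivity) (by positivity)] at h2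
  have h4 : 0 ≤ Real.logb 2 (2 * m.EL) := Real.logb_nonneg (by norm_num) (by linarith)
  have h5 : 0 ≤ Real.logb 2 ((m.A : ℝ) / 2) := Real.logb_nonneg (by norm_num) (by linarith)
  have h6 : Real.logb 2 ((m.A : ℝ) / 2) ≤ Real.logb 2 m.A :=
    Real.logb_le_logb_of_le (by norm_num) (by positivity) (by linarith)
  have h7 : max ((m.B : ℝ) - m.A) 0 ≤ m.B := max_le (by linarith) (by linarith)
  have h8 : max ((m.B : ℝ) - m.A) 0 * Real.logb 2 ((m.A : ℝ) / 2) ≤ m.B * Real.logb 2 m.A :=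
    mul_le_mul h7 h6 h5 (by linarith)
  have h9 : 0 ≤ m.B * Real.logb 2 (2 * m.EL) := mul_nonneg (by linarith) h4
  linarith

theorem mcRate_div_le (K : IntCode) (m : SourceModel) :
    mcRate K m / optimalRate m ≤ 1 + 4074 * (m.B * m.logSize / optimalRate m) := by
  have h := mcRate_le K m
  have h1 := one_le_optimalRate (m := m) K
  rw [div_le_iff₀ (by linarith)]
  have : (1 + 4074 * (m.B * m.logSize / optimalRate m)) * optimalRate m =
      optimalRate m + 4074 * (m.B * m.logSize) := by
    have h0 : optimalRate m ≠ 0 := by linarith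
    field_simp
  rw [this]
  exact h

theorem logSize_eq (m : SourceModel) :
    m.logSize = Real.logb 2 m.A + Real.logb 2 m.B + Real.logb 2 m.EL := by
  have hEL := m.four_le_EL
  have hA : (2 : ℝ) ≤ m.A := by exact_mod_cast m.two_le_A
  have hB : (1 : ℝ) ≤ m.B := by exact_mod_cast m.one_le_B
  unfold logSize
  rw [Real.logb_mul (by positivity) (by positivity), Real.logb_mul (by positivity) (by positivity)]

/-- In the regime of order optimality, the redundancy is of the order of the optimal rate. -/
theorem mul_logSize_le (K : IntCode) {m : SourceModel} {ε : ℝ} (hε : 0 < ε) (hε1 : ε ≤ 1)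
    (hA : (m.B : ℝ) ^ ε ≤ m.A) (hEL : m.EL ≤ (m.A : ℝ) ^ (ε / 3)) (hA8 : (8 : ℝ) ≤ m.A) :
    m.B * m.logSize ≤ 3 * (2 + 1 / ε) * optimalRate m := by
  have h1 := log_le_optimalRate (m := m) K
  have hEL4 := m.four_le_EL
  have hB : (1 : ℝ) ≤ m.B := by exact_mod_cast m.one_le_B
  have hA0 : (0 : ℝ) < m.A := by linarith
  set a := Real.logb 2 (m.A : ℝ) with ha
  have ha3 : 3 ≤ a := by
    rw [ha, Real.le_logb_iff_rpow_le (by norm_num) hA0]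
    rwa [show (2 : ℝ) ^ (3 : ℝ) = 8 by norm_num]
  have hb : Real.logb 2 (m.B : ℝ) ≤ a * (1 / ε) := by
    have h2 := Real.logb_le_logb_of_le (b := 2) (by norm_num) (by positivity) hA
    rw [Real.logb_rpow_eq_mul_logb_of_pos (by linarith)] at h2
    rw [mul_one_div, le_div_iff₀ hε, mul_comm]
    exact h2
  have he : Real.logb 2 m.EL ≤ a / 3 := by
    have h2 := Real.logb_le_logb_of_le (b := 2) (by norm_num) (by linarith) hEL
    rw [Real.logb_rpow_eq_mul_logb_of_pos hA0] at h2
    have : ε / 3 * a ≤ 1 / 3 * a := by gcongr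
    linarith
  -- From `log E(L) ≤ a/3` and `a ≥ 3`, the left-over `a - 1 - a/3` is at least `a/3`.
  have h3 : a / 3 ≤ Real.logb 2 (m.A / (2 * m.EL)) := by
    rw [Real.logb_div (by positivity) (by positivity), Real.logb_mul (by norm_num) (by positivity),
      Real.logb_self_eq_one (by norm_num)]
    linarith
  have h4 : m.logSize ≤ (2 + 1 / ε) * a := by
    rw [logSize_eq]
    linarith
  calc m.B * m.logSize ≤ m.B * ((2 + 1 / ε) * a) := by gcongr
    _ = 3 * (2 + 1 / ε) * (m.B * (a / 3)) := by ring
    _ ≤ 3 * (2 + 1 / ε) * optimalRate m := by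
        gcongr
        exact le_trans (by gcongr) h1

/-- In the regime of asymptotic optimality, the redundancy is controlled by
`B log (A E(L)) / (A E(L))`. -/
theorem mul_logSize_div_le (K : IntCode) {m : SourceModel} (hAB : m.A ≤ m.B)
    (hB : (m.B : ℝ) ≤ m.A * m.EL / Real.logb 2 (m.A * m.EL)) :
    m.B * m.logSize / optimalRate m ≤
      8 * (m.B / (m.A * m.EL / Real.logb 2 (m.A * m.EL))) := by
  have hEL := m.four_le_EL
  have hA : (2 : ℝ) ≤ m.A := by exact_mod_cast m.two_le_A
  have hB1 : (1 : ℝ) ≤ m.B := by exact_mod_cast m.one_le_B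
  have hAB' : (m.A : ℝ) ≤ m.B := by exact_mod_cast hAB
  have h1 := min_mul_le_optimalRate (m := m) K
  have h0 := one_le_optimalRate (m := m) K
  rw [min_eq_left hAB'] at h1
  set t : ℝ := m.A * m.EL with ht
  have ht8 : 8 ≤ t := by nlinarith
  have hlog : 1 ≤ Real.logb 2 t := by
    rw [Real.le_logb_iff_rpow_le (by norm_num) (by linarith)]
    norm_num
    linarith
  -- Uses `(E(L) - 1)/2 ≥ E(L)/4`, valid since `E(L) ≥ 4`.
  have h2 : t / 4 ≤ optimalRate m := by
    refine le_trans ?_ h1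
    nlinarith
  have h3 : (m.B : ℝ) ≤ t := hB.trans (div_le_self (by linarith) hlog)
  have h4 : m.logSize ≤ 2 * Real.logb 2 t := by
    have h5 : m.logSize = Real.logb 2 m.B + Real.logb 2 t := by
      unfold logSize
      rw [show (m.A : ℝ) * m.B * m.EL = m.B * t by rw [ht]; ring,
        Real.logb_mul (by positivity) (by positivity)]
    have h6 := Real.logb_le_logb_of_le (b := 2) (by norm_num) (by linarith) h3
    linarith
  calc m.B * m.logSize / optimalRate m ≤ m.B * (2 * Real.logb 2 t) / (t / 4) := by
        gcongr
    _ = 8 * (m.B / (t / Real.logb 2 t)) := by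
        have : Real.logb 2 t ≠ 0 := by linarith
        have : t ≠ 0 := by linarith
        field_simp
        norm_num

end SourceModel

end Dedup

/-! ### Assembly of the four claims -/

theorem theorem3 :
    -- the scheme is never better than the optimal prefix-free code
    (∀ (K : Dedup.IntCode) (m : Dedup.SourceModel),
      1 ≤ Dedup.mcRate K m / Dedup.optimalRate m) ∧
    -- the upper bound, with a universal constant (it is void where the denominator vanishes)
    (∃ C : ℝ, 0 < C ∧ ∃ B₀ : ℕ, ∀ (K : Dedup.IntCode) (m : Dedup.SourceModel), B₀ ≤ m.B →
      0 < Dedup.boundDenom m →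
      Dedup.mcRate K m / Dedup.optimalRate m ≤
        1 + C * ((m.B : ℝ) * Real.logb 2 ((m.A : ℝ) * (m.B : ℝ) * m.EL) / Dedup.boundDenom m)) ∧
    -- order optimality, with a constant that depends only on `ε`
    (∀ ε : ℝ, 0 < ε → ∃ C : ℝ, 0 < C ∧ ∃ B₀ : ℕ,
      ∀ (K : Dedup.IntCode) (m : Dedup.SourceModel), B₀ ≤ m.B →
        (m.B : ℝ) ^ ε ≤ (m.A : ℝ) → (m.A : ℝ) ≤ (1 - ε) * (m.B : ℝ) →
        m.EL ≤ (m.A : ℝ) ^ (ε / 3) →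
        Dedup.mcRate K m ≤ C * Dedup.optimalRate m) ∧
    -- asymptotic optimality along every sequence of sources with `B → ∞`
    (∀ (K : Dedup.IntCode) (m : ℕ → Dedup.SourceModel),
      Filter.Tendsto (fun n => (m n).B) Filter.atTop Filter.atTop →
      (∀ᶠ n in Filter.atTop, (m n).A ≤ (m n).B) →
      (fun n => ((m n).B : ℝ)) =o[Filter.atTop]
        (fun n => ((m n).A : ℝ) * (m n).EL / Real.logb 2 (((m n).A : ℝ) * (m n).EL)) →
      Filter.Tendsto (fun n => Dedup.mcRate K (m n) / Dedup.optimalRate (m n))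
        Filter.atTop (nhds 1)) := by
  open Dedup Dedup.SourceModel in
  have hratio : ∀ (K : IntCode) (m : SourceModel), 1 ≤ mcRate K m / optimalRate m := by
    intro K m
    have h := one_le_optimalRate (m := m) K
    rw [one_le_div (by linarith)]
    exact optimalRate_le_mcRate K m
  -- The constant is `3 * 4074`: the redundancy constant times the factor lost in `boundDenom_le`.
  refine ⟨hratio, ⟨12222, by norm_num, 0, ?_⟩, ?_, ?_⟩
  · intro K m _ hden
    refine (mcRate_div_le K m).trans ?_
    have h1 := boundDenom_le K m
    have h2 : 0 < optimalRate m := by linarith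
    have hL := m.three_le_logSize
    have h3 : m.B * m.logSize / optimalRate m ≤ 3 * (m.B * m.logSize / boundDenom m) := by
      rw [div_le_iff₀ h2, mul_comm 3, mul_assoc, div_mul_eq_mul_div, le_div_iff₀ hden]
      exact mul_le_mul_of_nonneg_left h1 (by positivity)
    change 1 + 4074 * (m.B * m.logSize / optimalRate m) ≤
      1 + 12222 * (m.B * m.logSize / boundDenom m)
    linarith
  · intro ε hε
    -- The threshold on `B` makes `A ≥ B^ε ≥ 8`, so that `log A ≥ 3` as `mul_logSize_le` needs.
    refine ⟨1 + 4074 * (3 * (2 + 1 / ε)), by positivity, ⌈(8 : ℝ) ^ (1 / ε)⌉₊, ?_⟩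
    intro K m hB hA hA1 hEL
    have hA2 : (2 : ℝ) ≤ m.A := by exact_mod_cast m.two_le_A
    have hB1 : (1 : ℝ) ≤ m.B := by exact_mod_cast m.one_le_B
    -- For `ε > 1` the upper bound `(1 - ε) B` on `A` would be negative.
    have hε1 : ε ≤ 1 := by
      by_contra hcon
      push Not at hcon
      nlinarith
    have hA8 : (8 : ℝ) ≤ m.A := by
      refine le_trans ?_ hA
      have h1 : (8 : ℝ) ^ (1 / ε) ≤ m.B := Nat.ceil_le.1 hB
      calc (8 : ℝ) = ((8 : ℝ) ^ (1 / ε)) ^ ε := by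
            rw [← Real.rpow_mul (by norm_num), one_div_mul_cancel hε.ne', Real.rpow_one]
        _ ≤ _ := Real.rpow_le_rpow (by positivity) h1 hε.le
    have h1 := mcRate_le K m
    have h2 := mul_logSize_le K hε hε1 hA hEL hA8
    linarith
  · intro K m _ hAB ho
    have hlim := ho.tendsto_div_nhds_zero
    have hev := ho.bound (c := 1) one_pos
    have hup : Filter.Tendsto (fun n => 1 + 4074 * (8 * (((m n).B : ℝ) /
        (((m n).A : ℝ) * (m n).EL / Real.logb 2 (((m n).A : ℝ) * (m n).EL)))))
        Filter.atTop (nhds 1) := by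
      simpa using ((hlim.const_mul 8).const_mul 4074).const_add 1
    refine tendsto_of_tendsto_of_tendsto_of_le_of_le' tendsto_const_nhds hup
      (Filter.Eventually.of_forall fun n => hratio K (m n)) ?_
    filter_upwards [hAB, hev] with n hn hb
    refine (mcRate_div_le K (m n)).trans ?_
    have hEL := (m n).four_le_EL
    have hA : (2 : ℝ) ≤ (m n).A := by exact_mod_cast (m n).two_le_A
    have hb' : ((m n).B : ℝ) ≤ (m n).A * (m n).EL / Real.logb 2 ((m n).A * (m n).EL) := by
      rw [one_mul, Real.norm_of_nonneg (Nat.cast_nonneg _), Real.norm_of_nonneg] at hb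
      · exact hb
      · exact div_nonneg (by positivity) (Real.logb_nonneg (by norm_num) (by nlinarith))
    have := mul_logSize_div_le K hn hb'
    linarith
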